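/- Fix $0<\varepsilon\le 1$. A map of an open subset of $\mathbb C=\mathbb R^2$ is $C^{1+\varepsilon}$ if it is $C^1$ (in the real sense) with locally $\varepsilon$-Hölder derivative. Two maps $f,h$ are $\delta$-close in $C^{1+\varepsilon}$ on a set $S$ if, for $e=f-h$ and all $x,y\in S$, $|e(x)|\le\delta$, $\|De(x)\|\le\delta$, $\|De(y)-De(x)\|\le\delta|y-x|^{\varepsilon}$ and $|e(y)-e(x)-De(x)(y-x)|\le\delta|y-x|^{1+\varepsilon}$. **Conformal Cantor sets.** Let $\mathbb A$ be a finite alphabet, $B\subset\mathbb A\times\mathbb A$ a set of admissible pairs, and suppose that the subshift $\Sigma=\{(a_i)_{i\ge0}:(a_i,a_{i+1})\in B\ \forall i\}$ is topologically mixing. $\Omega_\Sigma$ is the set of all data consisting of pairwise disjoint compact connected sets $G(a)=\overline{\operatorname{int}G(a)}\subset\mathbb C$, $a\in\mathbb A$, and a $C^{1+\varepsilon}$ map $g:V\to\mathbb C$ on an open set $V\supset\bigcup_aG(a)$ such that: near each $G(a)$, $g$ is a $C^{1+\varepsilon}$ embedding with $|Dg(x)v|\ge\mu|v|$ for some $\mu>1$;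 $G(b)\subset g(\operatorname{int}G(a))$ if $(a,b)\in B$ and $G(b)\cap g(G(a))=\emptyset$ otherwise; and $Dg(x)$ is multiplication by a complex number at every point $x$ of $K=\bigcap_{n\ge0}g^{-n}(\bigcup_aG(a))$. Put $K(a)=K\cap G(a)$. For $\delta>0$ let $U_{g,\delta}$ be the set of $\tilde g\in\Omega_\Sigma$ with $G(a)\subset V_\delta(\tilde G(a))$ and $\tilde G(a)\subset V_\delta(G(a))$ for all $a$ ($V_\delta$ is the open $\delta$-neighbourhood) and with $g,\tilde g$ $\delta$-close in $C^{1+\varepsilon}$ on $V\cap\tilde V$; these sets are the basic neighbourhoods of $g$. **Limit geometries.** Let $\Sigma^-=\{(\dots,\theta_{-1},\theta_0):(\theta_{-i-1},\theta_{-i})\in B\ \forall i\ge 0\}$ with the product topology. Fix base points $c_a\in K(a)$ for all $a$. With $f_{(a,b)}=(g|_{G(a)})^{-1}$ on $G(b)$ for $(a,b)\in B$, put $f_{\theta_n}=f_{(\theta_{-n},\theta_{-n+1})}\circ\dots\circ f_{(\theta_{-1},\theta_0)}$, let $\Phi_{\theta_n}\in \mathrm{Aff}(\mathbb C)=\{z\mapsto\alpha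 z+\beta:\alpha\in\mathbb C^*,\beta\in\mathbb C\}$ be the map for which $\Phi_{\theta_n}\circ f_{\theta_n}$ has value $0$ and derivative $1$ at $c_{\theta_0}$, and let $k^\theta=\lim_n\Phi_{\theta_n}\circ f_{\theta_n}:G(\theta_0)\to\mathbb C$ be the limit geometry of $\theta\in\Sigma^-$. For $(\theta_0,b)\in B$ let $\theta b=(\dots,\theta_{-1},\theta_0,b)$ and $F^{\theta b}=\lim_n\Phi_{\theta_n}\circ\Phi_{(\theta b)_{n+1}}^{-1}\in\mathrm{Aff}(\mathbb C)$, so that $F^{\theta b}\circ k^{\theta b}=k^\theta\circ f_{(\theta_0,b)}$. The renormalization operators on $\mathcal A=\mathrm{Aff}(\mathbb C)\times\Sigma^-$ are $T_{\theta_0,b}(A,\theta)=(A\circ F^{\theta b},\theta b)$ and, for an admissible word $\underline a=(a_0,\dots,a_n)$ of size $n$ with $a_0=\theta_0$, the successive application $T_{\underline a}$ of $T_{a_0,a_1},\dots,T_{a_{n-1},a_n}$. **Recurrent compact sets.** Let also $g'\in\Omega_{\Sigma'}$ be given, with base points $c_{a'}$ and objects $\mathbb A',K',k^{\theta'},\mathcal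 A',\dots$ Let $\mathcal C$ be the quotient of $\mathcal A\times\mathcal A'$ by the diagonal left action of $\mathrm{Aff}(\mathbb C)$, with the quotient topology; pairs of words act on it by $\mathcal T_{\underline a,\underline a'}=(T_{\underline a},T_{\underline a'})$. A compact set $\mathcal L\subset\mathcal C$ is recurrent for $(g,g')$ and the given base points if for each $v\in\mathcal L$ there are words $\underline a,\underline a'$, not both of size $0$, with $\mathcal T_{\underline a,\underline a'}(v)\in\operatorname{int}\mathcal L$; it is immediately recurrent if one can always take words of total size one. **Stable intersections.** A configuration of $G(a)$ is a map on $G(a)$ that extends to a $C^{1+\varepsilon}$ embedding of a neighbourhood of $G(a)$. A pair $(h,h')$ of configurations of $G(a),G'(a')$ has stable intersections if there is $\delta>0$ such that $\tilde h(\tilde K(a))\cap\tilde h'(\tilde K'(a'))\neq\emptyset$ for all $\tilde g\in U_{g,\delta}$, $\tilde g'\in U_{g',\delta}$ and all configurations $\tilde h,\tilde h'$ of $\tilde G(a),\tilde G'(a')$ that are $\delta$-close in $C^{1+\varepsilon}$ to $h,h'$ on $\operatorname{int}G(a)\cap\operatorname{int}\tilde G(a)$ and $\operatorname{int}G'(a')\cap\operatorname{int}\tilde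 G'(a')$, respectively. **Theorem B.** Let $g\in\Omega_\Sigma$, $g'\in\Omega_{\Sigma'}$ with base points $c_a\in K(a)$, $c_{a'}\in K'(a')$. 1. Every recurrent compact set is contained in an immediately recurrent compact set. 2. Let $\mathcal L\subset\mathcal C$ be a recurrent (resp. immediately recurrent) compact set for $(g,g')$ and the given base points. For every $\eta>0$ there is $\delta>0$ such that for all $\tilde g\in U_{g,\delta}$, $\tilde g'\in U_{g',\delta}$ there are base points $\tilde c_a\in\tilde K(a)$, $\tilde c_{a'}\in\tilde K'(a')$ with $|\tilde c_a-c_a|<\eta$ and $|\tilde c_{a'}-c_{a'}|<\eta$ for all $a,a'$, for which $\mathcal L$ is also a recurrent (resp. immediately recurrent) compact set for $(\tilde g,\tilde g')$. 3. If $\mathcal L$ is a recurrent compact set and $[(A,\theta),(A',\theta')]\in\mathcal L$, then the pair $(A\circ k^{\theta},A'\circ k^{\theta'})$ of configurations of $G(\theta_0),G'(\theta'_0)$ has stable intersections. -/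

import Mathlib

open Set Filter Topology

noncomputable section

namespace ConfCantor

/-! ### The group of complex affine transformations -/

/-- The complex affine transformation `z ↦ lin * z + tr` with `lin ∈ ℂ \ {0}` and `tr ∈ ℂ`. -/
@[ext]
structure AffC where
  lin : ℂˣ
  tr : ℂ

namespace AffC

/-- The map of the plane given by an affine transformation. -/
def app (S : AffC) (z : ℂ) : ℂ := S.lin * z + S.tr

instance : One AffC := ⟨⟨1, 0⟩⟩

/-- The product is composition: `S * T` is `S ∘ T`. -/
instance : Mul AffC := ⟨fun S T => ⟨S.lin * T.lin, S.lin * T.tr + S.tr⟩⟩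

instance : Inv AffC := ⟨fun S => ⟨S.lin⁻¹, -((S.lin⁻¹ : ℂˣ) * S.tr)⟩⟩

theorem one_lin : (1 : AffC).lin = 1 := rfl

theorem one_tr : (1 : AffC).tr = 0 := rfl

theorem mul_lin (S T : AffC) : (S * T).lin = S.lin * T.lin := rfl

theorem mul_tr (S T : AffC) : (S * T).tr = S.lin * T.tr + S.tr := rfl

theorem inv_lin (S : AffC) : S⁻¹.lin = S.lin⁻¹ := rfl

theorem inv_tr (S : AffC) : S⁻¹.tr = -((S.lin⁻¹ : ℂˣ) * S.tr) := rfl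

instance : Group AffC :=
  Group.ofLeftAxioms
    (fun S T R => by
      ext
      · simp only [mul_lin, mul_assoc]
      · simp only [mul_lin, mul_tr, Units.val_mul]; ring)
    (fun S => by
      ext
      · simp only [mul_lin, one_lin, one_mul]
      · simp only [mul_tr, one_lin, one_tr, Units.val_one]; ring)
    (fun S => by
      ext
      · simp only [mul_lin, inv_lin, one_lin, inv_mul_cancel]
      · simp only [mul_tr, inv_lin, inv_tr, one_tr]; ring)

theorem mul_app (S T : AffC) (z : ℂ) : (S * T).app z = S.app (T.app z) := by
  simp only [app, mul_lin, mul_tr, Units.val_mul]; ring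

instance : Inhabited AffC := ⟨1⟩

/-- The topology of `ℂˣ × ℂ`. -/
instance : TopologicalSpace AffC :=
  TopologicalSpace.induced (fun S => (S.lin, S.tr)) inferInstance

end AffC

/-! ### Subshifts of finite type -/

/-- The one-sided shift space `Σ` of sequences `(a₀, a₁, …)` with `(aᵢ, aᵢ₊₁)` admissible. -/
def PosSeq {A : Type*} (B : A → A → Prop) : Type _ :=
  {x : ℕ → A // ∀ i, B (x i) (x (i + 1))}

/-- The product topology, for the discrete topology on the alphabet. -/
instance {A : Type*} (B : A → A → Prop) : TopologicalSpace (PosSeq B) :=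
  TopologicalSpace.induced (fun x => x.1) (@Pi.topologicalSpace ℕ (fun _ => A) (fun _ => ⊥))

/-- The shift map on `Σ`. -/
def shift {A : Type*} {B : A → A → Prop} (x : PosSeq B) : PosSeq B :=
  ⟨fun i => x.1 (i + 1), fun i => x.2 (i + 1)⟩

/-- The subshift `Σ` is topologically mixing. -/
def IsTopMixing {A : Type*} (B : A → A → Prop) : Prop :=
  ∀ U W : Set (PosSeq B), IsOpen U → IsOpen W → U.Nonempty → W.Nonempty →
    ∃ N : ℕ, ∀ n ≥ N, ((shift^[n] '' U) ∩ W).Nonempty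

/-- The space `Σ⁻` of sequences `(…, θ₋₂, θ₋₁, θ₀)` with `(θ₋ᵢ₋₁, θ₋ᵢ)` admissible;
`θ.1 i` stands for `θ₋ᵢ`. -/
def NegSeq {A : Type*} (B : A → A → Prop) : Type _ :=
  {θ : ℕ → A // ∀ i, B (θ (i + 1)) (θ i)}

/-- The product topology, for the discrete topology on the alphabet. -/
instance {A : Type*} (B : A → A → Prop) : TopologicalSpace (NegSeq B) :=
  TopologicalSpace.induced (fun θ => θ.1) (@Pi.topologicalSpace ℕ (fun _ => A) (fun _ => ⊥))

/-- The sequence `(…, θ₋₁, θ₀, b)`. -/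
def NegSeq.snoc {A : Type*} {B : A → A → Prop} (θ : NegSeq B) (b : A) (h : B (θ.1 0) b) :
    NegSeq B :=
  ⟨fun i => Nat.casesOn i b θ.1, fun i => by
    cases i with
    | zero => exact h
    | succ j => exact θ.2 j⟩

/-! ### Maps of class `C^{1+ε}` -/

/-- `f` is of class `C^{1+ε}` on the open set `U`: it is `C¹` in the real sense and its
derivative is locally `ε`-Hölder. -/
def IsC1Holder (ε : ℝ) (f : ℂ → ℂ) (U : Set ℂ) : Prop :=
  ContDiffOn ℝ 1 f U ∧
    ∀ x ∈ U, ∃ W ∈ 𝓝 x, ∃ C : ℝ, ∀ y ∈ W ∩ U, ∀ z ∈ W ∩ U,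
      ‖fderiv ℝ f y - fderiv ℝ f z‖ ≤ C * ‖y - z‖ ^ ε

/-- `f` is a `C^{1+ε}` embedding of the open set `U` into the plane. By the inverse function
theorem its image is open and its inverse is of class `C^{1+ε}` too. -/
def IsC1HolderEmb (ε : ℝ) (f : ℂ → ℂ) (U : Set ℂ) : Prop :=
  IsC1Holder ε f U ∧ InjOn f U ∧ ∀ x ∈ U, Function.Injective (fderiv ℝ f x)

/-- `f` and `h` are at `C^{1+ε}` distance at most `δ` on the set `S`. As `S` need not be convex
(nor have a regular boundary), the `C^{1+ε}` norm of `f - h` is taken in the sense of Whitney: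
it bounds the values, the derivative, its `ε`-Hölder seminorm and the first order Taylor
remainder. On a convex set the last bound follows from the third. -/
def C1HolderClose (ε δ : ℝ) (f h : ℂ → ℂ) (S : Set ℂ) : Prop :=
  (∀ x ∈ S, ‖f x - h x‖ ≤ δ) ∧
  (∀ x ∈ S, ‖fderiv ℝ f x - fderiv ℝ h x‖ ≤ δ) ∧
  (∀ x ∈ S, ∀ y ∈ S,
    ‖(fderiv ℝ f y - fderiv ℝ h y) - (fderiv ℝ f x - fderiv ℝ h x)‖ ≤ δ * ‖y - x‖ ^ ε) ∧
  (∀ x ∈ S, ∀ y ∈ S,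
    ‖(f y - h y) - (f x - h x) - (fderiv ℝ f x - fderiv ℝ h x) (y - x)‖
      ≤ δ * ‖y - x‖ ^ (1 + ε))

/-! ### Conformal Cantor sets -/

/-- The maximal invariant set `⋂ₙ g⁻ⁿ(⋃ₐ G(a))`. -/
def maxInvariant {A : Type*} (G : A → Set ℂ) (g : ℂ → ℂ) : Set ℂ :=
  {x | ∀ n : ℕ, g^[n] x ∈ ⋃ a, G a}

/-- The space `Ω_Σ` of (the data of) conformal Cantor sets of class `C^{1+ε}` with admissible
pairs `B`. Only the values of `g` on `V` matter. -/
structure ConformalCantor {A : Type*} (B : A → A → Prop) (ε : ℝ) where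
  /-- the pieces -/
  G : A → Set ℂ
  /-- the domain of the expanding map -/
  V : Set ℂ
  /-- the expanding map -/
  g : ℂ → ℂ
  isCompact_G : ∀ a, IsCompact (G a)
  isConnected_G : ∀ a, IsConnected (G a)
  /-- every piece is the closure of its interior -/
  regular_G : ∀ a, closure (interior (G a)) = G a
  disjoint_G : ∀ a b, a ≠ b → Disjoint (G a) (G b)
  isOpen_V : IsOpen V
  G_subset_V : ∀ a, G a ⊆ V
  smooth : IsC1Holder ε g V
  /-- near every piece, `g` is an expanding embedding -/
  expanding : ∀ a, ∃ U : Set ℂ, IsOpen U ∧ G a ⊆ U ∧ U ⊆ V ∧ IsC1HolderEmb ε g U ∧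
    ∃ μ : ℝ, 1 < μ ∧ ∀ x ∈ U, ∀ v : ℂ, μ * ‖v‖ ≤ ‖fderiv ℝ g x v‖
  /-- the Markov property; pieces are covered by the image of the interior of a piece, because
  the pieces are taken to be closures of open pieces with the Markov property -/
  markov : ∀ a b, B a b → G b ⊆ g '' interior (G a)
  markov_not : ∀ a b, ¬ B a b → Disjoint (G b) (g '' G a)
  /-- on the Cantor set the derivative of `g` is the multiplication by a complex number -/
  conformal : ∀ x ∈ maxInvariant G g, ∃ l : ℂ, ∀ v : ℂ, fderiv ℝ g x v = l * v

namespace ConformalCantor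

variable {A : Type*} {B : A → A → Prop} {ε : ℝ}

/-- The Cantor set itself. -/
def cantorSet (K : ConformalCantor B ε) : Set ℂ := maxInvariant K.G K.g

/-- The part `K(a)` of the Cantor set in the piece `G(a)`. -/
def piece (K : ConformalCantor B ε) (a : A) : Set ℂ := K.cantorSet ∩ K.G a

/-- The family `c` is a choice of base points `c(a) ∈ K(a)`. -/
def IsBase (K : ConformalCantor B ε) (c : A → ℂ) : Prop := ∀ a, c a ∈ K.piece a

/-- `K₁` belongs to the basic neighbourhood `U_{K,δ}` of `K` in `Ω_Σ`: the pieces are close in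
the Hausdorff sense and the maps are `C^{1+ε}` close on the intersection of their domains. -/
def Near (δ : ℝ) (K K₁ : ConformalCantor B ε) : Prop :=
  (∀ a, K.G a ⊆ Metric.thickening δ (K₁.G a) ∧ K₁.G a ⊆ Metric.thickening δ (K.G a)) ∧
    C1HolderClose ε δ K.g K₁.g (K.V ∩ K₁.V)

/-- The inverse branch `(g|_{G(a)})⁻¹`, which is `f_{(a,b)}` on `G(b)` if `(a,b)` is admissible. -/
def branch (K : ConformalCantor B ε) (a : A) : ℂ → ℂ := Function.invFunOn K.g (K.G a)

/-- The composition `f_{θₙ}` of inverse branches for the word `θₙ = (θ₋ₙ, …, θ₀)`; it maps `G(θ₀)`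
into `G(θ₋ₙ)`. -/
def fWord (K : ConformalCantor B ε) (θ : NegSeq B) : ℕ → ℂ → ℂ
  | 0 => id
  | n + 1 => fun z => K.branch (θ.1 (n + 1)) (K.fWord θ n z)

/-- The complex number `D f_{θₙ}(c_{θ₀})` (the derivative is conformal there). -/
def dWord (K : ConformalCantor B ε) (c : A → ℂ) (θ : NegSeq B) (n : ℕ) : ℂ :=
  fderiv ℝ (K.fWord θ n) (c (θ.1 0)) 1

/-- A nonzero complex number as a unit. -/
def toUnit (z : ℂ) : ℂˣ := if h : z = 0 then 1 else Units.mk0 z h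

/-- The affine map `Φ_{θₙ}` for which `Φ_{θₙ} ∘ f_{θₙ}` sends `c_{θ₀}` to `0` and has derivative
`1` there. (The derivative `dWord` does not vanish.) -/
def phi (K : ConformalCantor B ε) (c : A → ℂ) (θ : NegSeq B) (n : ℕ) : AffC where
  lin := (toUnit (K.dWord c θ n))⁻¹
  tr := -(((toUnit (K.dWord c θ n))⁻¹ : ℂˣ) * K.fWord θ n (c (θ.1 0)))

/-- The map `kₙ^θ = Φ_{θₙ} ∘ f_{θₙ}`. -/
def kApprox (K : ConformalCantor B ε) (c : A → ℂ) (θ : NegSeq B) (n : ℕ) (z : ℂ) : ℂ :=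
  (K.phi c θ n).app (K.fWord θ n z)

/-- The limit geometry `k^θ = lim kₙ^θ`, a function on `G(θ₀)`. -/
def limGeom (K : ConformalCantor B ε) (c : A → ℂ) (θ : NegSeq B) (z : ℂ) : ℂ :=
  limUnder atTop (fun n => K.kApprox c θ n z)

/-- The affine map `F^{θb} = lim Φ_{θₙ} ∘ (Φ_{(θb)ₙ₊₁})⁻¹`, which satisfies
`F^{θb} ∘ k^{θb} = k^θ ∘ f_{(θ₀,b)}`. -/
def renormAff (K : ConformalCantor B ε) (c : A → ℂ) (θ : NegSeq B) (b : A)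
    (h : B (θ.1 0) b) : AffC :=
  limUnder atTop (fun n => K.phi c θ n * (K.phi c (θ.snoc b h) (n + 1))⁻¹)

/-- `h` is a configuration of the piece `G(a)`: its restriction to `G(a)` is the restriction of a
`C^{1+ε}` embedding of a neighbourhood. -/
def IsConfiguration (K : ConformalCantor B ε) (a : A) (h : ℂ → ℂ) : Prop :=
  ∃ U : Set ℂ, ∃ H : ℂ → ℂ, IsOpen U ∧ K.G a ⊆ U ∧ IsC1HolderEmb ε H U ∧ EqOn h H (K.G a)

/-- Renormalization on the space `𝒜 = Aff(ℂ) × Σ⁻` of affine configurations of limit geometries.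
`K.Renorm c x w y` says that `y = T_a x` for the admissible word `a = (θ₀, w₁, …, wₙ)`, which
starts with the last letter `θ₀` of `x = (S, θ)` and has size `n`. One step is
`T_{θ₀,b} (S, θ) = (S ∘ F^{θb}, θb)`; the void word acts as the identity. -/
inductive Renorm (K : ConformalCantor B ε) (c : A → ℂ) :
    AffC × NegSeq B → List A → AffC × NegSeq B → Prop
  | nil (x : AffC × NegSeq B) : Renorm K c x [] x
  | cons (S : AffC) (θ : NegSeq B) (b : A) (h : B (θ.1 0) b) (w : List A)
      (y : AffC × NegSeq B) (hy : Renorm K c (S * K.renormAff c θ b h, θ.snoc b h) w y) :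
      Renorm K c (S, θ) (b :: w) y

end ConformalCantor

/-! ### Relative configurations and recurrent compact sets -/

section Relative

variable {A₁ A₂ : Type*}

/-- The diagonal action of `Aff(ℂ)` on `𝒜 × 𝒜'` from the left, as an equivalence relation. -/
def affSetoid (B₁ : A₁ → A₁ → Prop) (B₂ : A₂ → A₂ → Prop) :
    Setoid ((AffC × NegSeq B₁) × (AffC × NegSeq B₂)) where
  r x y := ∃ T : AffC, y = ((T * x.1.1, x.1.2), (T * x.2.1, x.2.2))
  iseqv :=
    { refl := fun x => ⟨1, by simp only [one_mul]⟩
      symm := by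
        rintro x y ⟨T, rfl⟩
        exact ⟨T⁻¹, by simp only [inv_mul_cancel_left]⟩
      trans := by
        rintro x y z ⟨T, rfl⟩ ⟨R, rfl⟩
        exact ⟨R * T, by simp only [mul_assoc]⟩ }

/-- The space `𝒞` of relative affine configurations of limit geometries, with the quotient
topology. It depends only on the two types `Σ` and `Σ'`. -/
abbrev RelConf (B₁ : A₁ → A₁ → Prop) (B₂ : A₂ → A₂ → Prop) : Type _ :=
  Quotient (affSetoid B₁ B₂)

/-- The class of a pair in `𝒞`. -/
def RelConf.mk {B₁ : A₁ → A₁ → Prop} {B₂ : A₂ → A₂ → Prop}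
    (x₁ : AffC × NegSeq B₁) (x₂ : AffC × NegSeq B₂) : RelConf B₁ B₂ :=
  Quotient.mk (affSetoid B₁ B₂) (x₁, x₂)

variable {B₁ : A₁ → A₁ → Prop} {B₂ : A₂ → A₂ → Prop} {ε : ℝ}

/-- `u` is the image of `v` under the renormalization operator of the words given by `w₁`, `w₂`. -/
def RelRenorm (K₁ : ConformalCantor B₁ ε) (c₁ : A₁ → ℂ) (K₂ : ConformalCantor B₂ ε)
    (c₂ : A₂ → ℂ) (v : RelConf B₁ B₂) (w₁ : List A₁) (w₂ : List A₂) (u : RelConf B₁ B₂) : Prop :=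
  ∃ x₁ x₂ y₁ y₂, v = RelConf.mk x₁ x₂ ∧ u = RelConf.mk y₁ y₂ ∧
    K₁.Renorm c₁ x₁ w₁ y₁ ∧ K₂.Renorm c₂ x₂ w₂ y₂

/-- `L` is a recurrent compact set: every element of `L` is carried into the interior of `L` by a
(nontrivial) renormalization. -/
def IsRecurrent (K₁ : ConformalCantor B₁ ε) (c₁ : A₁ → ℂ) (K₂ : ConformalCantor B₂ ε)
    (c₂ : A₂ → ℂ) (L : Set (RelConf B₁ B₂)) : Prop :=
  IsCompact L ∧ ∀ v ∈ L, ∃ w₁ w₂ u, 1 ≤ w₁.length + w₂.length ∧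
    RelRenorm K₁ c₁ K₂ c₂ v w₁ w₂ u ∧ u ∈ interior L

/-- `L` is an immediately recurrent compact set: words of total size one suffice. -/
def IsImmediatelyRecurrent (K₁ : ConformalCantor B₁ ε) (c₁ : A₁ → ℂ) (K₂ : ConformalCantor B₂ ε)
    (c₂ : A₂ → ℂ) (L : Set (RelConf B₁ B₂)) : Prop :=
  IsCompact L ∧ ∀ v ∈ L, ∃ w₁ w₂ u, w₁.length + w₂.length = 1 ∧
    RelRenorm K₁ c₁ K₂ c₂ v w₁ w₂ u ∧ u ∈ interior L

/-- The pair of configurations `(h₁, h₂)` of the pieces `G₁(a₁)` and `G₂(a₂)` has stable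
intersections. (The derivatives of configurations of closed pieces are compared in the interior of
the pieces, which determines them on the pieces.) -/
def HasStableIntersections (K₁ : ConformalCantor B₁ ε) (K₂ : ConformalCantor B₂ ε)
    (a₁ : A₁) (a₂ : A₂) (h₁ h₂ : ℂ → ℂ) : Prop :=
  ∃ δ > 0, ∀ (M₁ : ConformalCantor B₁ ε) (M₂ : ConformalCantor B₂ ε),
    K₁.Near δ M₁ → K₂.Near δ M₂ → ∀ j₁ j₂ : ℂ → ℂ,
      M₁.IsConfiguration a₁ j₁ → M₂.IsConfiguration a₂ j₂ →
      C1HolderClose ε δ h₁ j₁ (interior (K₁.G a₁) ∩ interior (M₁.G a₁)) →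
      C1HolderClose ε δ h₂ j₂ (interior (K₂.G a₂) ∩ interior (M₂.G a₂)) →
      ((j₁ '' M₁.piece a₁) ∩ (j₂ '' M₂.piece a₂)).Nonempty

end Relative

end ConfCantor

end

/-! A relative configuration is determined by the affine map `S₁⁻¹ * S₂` and the two sequences
(`RelConf.homeo`). In these coordinates renormalization becomes the relation `Step`, driven by the
two families (θ, b) ↦ F^{θb}. Two facts carry the theorem. First, F^{θb} depends continuously on θ,
on the Cantor set and on its base points, jointly (`famTendsto_fam`). Second, reaching an open set
in a fixed number of steps is therefore an open condition on the starting point and the families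
together (`eventually_reach`).

Claim 1: by compactness the points of a recurrent set return in bounded time. The intermediate
points can be thickened to compact sets, whose union with the given set returns in one step
(`exists_compact_one_step`). Claim 2: 𝒞 does not depend on the Cantor sets, so ℒ stays fixed while
the families move slightly. Openness and compactness of ℒ keep the return property. The new base
points are the points with the old itineraries.

The continuity of F^{θb} rests on distortion estimates. The quotients (f_{θₙ}(x) - f_{θₙ}(y)) /
f_{θₙ}'(z), with z in the Cantor set, change at step n by a relative amount of order κ^{εn}, because
g is C^{1+ε}, expanding, and conformal at z. They converge geometrically, with constants valid in a
neighbourhood of g (`exists_tame`, `exists_geom`), so continuity of each finite stage passes to the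
limit.

Claim 3: a configuration j close to S ∘ k^θ is tracked by affine maps whose linear parts are those
of the exact renormalizations of S ∘ k^θ and whose translation parts are values of j
(`Approximates`). Since j - S ∘ k^θ has a small Lipschitz constant, each step of this tracking is a
renormalization step for F^{θb} changed by a small translation, with a bound independent of the
depth. An immediately recurrent set tolerates such changes, so the relative position of the two
tracked configurations stays in a compact set forever. The linear parts shrink geometrically, so
values of j₁ and j₂ on the Cantor sets become arbitrarily close, and compactness gives a common
value (`nonempty_inter_of_approximates`). -/

namespace ConfCantor

/-! ### Topology of the affine group -/

namespace AffC

/-- The affine group as a topological space is `ℂˣ × ℂ`. -/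
def homeo : AffC ≃ₜ ℂˣ × ℂ where
  toFun S := (S.lin, S.tr)
  invFun p := ⟨p.1, p.2⟩
  left_inv _ := rfl
  right_inv _ := rfl
  continuous_toFun := continuous_induced_dom
  continuous_invFun := continuous_induced_rng.2 continuous_id

theorem continuous_lin : Continuous AffC.lin := continuous_fst.comp homeo.continuous

theorem continuous_tr : Continuous AffC.tr := continuous_snd.comp homeo.continuous

instance : T2Space AffC := homeo.symm.t2Space

instance : LocallyCompactSpace ℂˣ :=
  (Units.isOpenEmbedding_val (R := ℂ)).locallyCompactSpace

instance : LocallyCompactSpace AffC := homeo.isOpenEmbedding.locallyCompactSpace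

theorem continuous_iff {X : Type*} [TopologicalSpace X] {f : X → AffC} :
    Continuous f ↔ (Continuous fun x => (f x).lin) ∧ Continuous fun x => (f x).tr := by
  rw [← homeo.comp_continuous_iff, continuous_prodMk.symm]; rfl

/-- Inversion is continuous on the nonzero complex numbers, so convergence of the units can be
tested in ℂ without separate control of the inverses. -/
theorem tendsto_iff {ι : Type*} {l : Filter ι} {f : ι → AffC} {S : AffC} :
    Tendsto f l (𝓝 S) ↔
      Tendsto (fun i => ((f i).lin : ℂ)) l (𝓝 (S.lin : ℂ)) ∧
        Tendsto (fun i => (f i).tr) l (𝓝 S.tr) := by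
  rw [homeo.isInducing.tendsto_nhds_iff, nhds_prod_eq]
  have : Tendsto (homeo ∘ f) l (𝓝 (homeo S).1 ×ˢ 𝓝 (homeo S).2) ↔
      Tendsto (fun i => (f i).lin) l (𝓝 S.lin) ∧ Tendsto (fun i => (f i).tr) l (𝓝 S.tr) :=
    tendsto_prod_iff'
  rw [this, Units.isEmbedding_val₀.isInducing.tendsto_nhds_iff]
  rfl

instance : ContinuousMul AffC where
  continuous_mul := by
    refine continuous_iff.2 ⟨?_, ?_⟩
    · exact (continuous_lin.comp continuous_fst).mul (continuous_lin.comp continuous_snd)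
    · exact ((Units.continuous_val.comp (continuous_lin.comp continuous_fst)).mul
        (continuous_tr.comp continuous_snd)).add (continuous_tr.comp continuous_fst)

instance : ContinuousInv AffC where
  continuous_inv := by
    refine continuous_iff.2 ⟨?_, ?_⟩
    · exact continuous_lin.inv
    · exact ((Units.continuous_val.comp continuous_lin.inv).mul continuous_tr).neg

end AffC

/-! ### Topology of the sequence space Σ⁻ -/

namespace NegSeq

variable {A : Type*} {B : A → A → Prop}

/-- The alphabet is discrete. In particular the last letter, and with it the piece on which k^θ
lives, is eventually constant along a convergent family. -/
theorem tendsto_iff {ι : Type*} {l : Filter ι} {f : ι → NegSeq B} {θ : NegSeq B} :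
    Tendsto f l (𝓝 θ) ↔ ∀ n, ∀ᶠ i in l, (f i).1 n = θ.1 n := by
  let _ : TopologicalSpace A := ⊥
  have _ : DiscreteTopology A := ⟨rfl⟩
  have hi : IsInducing (fun θ : NegSeq B => θ.1) := ⟨rfl⟩
  rw [hi.tendsto_nhds_iff, tendsto_pi_nhds]
  simp only [nhds_discrete, tendsto_pure]
  rfl

theorem eventually_eq (θ : NegSeq B) (n : ℕ) : ∀ᶠ η in 𝓝 θ, η.1 n = θ.1 n :=
  tendsto_iff.1 (tendsto_id (x := 𝓝 θ)) n

/-- With the Hausdorff property this makes the coordinate space of 𝒞 locally compact, which is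
needed to thicken compact sets. It also lets sequences be replaced by their limits along
ultrafilters. -/
instance [Finite A] : CompactSpace (NegSeq B) := by
  let _ : TopologicalSpace A := ⊥
  have _ : DiscreteTopology A := ⟨rfl⟩
  have hr : range (fun θ : NegSeq B => θ.1) = {x | ∀ i, B (x (i + 1)) (x i)} := Subtype.range_val
  have hi : IsClosedEmbedding (fun θ : NegSeq B => θ.1) := by
    refine ⟨⟨⟨rfl⟩, Subtype.val_injective⟩, ?_⟩
    rw [hr, Set.ofPred_forall]
    refine isClosed_iInter fun i => ?_
    have hc : Continuous fun x : ℕ → A => (x (i + 1), x i) :=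
      (continuous_apply (i + 1)).prodMk (continuous_apply i)
    exact (isClosed_discrete {p : A × A | B p.1 p.2}).preimage hc
  exact hi.compactSpace

instance : T2Space (NegSeq B) := by
  let _ : TopologicalSpace A := ⊥
  have _ : DiscreteTopology A := ⟨rfl⟩
  have hi : IsEmbedding (fun θ : NegSeq B => θ.1) := ⟨⟨rfl⟩, Subtype.val_injective⟩
  exact hi.t2Space

open Classical in
/-- The extension of a sequence by a letter; it is the sequence itself if this is impossible. -/
noncomputable def ext' (θ : NegSeq B) (b : A) : NegSeq B :=
  if h : B (θ.1 0) b then θ.snoc b h else θ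

theorem ext'_eq {θ : NegSeq B} {b : A} (h : B (θ.1 0) b) : θ.ext' b = θ.snoc b h := dif_pos h

theorem tendsto_ext' {ι : Type*} {l : Filter ι} {f : ι → NegSeq B} {θ : NegSeq B} {b : A}
    (h : B (θ.1 0) b) (hf : Tendsto f l (𝓝 θ)) :
    Tendsto (fun i => (f i).ext' b) l (𝓝 (θ.ext' b)) := by
  rw [tendsto_iff] at hf ⊢
  intro n
  filter_upwards [hf 0, hf (n - 1)] with i h0 hn
  rw [ext'_eq h, ext'_eq (h0 ▸ h)]
  cases n with
  | zero => rfl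
  | succ n => exact hn

end NegSeq

/-! ### Coordinates on the space of relative configurations -/

section Coordinates

variable {A₁ A₂ : Type*} {B₁ : A₁ → A₁ → Prop} {B₂ : A₂ → A₂ → Prop}

/-- The relative configuration of a pair is determined by the affine map between the two
configurations and the two sequences. -/
def RelConf.homeo (B₁ : A₁ → A₁ → Prop) (B₂ : A₂ → A₂ → Prop) :
    RelConf B₁ B₂ ≃ₜ AffC × NegSeq B₁ × NegSeq B₂ where
  toFun := Quotient.lift (fun x => (x.1.1⁻¹ * x.2.1, x.1.2, x.2.2)) (by
    rintro x y ⟨T, rfl⟩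
    simp only [mul_inv_rev, mul_assoc, inv_mul_cancel_left])
  invFun p := RelConf.mk (1, p.2.1) (p.1, p.2.2)
  left_inv := by
    rintro ⟨x⟩
    refine Quotient.sound ⟨x.1.1, ?_⟩
    simp only [mul_one, mul_inv_cancel_left]
  right_inv p := by
    show (((1 : AffC)⁻¹ * p.1, p.2.1, p.2.2) : AffC × NegSeq B₁ × NegSeq B₂) = p
    simp only [inv_one, one_mul]
  continuous_toFun := by
    refine Continuous.quotient_lift ?_ _
    fun_prop
  continuous_invFun := by
    refine continuous_quotient_mk'.comp ?_
    fun_prop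

theorem RelConf.homeo_mk (x₁ : AffC × NegSeq B₁) (x₂ : AffC × NegSeq B₂) :
    RelConf.homeo B₁ B₂ (RelConf.mk x₁ x₂) = (x₁.1⁻¹ * x₂.1, x₁.2, x₂.2) := rfl

end Coordinates

end ConfCantor

namespace ConfCantor

/-! ### Compact sets that return to themselves -/

section Reach

variable {X : Type*}

/-- The set of points from which `O` can be reached in `n` steps of the relation `R`. -/
def Reach (R : X → X → Prop) (O : Set X) : ℕ → Set X
  | 0 => O
  | n + 1 => {x | ∃ y ∈ Reach R O n, R x y}

theorem Reach.isOpen [TopologicalSpace X] {R : X → X → Prop}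
    (hR : ∀ O, IsOpen O → IsOpen {x | ∃ y ∈ O, R x y}) {O : Set X} (hO : IsOpen O) (n : ℕ) :
    IsOpen (Reach R O n) := by
  induction n with
  | zero => exact hO
  | succ n ih => exact hR _ ih

/-- If all points of a compact set reach `O` in at most `n + 1` steps, the set can be enlarged to a
compact set which one can only leave through `O`. -/
theorem exists_compact_of_reach_le [TopologicalSpace X] [LocallyCompactSpace X]
    {R : X → X → Prop} (hR : ∀ O, IsOpen O → IsOpen {x | ∃ y ∈ O, R x y}) {O : Set X}
    (hO : IsOpen O) (n : ℕ) {C : Set X} (hC : IsCompact C)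
    (h : ∀ x ∈ C, ∃ m ≤ n, x ∈ Reach R O (m + 1)) :
    ∃ D, IsCompact D ∧ C ⊆ D ∧ ∀ x ∈ D, ∃ y ∈ interior D ∪ O, R x y := by
  induction n generalizing C with
  | zero =>
    refine ⟨C, hC, Subset.rfl, fun x hx => ?_⟩
    obtain ⟨m, hm, y, hy, hxy⟩ := h x hx
    obtain rfl : m = 0 := by omega
    exact ⟨y, Or.inr hy, hxy⟩
  | succ n ih =>
    -- Each point of `C` steps either into `O` or to a point one step nearer to `O`. The latter has
    -- a compact neighbourhood of points with the same return time, and the step into its interior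
    -- persists for nearby starting points. Finitely many such neighbourhoods form `E`, to which the
    -- induction hypothesis applies.
    have key : ∃ E, IsCompact E ∧ (∀ x ∈ E, ∃ m ≤ n, x ∈ Reach R O (m + 1)) ∧
        ∀ x ∈ C, ∃ y ∈ interior E ∪ O, R x y := by
      refine hC.induction_on (p := fun S => ∃ E, IsCompact E ∧
        (∀ x ∈ E, ∃ m ≤ n, x ∈ Reach R O (m + 1)) ∧ ∀ x ∈ S, ∃ y ∈ interior E ∪ O, R x y)
        ⟨∅, isCompact_empty, by simp, by simp⟩ ?_ ?_ ?_
      · rintro S T hST ⟨E, h1, h2, h3⟩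
        exact ⟨E, h1, h2, fun x hx => h3 x (hST hx)⟩
      · rintro S T ⟨E, h1, h2, h3⟩ ⟨E', h1', h2', h3'⟩
        refine ⟨E ∪ E', h1.union h1', ?_, ?_⟩
        · rintro x (hx | hx)
          · exact h2 x hx
          · exact h2' x hx
        · have hi := interior_mono (subset_union_left (s := E) (t := E'))
          have hi' := interior_mono (subset_union_right (s := E) (t := E'))
          rintro x (hx | hx)
          · obtain ⟨y, hy, hxy⟩ := h3 x hx
            exact ⟨y, union_subset_union_left _ hi hy, hxy⟩
          · obtain ⟨y, hy, hxy⟩ := h3' x hx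
            exact ⟨y, union_subset_union_left _ hi' hy, hxy⟩
      · intro x hx
        obtain ⟨m, hm, y, hy, hxy⟩ := h x hx
        cases m with
        | zero =>
          exact ⟨_, mem_nhdsWithin_of_mem_nhds ((hR O hO).mem_nhds ⟨y, hy, hxy⟩), ∅,
            isCompact_empty, by simp, fun z hz => by simpa using hz⟩
        | succ m =>
          obtain ⟨E, hE, hyE, hEU⟩ := exists_compact_subset (Reach.isOpen hR hO (m + 1)) hy
          refine ⟨_, mem_nhdsWithin_of_mem_nhds ((hR _ isOpen_interior).mem_nhds ⟨y, hyE, hxy⟩),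
            E, hE, fun z hz => ⟨m, by omega, hEU hz⟩, ?_⟩
          rintro z ⟨w, hw, hzw⟩
          exact ⟨w, Or.inl hw, hzw⟩
    obtain ⟨E, hE, hEn, hEC⟩ := key
    obtain ⟨D, hD, hED, hDD⟩ := ih hE hEn
    refine ⟨C ∪ D, hC.union hD, subset_union_left, ?_⟩
    have hi := interior_mono (subset_union_right (s := C) (t := D))
    rintro x (hx | hx)
    · obtain ⟨y, hy, hxy⟩ := hEC x hx
      exact ⟨y, union_subset_union_left _ ((interior_mono hED).trans hi) hy, hxy⟩
    · obtain ⟨y, hy, hxy⟩ := hDD x hx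
      exact ⟨y, union_subset_union_left _ hi hy, hxy⟩

/-- A compact set whose points return to its interior lies in the interior of a compact set
whose points return to the interior in one step. -/
theorem exists_compact_one_step [TopologicalSpace X] [LocallyCompactSpace X]
    {R : X → X → Prop} (hR : ∀ O, IsOpen O → IsOpen {x | ∃ y ∈ O, R x y}) {L : Set X}
    (hL : IsCompact L) (h : ∀ x ∈ L, ∃ m, x ∈ Reach R (interior L) (m + 1)) :
    ∃ D, IsCompact D ∧ L ⊆ interior D ∧ ∀ x ∈ D, x ∈ Reach R (interior D) 1 := by
  -- The sets `U n` are open and increasing, so compactness of `L` bounds the return times.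
  set U : ℕ → Set X := fun n => ⋃ m ≤ n, Reach R (interior L) (m + 1) with hU
  have hUo : ∀ n, IsOpen (U n) := fun n =>
    isOpen_biUnion fun m _ => Reach.isOpen hR isOpen_interior _
  have hUm : Monotone U := fun n n' hn =>
    biUnion_mono (fun m hm => le_trans hm hn) fun _ _ => le_rfl
  have hLU : L ⊆ ⋃ n, U n := fun x hx => by
    obtain ⟨m, hm⟩ := h x hx
    exact mem_iUnion.2 ⟨m, mem_biUnion (le_refl m) hm⟩
  obtain ⟨n, hn⟩ := hL.elim_directed_cover U hUo hLU hUm.directed_le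
  -- Starting from a compact neighbourhood `C` of `L` puts `L` inside `interior D`. The exit set
  -- `interior L` is then absorbed by `interior D`.
  obtain ⟨C, hC, hLC, hCU⟩ := exists_compact_between hL (hUo n) hn
  obtain ⟨D, hD, hCD, hDD⟩ := exists_compact_of_reach_le hR isOpen_interior n hC
    (O := interior L) (fun x hx => by
      obtain ⟨m, hm, hxm⟩ := mem_iUnion₂.1 (hCU hx)
      exact ⟨m, hm, hxm⟩)
  have hLD : L ⊆ interior D := hLC.trans (interior_mono hCD)
  refine ⟨D, hD, hLD, fun x hx => ?_⟩
  obtain ⟨y, hy, hxy⟩ := hDD x hx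
  refine ⟨y, ?_, hxy⟩
  rcases hy with hy | hy
  · exact hy
  · exact hLD (interior_subset hy)

end Reach

/-! ### Renormalization with respect to families of affine maps -/

section Family

variable {A₁ A₂ : Type*} {B₁ : A₁ → A₁ → Prop} {B₂ : A₂ → A₂ → Prop}

/-- One step of renormalization in the coordinates of `RelConf.homeo`, where the affine map
for the extension of the sequence `θ` by the letter `b` is `F₁ θ b`, or `F₂ θ b`. -/
def Step (F : (NegSeq B₁ → A₁ → AffC) × (NegSeq B₂ → A₂ → AffC))
    (x y : AffC × NegSeq B₁ × NegSeq B₂) : Prop :=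
  (∃ b, B₁ (x.2.1.1 0) b ∧ y = ((F.1 x.2.1 b)⁻¹ * x.1, x.2.1.ext' b, x.2.2)) ∨
    ∃ b, B₂ (x.2.2.1 0) b ∧ y = (x.1 * F.2 x.2.2 b, x.2.1, x.2.2.ext' b)

/-- Along `l`, the families `F i` converge continuously to the family `F₀`. -/
def FamTendsto {ι A : Type*} {B : A → A → Prop} (l : Filter ι) (F : ι → NegSeq B → A → AffC)
    (F₀ : NegSeq B → A → AffC) : Prop :=
  ∀ θ b, B (θ.1 0) b → Tendsto (fun p : ι × NegSeq B => F p.1 p.2 b) (l ×ˢ 𝓝 θ) (𝓝 (F₀ θ b))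

variable {ι : Type*} {l : Filter ι}
  {F : ι → (NegSeq B₁ → A₁ → AffC) × (NegSeq B₂ → A₂ → AffC)}
  {F₀ : (NegSeq B₁ → A₁ → AffC) × (NegSeq B₂ → A₂ → AffC)}

/-- The same letter `b` stays admissible near `x₀`, and the endpoint of the step with that letter
depends continuously on the family and on the starting point. -/
theorem eventually_step (h₁ : FamTendsto l (fun i => (F i).1) F₀.1)
    (h₂ : FamTendsto l (fun i => (F i).2) F₀.2)
    {x₀ y₀ : AffC × NegSeq B₁ × NegSeq B₂} (hxy : Step F₀ x₀ y₀)
    {p : ι × AffC × NegSeq B₁ × NegSeq B₂ → Prop} (hp : ∀ᶠ q in l ×ˢ 𝓝 y₀, p q) :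
    ∀ᶠ q in l ×ˢ 𝓝 x₀, ∃ y, p (q.1, y) ∧ Step (F q.1) q.2 y := by
  obtain ⟨Q, θ₁, θ₂⟩ := x₀
  have hx : Tendsto (fun q : ι × AffC × NegSeq B₁ × NegSeq B₂ => q.2) (l ×ˢ 𝓝 (Q, θ₁, θ₂))
    (𝓝 (Q, θ₁, θ₂)) := tendsto_snd
  have hQ := continuous_fst.continuousAt.tendsto.comp hx
  have hθ₁ := (continuous_fst.comp continuous_snd).continuousAt.tendsto.comp hx
  have hθ₂ := (continuous_snd.comp continuous_snd).continuousAt.tendsto.comp hx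
  have hi : Tendsto (fun q : ι × AffC × NegSeq B₁ × NegSeq B₂ => q.1) (l ×ˢ 𝓝 (Q, θ₁, θ₂)) l :=
    tendsto_fst
  rcases hxy with ⟨b, hb, rfl⟩ | ⟨b, hb, rfl⟩
  · have hF := (h₁ θ₁ b hb).comp (hi.prodMk hθ₁)
    have hy := (hF.inv.mul hQ).prodMk_nhds ((NegSeq.tendsto_ext' hb hθ₁).prodMk_nhds hθ₂)
    filter_upwards [(hi.prodMk hy).eventually hp, NegSeq.tendsto_iff.1 hθ₁ 0] with q hq h0
    exact ⟨_, hq, Or.inl ⟨b, by rw [show q.2.2.1.1 0 = θ₁.1 0 from h0]; exact hb, rfl⟩⟩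
  · have hF := (h₂ θ₂ b hb).comp (hi.prodMk hθ₂)
    have hy := (hQ.mul hF).prodMk_nhds (hθ₁.prodMk_nhds (NegSeq.tendsto_ext' hb hθ₂))
    filter_upwards [(hi.prodMk hy).eventually hp, NegSeq.tendsto_iff.1 hθ₂ 0] with q hq h0
    exact ⟨_, hq, Or.inr ⟨b, by rw [show q.2.2.2.1 0 = θ₂.1 0 from h0]; exact hb, rfl⟩⟩

theorem eventually_reach (h₁ : FamTendsto l (fun i => (F i).1) F₀.1)
    (h₂ : FamTendsto l (fun i => (F i).2) F₀.2) {O : Set (AffC × NegSeq B₁ × NegSeq B₂)}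
    (hO : IsOpen O) (n : ℕ) {x₀ : AffC × NegSeq B₁ × NegSeq B₂}
    (hx₀ : x₀ ∈ Reach (Step F₀) O n) :
    ∀ᶠ q in l ×ˢ 𝓝 x₀, q.2 ∈ Reach (Step (F q.1)) O n := by
  induction n generalizing x₀ with
  | zero => exact tendsto_snd.eventually (hO.mem_nhds hx₀)
  | succ n ih =>
    obtain ⟨y₀, hy₀, hxy⟩ := hx₀
    exact eventually_step h₁ h₂ hxy (ih hy₀)

/-- Persistence of recurrence under perturbations of the families. -/
theorem eventually_forall_reach (h₁ : FamTendsto l (fun i => (F i).1) F₀.1)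
    (h₂ : FamTendsto l (fun i => (F i).2) F₀.2) {O L : Set (AffC × NegSeq B₁ × NegSeq B₂)}
    (hO : IsOpen O) (hL : IsCompact L) {N : Set ℕ} (h : ∀ x ∈ L, ∃ n ∈ N, x ∈ Reach (Step F₀) O n) :
    ∀ᶠ i in l, ∀ x ∈ L, ∃ n ∈ N, x ∈ Reach (Step (F i)) O n := by
  -- The tube lemma: the neighbourhoods found at the single points of `L` are combined into one
  -- condition on the index.
  have : {q : ι × AffC × NegSeq B₁ × NegSeq B₂ | ∃ n ∈ N, q.2 ∈ Reach (Step (F q.1)) O n} ∈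
      l ×ˢ 𝓝ˢ L := by
    refine hL.mem_prod_nhdsSet_of_forall fun x hx => ?_
    obtain ⟨n, hn, hxn⟩ := h x hx
    filter_upwards [eventually_reach h₁ h₂ hO n hxn] with q hq
    exact ⟨n, hn, hq⟩
  have h' : ∀ᶠ q in l ×ˢ 𝓟 L, ∃ n ∈ N, q.2 ∈ Reach (Step (F q.1)) O n :=
    (Filter.prod_mono le_rfl principal_le_nhdsSet) this
  rw [eventually_prod_principal_iff] at h'
  exact h'

theorem isOpen_step {F₀ : (NegSeq B₁ → A₁ → AffC) × (NegSeq B₂ → A₂ → AffC)}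
    (h₁ : ∀ θ b, B₁ (θ.1 0) b → ContinuousAt (fun η => F₀.1 η b) θ)
    (h₂ : ∀ θ b, B₂ (θ.1 0) b → ContinuousAt (fun η => F₀.2 η b) θ)
    (O : Set (AffC × NegSeq B₁ × NegSeq B₂)) (hO : IsOpen O) :
    IsOpen {x | ∃ y ∈ O, Step F₀ x y} := by
  rw [isOpen_iff_mem_nhds]
  rintro x ⟨y, hy, hxy⟩
  -- A one-point index set turns the statement on varying families into one on the single family
  -- `F₀`.
  have := eventually_step (l := (pure () : Filter Unit)) (F := fun _ => F₀) (F₀ := F₀)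
    (fun θ b hb => (h₁ θ b hb).tendsto.comp tendsto_snd)
    (fun θ b hb => (h₂ θ b hb).tendsto.comp tendsto_snd) hxy
    (p := fun q => q.2 ∈ O) (tendsto_snd.eventually (hO.mem_nhds hy))
  rw [pure_prod, eventually_map] at this
  exact this

/-- The families that are at distance less than `m` from `F₀`. -/
def FamClose {A : Type*} {B : A → A → Prop} (m : ℝ) (F₀ F : NegSeq B → A → AffC) : Prop :=
  ∀ θ b, B (θ.1 0) b →
    ‖((F θ b).lin : ℂ) - (F₀ θ b).lin‖ ≤ m ∧ ‖(F θ b).tr - (F₀ θ b).tr‖ ≤ m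

/-- Uniform convergence to a continuous limit is continuous convergence. Only the letter θ₀ matters
for admissibility, and it is locally constant. -/
theorem FamClose.tendsto {A : Type*} {B : A → A → Prop} {F₀ : NegSeq B → A → AffC}
    (h : ∀ θ b, B (θ.1 0) b → ContinuousAt (fun η => F₀ η b) θ) {ι : Type*} {l : Filter ι}
    {F : ι → NegSeq B → A → AffC} (hF : ∀ m > 0, ∀ᶠ i in l, FamClose m F₀ (F i)) :
    FamTendsto l F F₀ := by
  intro θ b hb
  have h0 := AffC.tendsto_iff.1 ((h θ b hb).tendsto.comp (tendsto_snd (f := l)))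
  have key : ∀ u : AffC → ℂ, (∀ m (S T : AffC), ‖(S.lin : ℂ) - T.lin‖ ≤ m ∧ ‖S.tr - T.tr‖ ≤ m →
      ‖u S - u T‖ ≤ m) → Tendsto (fun p : ι × NegSeq B => u (F p.1 p.2 b) - u (F₀ p.2 b))
      (l ×ˢ 𝓝 θ) (𝓝 0) := by
    intro u hu
    rw [Metric.tendsto_nhds]
    intro r hr
    filter_upwards [tendsto_fst.eventually (hF (r / 2) (half_pos hr)),
      tendsto_snd.eventually (NegSeq.eventually_eq θ 0)] with p hp h0
    rw [dist_zero_right]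
    exact (hu _ _ _ (hp p.2 b (by rw [h0]; exact hb))).trans_lt (half_lt_self hr)
  rw [AffC.tendsto_iff]
  constructor
  · simpa using (key (fun S => (S.lin : ℂ)) fun _ _ _ h => h.1).add h0.1
  · simpa using (key (fun S => S.tr) fun _ _ _ h => h.2).add h0.2

/-- A compact set that returns to the open set `O` in one step does so for all families which are
sufficiently close. -/
theorem exists_famClose_reach {F₀ : (NegSeq B₁ → A₁ → AffC) × (NegSeq B₂ → A₂ → AffC)}
    (h₁ : ∀ θ b, B₁ (θ.1 0) b → ContinuousAt (fun η => F₀.1 η b) θ)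
    (h₂ : ∀ θ b, B₂ (θ.1 0) b → ContinuousAt (fun η => F₀.2 η b) θ)
    {O L : Set (AffC × NegSeq B₁ × NegSeq B₂)} (hO : IsOpen O) (hL : IsCompact L)
    (h : ∀ x ∈ L, x ∈ Reach (Step F₀) O 1) :
    ∃ m > 0, ∀ F, FamClose m F₀.1 F.1 → FamClose m F₀.2 F.2 →
      ∀ x ∈ L, x ∈ Reach (Step F) O 1 := by
  by_contra! hcon
  -- A counterexample for each radius is indexed by that radius. As the radius tends to `0` from
  -- above these families converge to `F₀`, and persistence forbids that all of them fail.
  choose! F hF₁ hF₂ hF using hcon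
  have hmem : ∀ m > 0, ∀ᶠ i : ℝ in 𝓝[>] 0, 0 < i ∧ i ≤ m := fun m hm =>
    (Ioc_mem_nhdsGT hm)
  have t₁ : FamTendsto (𝓝[>] (0 : ℝ)) (fun i => (F i).1) F₀.1 := by
    refine FamClose.tendsto h₁ fun m hm => ?_
    filter_upwards [hmem m hm] with i hi θ b hb
    exact ⟨(hF₁ i hi.1 θ b hb).1.trans hi.2, (hF₁ i hi.1 θ b hb).2.trans hi.2⟩
  have t₂ : FamTendsto (𝓝[>] (0 : ℝ)) (fun i => (F i).2) F₀.2 := by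
    refine FamClose.tendsto h₂ fun m hm => ?_
    filter_upwards [hmem m hm] with i hi θ b hb
    exact ⟨(hF₂ i hi.1 θ b hb).1.trans hi.2, (hF₂ i hi.1 θ b hb).2.trans hi.2⟩
  have := eventually_forall_reach t₁ t₂ hO hL (N := {1}) fun x hx => ⟨1, rfl, h x hx⟩
  obtain ⟨i, hi, h0⟩ := (this.and (hmem 1 one_pos)).exists
  obtain ⟨x, hx, hx'⟩ := hF i h0.1
  obtain ⟨n, rfl, hn⟩ := hi x hx
  exact hx' hn

end Family

/-! ### Recurrence in coordinates -/

section Recurrence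

variable {A₁ A₂ : Type*} {B₁ : A₁ → A₁ → Prop} {B₂ : A₂ → A₂ → Prop} {ε : ℝ}

namespace ConformalCantor

open Classical in
/-- The family of the affine maps `F^{θb}`. -/
noncomputable def fam (K : ConformalCantor B₁ ε) (c : A₁ → ℂ) (θ : NegSeq B₁) (b : A₁) : AffC :=
  if h : B₁ (θ.1 0) b then K.renormAff c θ b h else 1

theorem fam_eq (K : ConformalCantor B₁ ε) (c : A₁ → ℂ) {θ : NegSeq B₁} {b : A₁}
    (h : B₁ (θ.1 0) b) : K.fam c θ b = K.renormAff c θ b h := dif_pos h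

/-- Renormalization multiplies on the right, so it commutes with the diagonal left action; this is
why it descends to 𝒞. -/
theorem Renorm.mul_left {K : ConformalCantor B₁ ε} {c : A₁ → ℂ} {x y : AffC × NegSeq B₁}
    {w : List A₁} (h : K.Renorm c x w y) (T : AffC) :
    K.Renorm c (T * x.1, x.2) w (T * y.1, y.2) := by
  induction h with
  | nil x => exact .nil _
  | cons S θ b h w y hy ih =>
    refine .cons _ _ b h w _ ?_
    rw [mul_assoc]
    exact ih

end ConformalCantor

variable {K₁ : ConformalCantor B₁ ε} {K₂ : ConformalCantor B₂ ε} {c₁ : A₁ → ℂ} {c₂ : A₂ → ℂ}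

theorem relRenorm_mk_iff {x₁ : AffC × NegSeq B₁} {x₂ : AffC × NegSeq B₂} {w₁ : List A₁}
    {w₂ : List A₂} {u : RelConf B₁ B₂} :
    RelRenorm K₁ c₁ K₂ c₂ (RelConf.mk x₁ x₂) w₁ w₂ u ↔
      ∃ y₁ y₂, u = RelConf.mk y₁ y₂ ∧ K₁.Renorm c₁ x₁ w₁ y₁ ∧ K₂.Renorm c₂ x₂ w₂ y₂ := by
  constructor
  · rintro ⟨z₁, z₂, y₁, y₂, hv, rfl, h₁, h₂⟩
    obtain ⟨T, hT⟩ := Quotient.exact hv.symm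
    obtain ⟨rfl, rfl⟩ := Prod.ext_iff.1 hT
    exact ⟨_, _, Quotient.sound ⟨T, rfl⟩, h₁.mul_left T, h₂.mul_left T⟩
  · rintro ⟨y₁, y₂, hu, h₁, h₂⟩
    exact ⟨x₁, x₂, y₁, y₂, rfl, hu, h₁, h₂⟩

theorem relRenorm_cons_left {S : AffC} {θ : NegSeq B₁} {x₂ : AffC × NegSeq B₂} {b : A₁}
    {w₁ : List A₁} {w₂ : List A₂} {u : RelConf B₁ B₂} :
    RelRenorm K₁ c₁ K₂ c₂ (RelConf.mk (S, θ) x₂) (b :: w₁) w₂ u ↔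
      B₁ (θ.1 0) b ∧
        RelRenorm K₁ c₁ K₂ c₂ (RelConf.mk (S * K₁.fam c₁ θ b, θ.ext' b) x₂) w₁ w₂ u := by
  rw [relRenorm_mk_iff, relRenorm_mk_iff]
  constructor
  · rintro ⟨y₁, y₂, hu, h₁, h₂⟩
    cases h₁ with
    | cons _ _ _ h _ _ hy =>
      refine ⟨h, y₁, y₂, hu, ?_, h₂⟩
      rw [K₁.fam_eq c₁ h, NegSeq.ext'_eq h]
      exact hy
  · rintro ⟨h, y₁, y₂, hu, h₁, h₂⟩
    rw [K₁.fam_eq c₁ h, NegSeq.ext'_eq h] at h₁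
    exact ⟨y₁, y₂, hu, .cons _ _ _ h _ _ h₁, h₂⟩

theorem relRenorm_cons_right {S : AffC} {θ : NegSeq B₂} {x₁ : AffC × NegSeq B₁} {b : A₂}
    {w₁ : List A₁} {w₂ : List A₂} {u : RelConf B₁ B₂} :
    RelRenorm K₁ c₁ K₂ c₂ (RelConf.mk x₁ (S, θ)) w₁ (b :: w₂) u ↔
      B₂ (θ.1 0) b ∧
        RelRenorm K₁ c₁ K₂ c₂ (RelConf.mk x₁ (S * K₂.fam c₂ θ b, θ.ext' b)) w₁ w₂ u := by
  rw [relRenorm_mk_iff, relRenorm_mk_iff]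
  constructor
  · rintro ⟨y₁, y₂, hu, h₁, h₂⟩
    cases h₂ with
    | cons _ _ _ h _ _ hy =>
      refine ⟨h, y₁, y₂, hu, h₁, ?_⟩
      rw [K₂.fam_eq c₂ h, NegSeq.ext'_eq h]
      exact hy
  · rintro ⟨h, y₁, y₂, hu, h₁, h₂⟩
    rw [K₂.fam_eq c₂ h, NegSeq.ext'_eq h] at h₂
    exact ⟨y₁, y₂, hu, h₁, .cons _ _ _ h _ _ h₂⟩

/-- The two words act on different factors, so the order in which their letters are applied is
irrelevant and only the total length counts. From words to steps, the letters of `w₁` are used up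
before those of `w₂`. -/
theorem exists_relRenorm_iff (n : ℕ) (O : Set (RelConf B₁ B₂)) (v : RelConf B₁ B₂) :
    (∃ w₁ w₂ u, w₁.length + w₂.length = n ∧ RelRenorm K₁ c₁ K₂ c₂ v w₁ w₂ u ∧ u ∈ O) ↔
      RelConf.homeo B₁ B₂ v ∈
        Reach (Step (K₁.fam c₁, K₂.fam c₂)) (RelConf.homeo B₁ B₂ '' O) n := by
  induction n generalizing v with
  | zero =>
    obtain ⟨⟨x₁, x₂⟩, rfl⟩ := Quotient.exists_rep v
    show (∃ w₁ w₂ u, _ ∧ RelRenorm K₁ c₁ K₂ c₂ (RelConf.mk x₁ x₂) w₁ w₂ u ∧ u ∈ O) ↔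
      RelConf.homeo B₁ B₂ (RelConf.mk x₁ x₂) ∈ _ '' O
    rw [(RelConf.homeo B₁ B₂).injective.mem_set_image]
    constructor
    · rintro ⟨w₁, w₂, u, h, hu, huO⟩
      obtain ⟨h1, h2⟩ := Nat.add_eq_zero_iff.1 h
      rw [List.length_eq_zero_iff] at h1 h2
      subst h1 h2
      obtain ⟨y₁, y₂, rfl, h₁, h₂⟩ := relRenorm_mk_iff.1 hu
      cases h₁
      cases h₂
      exact huO
    · intro h
      exact ⟨[], [], _, rfl, relRenorm_mk_iff.2 ⟨x₁, x₂, rfl, .nil _, .nil _⟩, h⟩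
  | succ n ih =>
    obtain ⟨⟨⟨S₁, θ₁⟩, ⟨S₂, θ₂⟩⟩, rfl⟩ := Quotient.exists_rep v
    show (∃ w₁ w₂ u, _ ∧ RelRenorm K₁ c₁ K₂ c₂ (RelConf.mk (S₁, θ₁) (S₂, θ₂)) w₁ w₂ u ∧ u ∈ O) ↔
      ∃ y ∈ Reach _ _ n, Step _ (S₁⁻¹ * S₂, θ₁, θ₂) y
    have hl (b) : RelConf.homeo B₁ B₂ (RelConf.mk (S₁ * K₁.fam c₁ θ₁ b, θ₁.ext' b) (S₂, θ₂)) =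
        ((K₁.fam c₁ θ₁ b)⁻¹ * (S₁⁻¹ * S₂), θ₁.ext' b, θ₂) := by
      rw [RelConf.homeo_mk, mul_inv_rev, mul_assoc]
    have hr (b) : RelConf.homeo B₁ B₂ (RelConf.mk (S₁, θ₁) (S₂ * K₂.fam c₂ θ₂ b, θ₂.ext' b)) =
        (S₁⁻¹ * S₂ * K₂.fam c₂ θ₂ b, θ₁, θ₂.ext' b) := by
      rw [RelConf.homeo_mk, mul_assoc]
    constructor
    · rintro ⟨w₁, w₂, u, h, hu, huO⟩
      cases w₁ with
      | cons b w₁ =>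
        obtain ⟨hb, hu⟩ := relRenorm_cons_left.1 hu
        refine ⟨_, (ih _).1 ⟨w₁, w₂, u, ?_, hu, huO⟩, Or.inl ⟨b, hb, hl b⟩⟩
        simp only [List.length_cons] at h
        omega
      | nil =>
        cases w₂ with
        | nil => simp at h
        | cons b w₂ =>
          obtain ⟨hb, hu⟩ := relRenorm_cons_right.1 hu
          refine ⟨_, (ih _).1 ⟨[], w₂, u, ?_, hu, huO⟩, Or.inr ⟨b, hb, hr b⟩⟩
          simp only [List.length_cons] at h
          omega
    · rintro ⟨y, hy, ⟨b, hb, rfl⟩ | ⟨b, hb, rfl⟩⟩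
      · rw [← hl b] at hy
        obtain ⟨w₁, w₂, u, h, hu, huO⟩ := (ih _).2 hy
        refine ⟨b :: w₁, w₂, u, ?_, relRenorm_cons_left.2 ⟨hb, hu⟩, huO⟩
        simp only [List.length_cons]
        omega
      · rw [← hr b] at hy
        obtain ⟨w₁, w₂, u, h, hu, huO⟩ := (ih _).2 hy
        refine ⟨w₁, b :: w₂, u, ?_, relRenorm_cons_right.2 ⟨hb, hu⟩, huO⟩
        simp only [List.length_cons]
        omega

theorem isImmediatelyRecurrent_iff {L : Set (RelConf B₁ B₂)} :
    IsImmediatelyRecurrent K₁ c₁ K₂ c₂ L ↔ IsCompact (RelConf.homeo B₁ B₂ '' L) ∧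
      ∀ x ∈ RelConf.homeo B₁ B₂ '' L,
        x ∈ Reach (Step (K₁.fam c₁, K₂.fam c₂)) (interior (RelConf.homeo B₁ B₂ '' L)) 1 := by
  rw [(RelConf.homeo B₁ B₂).isCompact_image, forall_mem_image,
    ← (RelConf.homeo B₁ B₂).image_interior]
  exact and_congr_right fun _ => forall₂_congr fun v _ => exists_relRenorm_iff 1 _ v

theorem isRecurrent_iff {L : Set (RelConf B₁ B₂)} :
    IsRecurrent K₁ c₁ K₂ c₂ L ↔ IsCompact (RelConf.homeo B₁ B₂ '' L) ∧
      ∀ x ∈ RelConf.homeo B₁ B₂ '' L, ∃ n ∈ Ici 1,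
        x ∈ Reach (Step (K₁.fam c₁, K₂.fam c₂)) (interior (RelConf.homeo B₁ B₂ '' L)) n := by
  rw [(RelConf.homeo B₁ B₂).isCompact_image, forall_mem_image,
    ← (RelConf.homeo B₁ B₂).image_interior]
  refine and_congr_right fun _ => forall₂_congr fun v _ => ?_
  simp only [← exists_relRenorm_iff]
  constructor
  · rintro ⟨w₁, w₂, u, h, hu⟩
    exact ⟨_, h, w₁, w₂, u, rfl, hu⟩
  · rintro ⟨n, hn, w₁, w₂, u, h, hu⟩
    exact ⟨w₁, w₂, u, by rw [h]; exact hn, hu⟩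

end Recurrence

end ConfCantor

namespace ConfCantor

namespace ConformalCantor

variable {A : Type*} {B : A → A → Prop} {ε : ℝ} (K : ConformalCantor B ε)

/-! ### The expanding map and its inverse branches -/

theorem injOn_G (a : A) : InjOn K.g (K.G a) := by
  obtain ⟨U, -, hGU, -, hU, -⟩ := K.expanding a
  exact hU.2.1.mono hGU

variable {K}

theorem eq_of_mem_G {a b : A} {x : ℂ} (ha : x ∈ K.G a) (hb : x ∈ K.G b) : a = b := by
  by_contra h
  exact (K.disjoint_G a b h).le_bot ⟨ha, hb⟩

theorem admissible {a b : A} {x : ℂ} (ha : x ∈ K.G a) (hb : K.g x ∈ K.G b) : B a b := by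
  by_contra h
  exact (K.markov_not a b h).le_bot ⟨hb, x, ha, rfl⟩

theorem branch_g {a : A} {x : ℂ} (hx : x ∈ K.G a) : K.branch a (K.g x) = x :=
  (K.injOn_G a).leftInvOn_invFunOn hx

theorem branch_spec {a b : A} (h : B a b) {z : ℂ} (hz : z ∈ K.G b) :
    K.branch a z ∈ interior (K.G a) ∧ K.g (K.branch a z) = z := by
  obtain ⟨x, hx, rfl⟩ := K.markov a b h hz
  rw [branch_g (interior_subset hx)]
  exact ⟨hx, rfl⟩

theorem branch_mem {a b : A} (h : B a b) {z : ℂ} (hz : z ∈ K.G b) : K.branch a z ∈ K.G a :=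
  interior_subset (branch_spec h hz).1

theorem g_branch {a b : A} (h : B a b) {z : ℂ} (hz : z ∈ K.G b) : K.g (K.branch a z) = z :=
  (branch_spec h hz).2

theorem g_mem_cantorSet {x : ℂ} (hx : x ∈ K.cantorSet) : K.g x ∈ K.cantorSet :=
  fun n => hx (n + 1)

theorem exists_mem_piece {x : ℂ} (hx : x ∈ K.cantorSet) : ∃ a, x ∈ K.piece a := by
  obtain ⟨a, ha⟩ := mem_iUnion.1 (hx 0)
  exact ⟨a, hx, ha⟩

/-- A point of the Cantor set is the image of its own image under an inverse branch, and inverse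
branches take values in interiors by the form of the Markov property. -/
theorem piece_subset_interior {a : A} {x : ℂ} (hx : x ∈ K.piece a) : x ∈ interior (K.G a) := by
  obtain ⟨b, hb⟩ := exists_mem_piece (g_mem_cantorSet hx.1)
  have h := (branch_spec (admissible hx.2 hb.2) hb.2).1
  rwa [branch_g hx.2] at h

theorem branch_mem_piece {a b : A} (h : B a b) {z : ℂ} (hz : z ∈ K.piece b) :
    K.branch a z ∈ K.piece a := by
  refine ⟨fun n => ?_, branch_mem h hz.2⟩
  cases n with
  | zero => exact mem_iUnion.2 ⟨a, branch_mem h hz.2⟩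
  | succ n =>
    rw [Function.iterate_succ_apply, g_branch h hz.2]
    exact hz.1 n

theorem contDiffAt_g {x : ℂ} (hx : x ∈ K.V) : ContDiffAt ℝ 1 K.g x :=
  (K.smooth.1 x hx).contDiffAt (K.isOpen_V.mem_nhds hx)

theorem hasStrictFDerivAt_g {x : ℂ} (hx : x ∈ K.V) :
    HasStrictFDerivAt K.g (fderiv ℝ K.g x) x :=
  (contDiffAt_g hx).hasStrictFDerivAt one_ne_zero

theorem continuousAt_g {x : ℂ} (hx : x ∈ K.V) : ContinuousAt K.g x :=
  (contDiffAt_g hx).continuousAt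

theorem continuousAt_fderiv {x : ℂ} (hx : x ∈ K.V) : ContinuousAt (fderiv ℝ K.g) x :=
  (K.smooth.1.continuousOn_fderiv_of_isOpen K.isOpen_V le_rfl).continuousAt
    (K.isOpen_V.mem_nhds hx)

theorem norm_le_fderiv {a : A} {x : ℂ} (hx : x ∈ K.G a) (v : ℂ) :
    ‖v‖ ≤ ‖fderiv ℝ K.g x v‖ := by
  obtain ⟨U, -, hGU, -, -, μ, hμ, hU⟩ := K.expanding a
  exact le_trans (by nlinarith [norm_nonneg v]) (hU x (hGU hx) v)

variable (K) in
/-- The derivative of the expanding map at a point of the Cantor set, as a complex number. -/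
noncomputable def der (x : ℂ) : ℂ := fderiv ℝ K.g x 1

theorem fderiv_apply {x : ℂ} (hx : x ∈ K.cantorSet) (v : ℂ) :
    fderiv ℝ K.g x v = K.der x * v := by
  obtain ⟨l, hl⟩ := K.conformal x hx
  rw [der, hl, hl, mul_one]

theorem one_le_norm_der {a : A} {x : ℂ} (hx : x ∈ K.G a) : 1 ≤ ‖K.der x‖ := by
  simpa [der] using norm_le_fderiv hx 1

theorem der_ne_zero {a : A} {x : ℂ} (hx : x ∈ K.G a) : K.der x ≠ 0 :=
  norm_pos_iff.1 (one_pos.trans_le (one_le_norm_der hx))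

/-- Conformality makes the real derivative complex linear at these points, so derivatives of
compositions of branches there are products of complex numbers. -/
theorem hasDerivAt_g {a : A} {x : ℂ} (hx : x ∈ K.piece a) : HasDerivAt K.g (K.der x) x := by
  have h := (hasStrictFDerivAt_g (K.G_subset_V a hx.2)).hasFDerivAt
  rw [hasDerivAt_iff_hasFDerivAt]
  refine hasFDerivAt_of_restrictScalars ℝ h ?_
  ext v; simp [fderiv_apply hx.1, mul_comm]

/-- Expansion makes the derivative injective, hence bijective in dimension two, so `g` maps the
neighbourhood filter of `x` onto that of `g x`. On a neighbourhood of `x` contained in the piece,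
`branch` undoes `g`. -/
theorem continuousAt_branch {a : A} {x : ℂ} (hx : x ∈ interior (K.G a)) :
    ContinuousAt (K.branch a) (K.g x) ∧ ∀ᶠ y in 𝓝 (K.g x), K.g (K.branch a y) = y := by
  have hxG := interior_subset hx
  have hs := hasStrictFDerivAt_g (K.G_subset_V a hxG)
  have hinj : Function.Injective (fderiv ℝ K.g x) := by
    rw [injective_iff_map_eq_zero]
    intro v hv
    have := norm_le_fderiv hxG v
    rw [hv, norm_zero] at this
    exact norm_le_zero_iff.1 this
  have hsurj : Function.Surjective (fderiv ℝ K.g x) :=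
    (LinearMap.injective_iff_surjective (f := (fderiv ℝ K.g x).toLinearMap)).1 hinj
  have hmap : map K.g (𝓝 x) = 𝓝 (K.g x) :=
    hs.map_nhds_eq_of_surj (LinearMap.range_eq_top.2 hsurj)
  have hev : ∀ᶠ y in 𝓝 x, y ∈ K.G a := mem_interior_iff_mem_nhds.1 hx
  constructor
  · rw [ContinuousAt, ← hmap, tendsto_map'_iff, branch_g hxG]
    refine tendsto_id.congr' ?_
    filter_upwards [hev] with y hy
    exact (branch_g hy).symm
  · rw [← hmap, eventually_map]
    filter_upwards [hev] with y hy
    rw [branch_g hy]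

theorem hasDerivAt_branch {a b : A} (h : B a b) {z : ℂ} (hz : z ∈ K.piece b) :
    HasDerivAt (K.branch a) (K.der (K.branch a z))⁻¹ z := by
  have hx := branch_mem_piece h hz
  obtain ⟨h1, h2⟩ := continuousAt_branch (piece_subset_interior hx)
  rw [g_branch h hz.2] at h1 h2
  exact (hasDerivAt_g hx).of_local_left_inverse h1 (der_ne_zero hx.2) h2

/-! ### Compositions of inverse branches -/

variable (K) in
/-- The composition of the inverse branches along a word `w 0, …, w n`. -/
noncomputable def fSeq (w : ℕ → A) : ℕ → ℂ → ℂ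
  | 0 => id
  | n + 1 => fun z => K.branch (w (n + 1)) (fSeq w n z)

theorem fWord_eq (θ : NegSeq B) (n : ℕ) : K.fWord θ n = K.fSeq θ.1 n := by
  induction n with
  | zero => rfl
  | succ n ih => funext z; simp only [fWord, fSeq, ih]

theorem fSeq_mem {w : ℕ → A} {n : ℕ} (hw : ∀ i < n, B (w (i + 1)) (w i)) {z : ℂ}
    (hz : z ∈ K.G (w 0)) {m : ℕ} (hm : m ≤ n) : K.fSeq w m z ∈ K.G (w m) := by
  induction m with
  | zero => exact hz
  | succ m ih => exact branch_mem (hw m hm) (ih (Nat.le_of_succ_le hm))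

theorem fSeq_mem_piece {w : ℕ → A} {n : ℕ} (hw : ∀ i < n, B (w (i + 1)) (w i)) {z : ℂ}
    (hz : z ∈ K.piece (w 0)) {m : ℕ} (hm : m ≤ n) : K.fSeq w m z ∈ K.piece (w m) := by
  induction m with
  | zero => exact hz
  | succ m ih => exact branch_mem_piece (hw m hm) (ih (Nat.le_of_succ_le hm))

theorem g_fSeq {w : ℕ → A} {n : ℕ} (hw : ∀ i < n, B (w (i + 1)) (w i)) {z : ℂ}
    (hz : z ∈ K.G (w 0)) {m : ℕ} (hm : m < n) : K.g (K.fSeq w (m + 1) z) = K.fSeq w m z :=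
  g_branch (hw m hm) (fSeq_mem hw hz hm.le)

theorem fWord_mem (θ : NegSeq B) (n : ℕ) {z : ℂ} (hz : z ∈ K.G (θ.1 0)) :
    K.fWord θ n z ∈ K.G (θ.1 n) :=
  fWord_eq (K := K) θ n ▸ fSeq_mem (fun i _ => θ.2 i) hz le_rfl

theorem fWord_mem_piece (θ : NegSeq B) (n : ℕ) {z : ℂ} (hz : z ∈ K.piece (θ.1 0)) :
    K.fWord θ n z ∈ K.piece (θ.1 n) :=
  fWord_eq (K := K) θ n ▸ fSeq_mem_piece (fun i _ => θ.2 i) hz le_rfl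

theorem g_fWord (θ : NegSeq B) (n : ℕ) {z : ℂ} (hz : z ∈ K.G (θ.1 0)) :
    K.g (K.fWord θ (n + 1) z) = K.fWord θ n z :=
  g_branch (θ.2 n) (fWord_mem θ n hz)

theorem fWord_snoc (θ : NegSeq B) {b : A} (h : B (θ.1 0) b) (n : ℕ) (z : ℂ) :
    K.fWord (θ.snoc b h) (n + 1) z = K.fWord θ n (K.branch (θ.1 0) z) := by
  induction n with
  | zero => rfl
  | succ n ih =>
    change K.branch (θ.1 (n + 1)) (K.fWord (θ.snoc b h) (n + 1) z) = _
    rw [ih]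
    rfl

variable (K) in
/-- The derivative of `f_{θₙ}` at the point `z` of the Cantor set. -/
noncomputable def dAt (θ : NegSeq B) (n : ℕ) (z : ℂ) : ℂ :=
  ∏ i ∈ Finset.range n, (K.der (K.fWord θ (i + 1) z))⁻¹

theorem hasDerivAt_fWord (θ : NegSeq B) (n : ℕ) {z : ℂ} (hz : z ∈ K.piece (θ.1 0)) :
    HasDerivAt (K.fWord θ n) (K.dAt θ n z) z := by
  induction n with
  | zero => simpa [dAt, fWord] using hasDerivAt_id z
  | succ n ih =>
    rw [dAt, Finset.prod_range_succ, mul_comm]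
    exact (hasDerivAt_branch (θ.2 n) (fWord_mem_piece θ n hz)).comp z ih

theorem dAt_succ (θ : NegSeq B) (n : ℕ) (z : ℂ) :
    K.dAt θ (n + 1) z = K.dAt θ n z * (K.der (K.fWord θ (n + 1) z))⁻¹ :=
  Finset.prod_range_succ _ _

theorem dAt_ne_zero (θ : NegSeq B) (n : ℕ) {z : ℂ} (hz : z ∈ K.G (θ.1 0)) :
    K.dAt θ n z ≠ 0 :=
  Finset.prod_ne_zero_iff.2 fun i _ => inv_ne_zero (der_ne_zero (fWord_mem θ (i + 1) hz))

theorem dAt_snoc (θ : NegSeq B) {b : A} (h : B (θ.1 0) b) (n : ℕ) (z : ℂ) :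
    K.dAt (θ.snoc b h) (n + 1) z =
      K.dAt θ n (K.branch (θ.1 0) z) * (K.der (K.branch (θ.1 0) z))⁻¹ := by
  rw [dAt, Finset.prod_range_succ']
  simp only [fWord_snoc]
  rfl

variable {c : A → ℂ}

theorem dWord_eq (hc : K.IsBase c) (θ : NegSeq B) (n : ℕ) :
    K.dWord c θ n = K.dAt θ n (c (θ.1 0)) := by
  rw [dWord, (hasDerivAt_fWord θ n (hc _)).hasFDerivAt.restrictScalars ℝ |>.fderiv]
  simp

theorem toUnit_val {z : ℂ} (hz : z ≠ 0) : (toUnit z : ℂ) = z := by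
  rw [toUnit, dif_neg hz]; rfl

theorem phi_lin (hc : K.IsBase c) (θ : NegSeq B) (n : ℕ) :
    ((K.phi c θ n).lin : ℂ) = (K.dAt θ n (c (θ.1 0)))⁻¹ := by
  rw [phi, Units.val_inv_eq_inv_val, dWord_eq hc, toUnit_val (dAt_ne_zero θ n (hc _).2)]

theorem phi_tr (hc : K.IsBase c) (θ : NegSeq B) (n : ℕ) :
    (K.phi c θ n).tr = -((K.dAt θ n (c (θ.1 0)))⁻¹ * K.fWord θ n (c (θ.1 0))) := by
  rw [← phi_lin hc]; rfl

theorem kApprox_eq (hc : K.IsBase c) (θ : NegSeq B) (n : ℕ) (z : ℂ) :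
    K.kApprox c θ n z =
      (K.fWord θ n z - K.fWord θ n (c (θ.1 0))) / K.dAt θ n (c (θ.1 0)) := by
  rw [kApprox, AffC.app, phi_lin hc, phi_tr hc]
  ring

theorem kApprox_base (hc : K.IsBase c) (θ : NegSeq B) (n : ℕ) :
    K.kApprox c θ n (c (θ.1 0)) = 0 := by
  rw [kApprox_eq hc, sub_self, zero_div]

theorem kApprox_snoc (θ : NegSeq B) {b : A} (h : B (θ.1 0) b) (n : ℕ) (z : ℂ) :
    (K.phi c θ n * (K.phi c (θ.snoc b h) (n + 1))⁻¹).app (K.kApprox c (θ.snoc b h) (n + 1) z) =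
      K.kApprox c θ n (K.branch (θ.1 0) z) := by
  rw [kApprox, ← AffC.mul_app, inv_mul_cancel_right, fWord_snoc]
  rfl

/-- The linear part of the approximants of F^{θb} involves only the quotient of the derivatives of
f_{θₙ} at two Cantor points; their translation part is a value of kₙ^θ. The two limits can thus be
treated separately. -/
theorem phi_mul_lin (hc : K.IsBase c) (θ : NegSeq B) {b : A} (h : B (θ.1 0) b) (n : ℕ) :
    ((K.phi c θ n * (K.phi c (θ.snoc b h) (n + 1))⁻¹).lin : ℂ) =
      K.dAt θ n (K.branch (θ.1 0) (c b)) / K.dAt θ n (c (θ.1 0)) /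
        K.der (K.branch (θ.1 0) (c b)) := by
  rw [AffC.mul_lin, AffC.inv_lin, Units.val_mul, Units.val_inv_eq_inv_val, phi_lin hc, phi_lin hc,
    inv_inv]
  change _ * K.dAt (θ.snoc b h) (n + 1) (c b) = _
  rw [dAt_snoc, div_eq_mul_inv, div_eq_mul_inv]
  ring

theorem phi_mul_tr (hc : K.IsBase c) (θ : NegSeq B) {b : A} (h : B (θ.1 0) b) (n : ℕ) :
    (K.phi c θ n * (K.phi c (θ.snoc b h) (n + 1))⁻¹).tr =
      K.kApprox c θ n (K.branch (θ.1 0) (c b)) := by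
  rw [← kApprox_snoc θ h]
  have := kApprox_base hc (θ.snoc b h) (n + 1)
  change K.kApprox c (θ.snoc b h) (n + 1) (c b) = 0 at this
  rw [this, AffC.app, mul_zero, zero_add]

end ConformalCantor

end ConfCantor

namespace ConfCantor

/-! ### Two auxiliary facts -/

/-- To check a uniform statement it suffices to consider families of points along ultrafilters. -/
theorem eventually_forall_of_ultrafilter {ι Y : Type*} {l : Filter ι} {H P : ι → Y → Prop}
    (h : ∀ U : Ultrafilter ι, ↑U ≤ l → ∀ y : ι → Y, (∀ᶠ i in U, H i (y i)) →
      ∃ᶠ i in U, P i (y i)) :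
    ∀ᶠ i in l, ∀ y, H i y → P i y := by
  by_contra hcon
  have hne : (l ⊓ 𝓟 {i | ∃ y, H i y ∧ ¬ P i y}).NeBot := by
    rw [← frequently_mem_iff_neBot]
    refine (not_eventually.1 hcon).mono fun i hi => ?_
    push Not at hi
    exact hi
  -- If the conclusion fails, the indices with a counterexample meet every set of `l`. An
  -- ultrafilter containing them carries a whole family of counterexamples, whose limits can then be
  -- studied.
  set U := Ultrafilter.of (l ⊓ 𝓟 {i | ∃ y, H i y ∧ ¬ P i y})
  have hU : ↑U ≤ l ⊓ 𝓟 {i | ∃ y, H i y ∧ ¬ P i y} := Ultrafilter.of_le _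
  have hex : ∀ᶠ i in (U : Filter ι), ∃ y, H i y ∧ ¬ P i y :=
    (hU.trans inf_le_right) (mem_principal_self _)
  obtain ⟨y, hy⟩ := hex.choice
  exact h U (hU.trans inf_le_left) y (hy.mono fun i hi => hi.1) (hy.mono fun i hi => hi.2)

/-- Serves to produce uniform constants: the first variable is a candidate constant, tending to `0`
or to infinity, the second a nearby Cantor set. -/
theorem exists_of_eventually_prod {α ι : Type*} {k : Filter α} [k.NeBot] {l : Filter ι}
    {P : α → ι → Prop} (h : ∀ᶠ p in k ×ˢ l, P p.1 p.2) : ∃ a, ∀ᶠ i in l, P a i :=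
  h.curry.exists

/-- A map which contracts at small scales contracts a connected set which is covered by a finite
number of small balls. -/
theorem norm_sub_le_of_isPreconnected {X : Set ℂ} (hX : IsPreconnected X) {s : Finset ℂ} {r k : ℝ}
    (hk : 0 ≤ k) (hr : 0 < r) (hs : X ⊆ ⋃ c ∈ s, Metric.ball c r) {f : ℂ → ℂ}
    (hf : ∀ x ∈ X, ∀ y ∈ X, ‖x - y‖ < 2 * r → ‖f x - f y‖ ≤ k * ‖x - y‖) {x y : ℂ} (hx : x ∈ X)
    (hy : y ∈ X) : ‖f x - f y‖ ≤ s.card * (k * (2 * r)) := by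
  have hcont : ContinuousOn (fun z => ‖f z - f y‖) X := by
    refine ContinuousOn.norm (ContinuousOn.sub ?_ continuousOn_const)
    rw [Metric.continuousOn_iff]
    intro z hz e he
    refine ⟨min (2 * r) (e / (k + 1)), by positivity, fun w hw hwz => ?_⟩
    rw [dist_eq_norm] at hwz ⊢
    calc ‖f w - f z‖ ≤ k * ‖w - z‖ := hf w hw z hz (hwz.trans_le (min_le_left _ _))
      _ ≤ k * (e / (k + 1)) := by gcongr; exact hwz.le.trans (min_le_right _ _)
      _ < e := by rw [← mul_div_assoc, div_lt_iff₀ (by positivity)]; nlinarith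
  -- The image of `X` under the distance to `f y` is connected and contains this interval. Each
  -- small ball contributes a set of length at most `2kr`, so the length of the interval is at most
  -- `s.card` times that.
  have hI : Icc 0 ‖f x - f y‖ ⊆ (fun z => ‖f z - f y‖) '' X :=
    (hX.image _ hcont).Icc_subset ⟨y, hy, by simp⟩ ⟨x, hx, rfl⟩
  have hcov : Icc 0 ‖f x - f y‖ ⊆ ⋃ c ∈ s, (fun z => ‖f z - f y‖) '' (X ∩ Metric.ball c r) := by
    intro t ht
    obtain ⟨z, hz, rfl⟩ := hI ht
    obtain ⟨c, hc, hzc⟩ := mem_iUnion₂.1 (hs hz)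
    exact mem_biUnion hc ⟨z, ⟨hz, hzc⟩, rfl⟩
  have hdiam : ∀ c ∈ s, MeasureTheory.volume ((fun z => ‖f z - f y‖) '' (X ∩ Metric.ball c r)) ≤
      ENNReal.ofReal (k * (2 * r)) := by
    intro c _
    refine (Real.volume_le_diam _).trans (Metric.ediam_le ?_)
    rintro _ ⟨z, ⟨hz, hzc⟩, rfl⟩ _ ⟨w, ⟨hw, hwc⟩, rfl⟩
    rw [edist_dist]
    refine ENNReal.ofReal_le_ofReal ?_
    have hzw : ‖z - w‖ < 2 * r := by
      rw [← dist_eq_norm]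
      have := dist_triangle_right z w c
      rw [Metric.mem_ball] at hzc hwc
      linarith
    calc dist ‖f z - f y‖ ‖f w - f y‖ ≤ ‖(f z - f y) - (f w - f y)‖ := abs_norm_sub_norm_le _ _
      _ = ‖f z - f w‖ := by congr 1; ring
      _ ≤ k * ‖z - w‖ := hf z hz w hw hzw
      _ ≤ k * (2 * r) := by gcongr
  have h := (MeasureTheory.measure_mono hcov).trans
    ((MeasureTheory.measure_biUnion_finset_le s _).trans (Finset.sum_le_sum hdiam))
  rw [Real.volume_Icc, sub_zero, Finset.sum_const, nsmul_eq_mul,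
    ← ENNReal.ofReal_natCast, ← ENNReal.ofReal_mul (by positivity)] at h
  exact (ENNReal.ofReal_le_ofReal_iff (by positivity)).1 h

/-- The Whitney bound on the Taylor remainder replaces the mean value inequality, for which the set
would have to be convex. -/
theorem C1HolderClose.norm_sub_le {ε δ : ℝ} (hε : 0 < ε) {f h : ℂ → ℂ} {S : Set ℂ}
    (H : C1HolderClose ε δ f h S) {x y : ℂ} (hx : x ∈ S) (hy : y ∈ S) :
    ‖(f x - h x) - (f y - h y)‖ ≤ δ * (1 + ‖x - y‖ ^ ε) * ‖x - y‖ := by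
  have h1 := H.2.2.2 y hy x hx
  have h2 := (fderiv ℝ f y - fderiv ℝ h y).le_of_opNorm_le (H.2.1 y hy) (x - y)
  rw [Real.rpow_one_add' (norm_nonneg _) (by linarith)] at h1
  have h3 := norm_add_le ((f x - h x) - (f y - h y) - (fderiv ℝ f y - fderiv ℝ h y) (x - y))
    ((fderiv ℝ f y - fderiv ℝ h y) (x - y))
  rw [sub_add_cancel] at h3
  calc _ ≤ _ := h3
    _ ≤ δ * (‖x - y‖ * ‖x - y‖ ^ ε) + δ * ‖x - y‖ := add_le_add h1 h2
    _ = _ := by ring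

namespace ConformalCantor

variable {A : Type*} {B : A → A → Prop} {ε : ℝ} {K : ConformalCantor B ε}

/-! ### Convergence of conformal Cantor sets -/

/-- The Cantor sets `M i` converge to `K` along `l`. -/
def Conv {ι : Type*} (l : Filter ι) (M : ι → ConformalCantor B ε) (K : ConformalCantor B ε) :
    Prop := ∀ δ > 0, ∀ᶠ i in l, K.Near δ (M i)

theorem near_self (K : ConformalCantor B ε) {δ : ℝ} (hδ : 0 < δ) : K.Near δ K := by
  refine ⟨fun a => ⟨Metric.self_subset_thickening hδ _, Metric.self_subset_thickening hδ _⟩,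
    ?_, ?_, ?_, ?_⟩
  · intro x _; simp [hδ.le]
  · intro x _; simp [hδ.le]
  · intro x _ y _; simp only [sub_self, norm_zero]; positivity
  · intro x _ y _; simp only [sub_self, norm_zero, zero_apply]; positivity

theorem conv_const {ι : Type*} (l : Filter ι) (K : ConformalCantor B ε) : Conv l (fun _ => K) K :=
  fun _ hδ => Eventually.of_forall fun _ => near_self K hδ

variable {ι : Type*} {l : Filter ι} {M : ι → ConformalCantor B ε}

theorem Conv.mono {l' : Filter ι} (hM : Conv l M K) (h : l' ≤ l) : Conv l' M K :=
  fun δ hδ => h (hM δ hδ)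

theorem Conv.mem_G [l.NeBot] (hM : Conv l M K) {a : A} {p : ι → ℂ} {p₀ : ℂ}
    (hp : ∀ᶠ i in l, p i ∈ (M i).G a) (h : Tendsto p l (𝓝 p₀)) : p₀ ∈ K.G a := by
  rw [← (K.isCompact_G a).isClosed.closure_eq, Metric.mem_closure_iff]
  intro r hr
  obtain ⟨i, hi, hi', hn⟩ := (hp.and ((Metric.tendsto_nhds.1 h (r / 2) (half_pos hr)).and
    (hM (r / 2) (half_pos hr)))).exists
  obtain ⟨y, hy, hyp⟩ := Metric.mem_thickening_iff.1 ((hn.1 a).2 hi)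
  exact ⟨y, hy, by linarith [dist_triangle_left p₀ y (p i)]⟩

/-- The nearby pieces eventually lie in a compact thickening of `K.G a`. Every uniform estimate
below starts by passing to such limits. -/
theorem Conv.exists_tendsto {U : Ultrafilter ι} (hM : Conv (U : Filter ι) M K) {a : A}
    {p : ι → ℂ} (hp : ∀ᶠ i in (U : Filter ι), p i ∈ (M i).G a) :
    ∃ p₀ ∈ K.G a, Tendsto p U (𝓝 p₀) := by
  have hc : IsCompact (Metric.cthickening 1 (K.G a)) := (K.isCompact_G a).cthickening
  have : ↑(U.map p) ≤ 𝓟 (Metric.cthickening 1 (K.G a)) := by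
    rw [le_principal_iff]
    show ∀ᶠ i in (U : Filter ι), p i ∈ Metric.cthickening 1 (K.G a)
    filter_upwards [hp, hM 1 one_pos] with i hi hn
    exact Metric.thickening_subset_cthickening _ _ ((hn.1 a).2 hi)
  obtain ⟨p₀, -, h⟩ := hc.ultrafilter_le_nhds _ this
  exact ⟨p₀, hM.mem_G hp h, h⟩

/-- The maps are compared only on the intersection of their domains, and `(M i).V` need not contain
a fixed neighbourhood of `p₀`; hence membership in it is assumed. -/
theorem Conv.eventually_mem_V {p : ι → ℂ} {p₀ : ℂ}
    (hV : ∀ᶠ i in l, p i ∈ (M i).V) (h : Tendsto p l (𝓝 p₀)) (h₀ : p₀ ∈ K.V) :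
    ∀ᶠ i in l, p i ∈ K.V ∩ (M i).V := by
  filter_upwards [hV, h.eventually (K.isOpen_V.mem_nhds h₀)] with i h1 h2
  exact ⟨h2, h1⟩

theorem eventually_mem_V_of_G {a : A} {p : ι → ℂ} (hp : ∀ᶠ i in l, p i ∈ (M i).G a) :
    ∀ᶠ i in l, p i ∈ (M i).V := hp.mono fun i hi => (M i).G_subset_V a hi

theorem Conv.tendsto_g (hM : Conv l M K) {p : ι → ℂ} {p₀ : ℂ}
    (hV : ∀ᶠ i in l, p i ∈ (M i).V) (h : Tendsto p l (𝓝 p₀)) (h₀ : p₀ ∈ K.V) :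
    Tendsto (fun i => (M i).g (p i)) l (𝓝 (K.g p₀)) := by
  have h1 : Tendsto (fun i => K.g (p i) - (M i).g (p i)) l (𝓝 0) := by
    rw [Metric.tendsto_nhds]
    intro r hr
    filter_upwards [hM (r / 2) (half_pos hr), Conv.eventually_mem_V hV h h₀] with i hn hi
    rw [dist_zero_right]
    exact (hn.2.1 _ hi).trans_lt (half_lt_self hr)
  simpa using ((continuousAt_g h₀).tendsto.comp h).sub h1

theorem Conv.tendsto_fderiv (hM : Conv l M K) {p : ι → ℂ} {p₀ : ℂ}
    (hV : ∀ᶠ i in l, p i ∈ (M i).V) (h : Tendsto p l (𝓝 p₀)) (h₀ : p₀ ∈ K.V) :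
    Tendsto (fun i => fderiv ℝ (M i).g (p i)) l (𝓝 (fderiv ℝ K.g p₀)) := by
  have h1 : Tendsto (fun i => fderiv ℝ K.g (p i) - fderiv ℝ (M i).g (p i)) l (𝓝 0) := by
    rw [Metric.tendsto_nhds]
    intro r hr
    filter_upwards [hM (r / 2) (half_pos hr), Conv.eventually_mem_V hV h h₀] with i hn hi
    rw [dist_zero_right]
    exact (hn.2.2.1 _ hi).trans_lt (half_lt_self hr)
  simpa using ((continuousAt_fderiv h₀).tendsto.comp h).sub h1

theorem Conv.tendsto_der (hM : Conv l M K) {p : ι → ℂ} {p₀ : ℂ}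
    (hV : ∀ᶠ i in l, p i ∈ (M i).V) (h : Tendsto p l (𝓝 p₀)) (h₀ : p₀ ∈ K.V) :
    Tendsto (fun i => (M i).der (p i)) l (𝓝 (K.der p₀)) :=
  ((ContinuousLinearMap.apply ℝ ℂ (1 : ℂ)).continuous.tendsto _).comp (hM.tendsto_fderiv hV h h₀)

/-- `(M i).g` is `K.g` minus a difference with small Lipschitz constant, and `K.g` is strictly
differentiable at `p₀`. Each part contributes `r / 2`. -/
theorem Conv.strict (hε : 0 < ε) (hM : Conv l M K) {x y : ι → ℂ} {p₀ : ℂ}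
    (hxV : ∀ᶠ i in l, x i ∈ (M i).V) (hyV : ∀ᶠ i in l, y i ∈ (M i).V)
    (hx : Tendsto x l (𝓝 p₀)) (hy : Tendsto y l (𝓝 p₀)) (h₀ : p₀ ∈ K.V) {r : ℝ} (hr : 0 < r) :
    ∀ᶠ i in l, ‖(M i).g (x i) - (M i).g (y i) - fderiv ℝ K.g p₀ (x i - y i)‖ ≤
      r * ‖x i - y i‖ := by
  have h1 := (hasStrictFDerivAt_g h₀).isLittleO.def (half_pos hr)
  have h2 := (hx.prodMk_nhds hy).eventually h1
  have h3 : ∀ᶠ i in l, ‖x i - y i‖ ≤ 1 := by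
    have : Tendsto (fun i => ‖x i - y i‖) l (𝓝 0) := by simpa using (hx.sub hy).norm
    exact (this.eventually (gt_mem_nhds one_pos)).mono fun _ h => h.le
  filter_upwards [h2, h3, hM (r / 4) (by positivity), Conv.eventually_mem_V hxV hx h₀,
    Conv.eventually_mem_V hyV hy h₀] with i h2 h3 hn hxi hyi
  have h4 := hn.2.norm_sub_le hε hxi hyi
  have h5 : ‖x i - y i‖ ^ ε ≤ 1 := Real.rpow_le_one (norm_nonneg _) h3 hε.le
  have h6 : r / 4 * (1 + ‖x i - y i‖ ^ ε) * ‖x i - y i‖ ≤ r / 2 * ‖x i - y i‖ := by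
    gcongr; nlinarith
  have h7 : (M i).g (x i) - (M i).g (y i) - fderiv ℝ K.g p₀ (x i - y i) =
      (K.g (x i) - K.g (y i) - fderiv ℝ K.g p₀ (x i - y i)) -
        ((K.g (x i) - (M i).g (x i)) - (K.g (y i) - (M i).g (y i))) := by ring
  rw [h7]
  refine (norm_sub_le _ _).trans ?_
  have h8 : ‖K.g (x i) - K.g (y i) - fderiv ℝ K.g p₀ (x i - y i)‖ ≤ r / 2 * ‖x i - y i‖ := h2
  linarith

/-- Any ultrafilter limit of the preimages lies in `K.G a` and is mapped to `p₀` by `K.g`;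
injectivity on the piece leaves only one candidate. -/
theorem Conv.tendsto_branch (hM : Conv l M K) {a b : A} (hab : B a b) {p : ι → ℂ} {p₀ : ℂ}
    (hp : ∀ᶠ i in l, p i ∈ (M i).G b) (h : Tendsto p l (𝓝 p₀)) :
    Tendsto (fun i => (M i).branch a (p i)) l (𝓝 (K.branch a p₀)) := by
  rw [tendsto_iff_ultrafilter]
  intro U hU
  have hMU := hM.mono hU
  have hpU : ∀ᶠ i in (U : Filter ι), p i ∈ (M i).G b := hU hp
  have hq : ∀ᶠ i in (U : Filter ι), (M i).branch a (p i) ∈ (M i).G a :=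
    hpU.mono fun i hi => branch_mem hab hi
  obtain ⟨q, hqG, hqt⟩ := hMU.exists_tendsto hq
  have h1 := hMU.tendsto_g (eventually_mem_V_of_G hq) hqt (K.G_subset_V a hqG)
  have h2 : K.g q = p₀ := tendsto_nhds_unique h1 ((h.mono_left hU).congr' (by
    filter_upwards [hpU] with i hi
    exact (g_branch hab hi).symm))
  rw [← h2, branch_g hqG]
  exact hqt

/-- The filter of neighbourhoods of `K`. -/
def nhdsCantor (K : ConformalCantor B ε) : Filter (ConformalCantor B ε) :=
  ⨅ δ ∈ Ioi (0 : ℝ), 𝓟 {M | K.Near δ M}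

theorem conv_nhdsCantor (K : ConformalCantor B ε) : Conv K.nhdsCantor id K := fun δ hδ =>
  mem_iInf_of_mem δ (mem_iInf_of_mem hδ (mem_principal_self _))

theorem C1HolderClose.mono' {δ δ' : ℝ} (h : δ ≤ δ') {f g : ℂ → ℂ} {S : Set ℂ}
    (H : C1HolderClose ε δ f g S) : C1HolderClose ε δ' f g S :=
  ⟨fun x hx => (H.1 x hx).trans h, fun x hx => (H.2.1 x hx).trans h,
    fun x hx y hy => (H.2.2.1 x hx y hy).trans (by gcongr),
    fun x hx y hy => (H.2.2.2 x hx y hy).trans (by gcongr)⟩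

theorem Near.mono {δ δ' : ℝ} (h : δ ≤ δ') {N : ConformalCantor B ε} (H : K.Near δ N) :
    K.Near δ' N :=
  ⟨fun a => ⟨(H.1 a).1.trans (Metric.thickening_mono h _),
    (H.1 a).2.trans (Metric.thickening_mono h _)⟩, C1HolderClose.mono' h H.2⟩

theorem eventually_nhdsCantor {P : ConformalCantor B ε → Prop} :
    (∀ᶠ N in K.nhdsCantor, P N) ↔ ∃ δ > 0, ∀ N, K.Near δ N → P N := by
  have : K.nhdsCantor.HasBasis (fun δ : ℝ => δ ∈ Ioi (0 : ℝ)) fun δ => {M | K.Near δ M} :=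
    hasBasis_biInf_principal' (fun δ hδ δ' hδ' => ⟨min δ δ', mem_Ioi.2 (lt_min hδ hδ'),
      fun _ h => h.mono (min_le_left _ _), fun _ h => h.mono (min_le_right _ _)⟩)
    ⟨1, mem_Ioi.2 one_pos⟩
  exact this.eventually_iff

theorem Conv.eventually (hM : Conv l M K) {P : ConformalCantor B ε → Prop}
    (h : ∀ᶠ N in K.nhdsCantor, P N) : ∀ᶠ i in l, P (M i) := by
  obtain ⟨δ, hδ, h⟩ := eventually_nhdsCantor.1 h
  exact (hM δ hδ).mono fun i hi => h _ hi

end ConformalCantor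

end ConfCantor

namespace ConfCantor

namespace ConformalCantor

variable {A : Type*} {B : A → A → Prop} {ε : ℝ} {K : ConformalCantor B ε}

/-! ### Uniform estimates in a neighbourhood of a Cantor set -/

/-- Quantitative bounds on the expanding map. -/
structure Tame (κ C : ℝ) (M : ConformalCantor B ε) : Prop where
  contraction : ∀ (w : ℕ → A) (n : ℕ), (∀ i < n, B (w (i + 1)) (w i)) → ∀ x ∈ M.G (w 0),
    ∀ y ∈ M.G (w 0), ‖M.fSeq w n x - M.fSeq w n y‖ ≤ C * κ ^ n * ‖x - y‖
  taylor : ∀ a, ∀ x ∈ M.G a, ∀ y ∈ M.G a, ∀ z ∈ M.G a, ∀ ρ, ‖x - z‖ ≤ ρ → ‖y - z‖ ≤ ρ →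
    ‖M.g x - M.g y - fderiv ℝ M.g z (x - y)‖ ≤ C * ρ ^ ε * ‖x - y‖
  holder : ∀ a, ∀ x ∈ M.G a, ∀ y ∈ M.G a,
    ‖fderiv ℝ M.g x - fderiv ℝ M.g y‖ ≤ C * ‖x - y‖ ^ ε
  diam : ∀ a, ∀ x ∈ M.G a, ∀ y ∈ M.G a, ‖x - y‖ ≤ C

/-- When the distance of the images tends to `0`, injectivity on `K.G a` forces both points to the
same limit. There the strict derivative expands by μ, and half of μ - 1 is given up to the error
term and the other half exceeds the rate `p.1`. -/
theorem eventually_expanding (hε : 0 < ε) (K : ConformalCantor B ε) (a : A) :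
    ∀ᶠ p in (𝓝[>] (0 : ℝ)) ×ˢ K.nhdsCantor, ∀ x : ℂ × ℂ,
      (x.1 ∈ p.2.G a ∧ x.2 ∈ p.2.G a ∧ ‖p.2.g x.1 - p.2.g x.2‖ < p.1) →
        (1 + p.1) * ‖x.1 - x.2‖ ≤ ‖p.2.g x.1 - p.2.g x.2‖ := by
  refine eventually_forall_of_ultrafilter fun U hU x hx => ?_
  simp only [eventually_and] at hx
  obtain ⟨hx1, hx2, hx3⟩ := hx
  have hM : Conv (U : Filter (ℝ × ConformalCantor B ε)) (fun p => p.2) K := fun δ hδ =>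
    (tendsto_snd.mono_left hU) (conv_nhdsCantor K δ hδ)
  have ht : Tendsto (fun p : ℝ × ConformalCantor B ε => p.1) U (𝓝 0) :=
    (tendsto_fst.mono_left hU).mono_right nhdsWithin_le_nhds
  obtain ⟨u, hu, hxu⟩ := hM.exists_tendsto hx1
  obtain ⟨v, hv, hxv⟩ := hM.exists_tendsto hx2
  have hV1 := eventually_mem_V_of_G hx1
  have hV2 := eventually_mem_V_of_G hx2
  have hg := ((hM.tendsto_g hV1 hxu (K.G_subset_V a hu)).sub
    (hM.tendsto_g hV2 hxv (K.G_subset_V a hv))).norm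
  have h0 : ‖K.g u - K.g v‖ ≤ 0 := le_of_tendsto_of_tendsto hg ht (hx3.mono fun _ h => h.le)
  obtain rfl : u = v := K.injOn_G a hu hv (sub_eq_zero.1 (norm_le_zero_iff.1 h0))
  obtain ⟨W, -, hGW, -, -, μ, hμ, hW⟩ := K.expanding a
  have hr : 0 < (μ - 1) / 2 := by linarith
  refine Eventually.frequently ?_
  filter_upwards [hM.strict hε hV1 hV2 hxu hxv (K.G_subset_V a hu) hr,
    ht.eventually (gt_mem_nhds hr)] with i h1 h2
  have h3 := hW u (hGW hu) ((x i).1 - (x i).2)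
  have h4 := norm_sub_norm_le (fderiv ℝ K.g u ((x i).1 - (x i).2))
    (i.2.g (x i).1 - i.2.g (x i).2)
  rw [norm_sub_rev (fderiv ℝ K.g u _)] at h4
  have h5 : i.1 * ‖(x i).1 - (x i).2‖ ≤ (μ - 1) / 2 * ‖(x i).1 - (x i).2‖ := by gcongr
  linarith

/-- Inverse branches contract at distances below `t`, and composition keeps points that close.
Larger distances are handled by connectedness of the pieces, at the price of a factor counting the
balls of a cover. -/
theorem exists_contraction [Finite A] (hε : 0 < ε) (K : ConformalCantor B ε) :
    ∃ κ, 0 < κ ∧ κ < 1 ∧ ∃ C, ∀ᶠ M in K.nhdsCantor, ∀ (w : ℕ → A) (n : ℕ),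
      (∀ i < n, B (w (i + 1)) (w i)) → ∀ x ∈ M.G (w 0), ∀ y ∈ M.G (w 0),
        ‖M.fSeq w n x - M.fSeq w n y‖ ≤ C * κ ^ n * ‖x - y‖ := by
  have h := eventually_all.2 (eventually_expanding hε K)
  have hpos : ∀ᶠ p in (𝓝[>] (0 : ℝ)) ×ˢ K.nhdsCantor, 0 < p.1 :=
    tendsto_fst.eventually self_mem_nhdsWithin
  obtain ⟨t, ht⟩ := exists_of_eventually_prod (k := 𝓝[>] (0 : ℝ)) (l := K.nhdsCantor)
    (P := fun t N => 0 < t ∧ ∀ a, ∀ x : ℂ × ℂ,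
      (x.1 ∈ N.G a ∧ x.2 ∈ N.G a ∧ ‖N.g x.1 - N.g x.2‖ < t) →
        (1 + t) * ‖x.1 - x.2‖ ≤ ‖N.g x.1 - N.g x.2‖) (hpos.and h)
  -- Positivity of `t` is known only eventually along `K.nhdsCantor`. If it failed, the eventual
  -- statement would be vacuous and any constants would serve.
  by_cases ht0 : 0 < t
  swap
  · exact ⟨1 / 2, by norm_num, by norm_num, 0, ht.mono fun M hM => absurd hM.1 ht0⟩
  have hcov : ∀ a, ∃ s : Finset ℂ, K.G a ⊆ ⋃ c ∈ s, Metric.ball c (t / 4) := by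
    intro a
    obtain ⟨s, -, hs, hsG⟩ := (K.isCompact_G a).finite_cover_balls (e := t / 4) (by positivity)
    refine ⟨hs.toFinset, ?_⟩
    simpa using hsG
  choose s hs using hcov
  cases nonempty_fintype A
  set N : ℕ := ∑ a, (s a).card
  have hN : ∀ a, (s a).card ≤ N := fun a =>
    Finset.single_le_sum (f := fun a => (s a).card) (fun _ _ => Nat.zero_le _) (Finset.mem_univ a)
  have hκ : 0 < (1 + t)⁻¹ := by positivity
  refine ⟨(1 + t)⁻¹, hκ, inv_lt_one_of_one_lt₀ (by linarith), N + 1, ?_⟩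
  filter_upwards [ht, conv_nhdsCantor K (t / 4) (by positivity)] with M hM hnear w n hw x hx y hy
  set κ := (1 + t)⁻¹
  have hκ1 : κ ≤ 1 := (inv_lt_one_of_one_lt₀ (by linarith)).le
  have hsmall : ∀ x ∈ M.G (w 0), ∀ y ∈ M.G (w 0), ‖x - y‖ < 2 * (t / 2) →
      ‖M.fSeq w n x - M.fSeq w n y‖ ≤ κ ^ n * ‖x - y‖ := by
    intro x hx y hy hxy
    rw [mul_div_cancel₀ _ two_ne_zero] at hxy
    have : ∀ m ≤ n, ‖M.fSeq w m x - M.fSeq w m y‖ ≤ κ ^ m * ‖x - y‖ := by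
      intro m hm
      induction m with
      | zero => simp [fSeq]
      | succ m ih =>
        have ih := ih (Nat.le_of_succ_le hm)
        have h1 := hM.2 (w (m + 1)) (M.fSeq w (m + 1) x, M.fSeq w (m + 1) y)
        simp only [g_fSeq hw hx hm, g_fSeq hw hy hm] at h1
        have h2 := h1 ⟨fSeq_mem hw hx hm, fSeq_mem hw hy hm, ih.trans_lt
          ((mul_le_of_le_one_left (norm_nonneg _) (pow_le_one₀ hκ.le hκ1)).trans_lt hxy)⟩
        have h3 : ‖M.fSeq w (m + 1) x - M.fSeq w (m + 1) y‖ ≤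
            κ * ‖M.fSeq w m x - M.fSeq w m y‖ := by
          rw [inv_mul_eq_div, le_div_iff₀ (by positivity), mul_comm]
          exact h2
        calc _ ≤ _ := h3
          _ ≤ κ * (κ ^ m * ‖x - y‖) := by gcongr
          _ = _ := by ring
    exact this n le_rfl
  -- The centres cover `K.G` with radius `t / 4`; doubling the radius covers the pieces of all
  -- Cantor sets that are `t / 4`-near.
  have hcovM : M.G (w 0) ⊆ ⋃ c ∈ s (w 0), Metric.ball c (t / 2) := by
    intro z hz
    obtain ⟨y, hy, hzy⟩ := Metric.mem_thickening_iff.1 ((hnear.1 (w 0)).2 hz)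
    obtain ⟨c, hc, hyc⟩ := mem_iUnion₂.1 (hs (w 0) hy)
    refine mem_biUnion hc ?_
    rw [Metric.mem_ball] at hyc ⊢
    change dist z y < t / 4 at hzy
    linarith [dist_triangle z y c]
  have hκn : 0 ≤ κ ^ n := pow_nonneg hκ.le n
  by_cases hxy : ‖x - y‖ < 2 * (t / 2)
  · refine (hsmall x hx y hy hxy).trans ?_
    gcongr
    exact le_mul_of_one_le_left hκn (by linarith [Nat.cast_nonneg (α := ℝ) N])
  -- Here `‖x - y‖ ≥ t`, so a bound by a multiple of `κ ^ n * t` is a Lipschitz bound.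
  · refine (norm_sub_le_of_isPreconnected (M.isConnected_G (w 0)).isPreconnected hκn
      (half_pos ht0) hcovM hsmall hx hy).trans ?_
    have h1 : ((s (w 0)).card : ℝ) ≤ N + 1 := by
      have : ((s (w 0)).card : ℝ) ≤ N := Nat.cast_le.2 (hN (w 0))
      linarith
    have h2 := mul_le_mul h1 (mul_le_mul_of_nonneg_left (not_lt.1 hxy) hκn)
      (mul_nonneg hκn (by linarith)) (by linarith [Nat.cast_nonneg (α := ℝ) N])
    rwa [← mul_assoc (_ + _ : ℝ)] at h2

/-! ### Uniform C^{1+ε} bounds near a Cantor set -/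

section Bounds

variable {ι : Type*} {l : Filter ι} {M : ι → ConformalCantor B ε}

/-- The constant tends to infinity while the Cantor set tends to `K`. Along an ultrafilter the
quantity converges to a finite limit and is overtaken by the constant. -/
theorem eventually_bound (K : ConformalCantor B ε) (a : A) :
    ∀ᶠ p in (atTop : Filter ℝ) ×ˢ K.nhdsCantor, ∀ x : ℂ, x ∈ p.2.G a →
      ‖fderiv ℝ p.2.g x‖ ≤ p.1 := by
  refine eventually_forall_of_ultrafilter fun U hU x hx => ?_
  have hM : Conv (U : Filter (ℝ × ConformalCantor B ε)) (fun p => p.2) K := fun δ hδ =>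
    (tendsto_snd.mono_left hU) (conv_nhdsCantor K δ hδ)
  have ht : Tendsto (fun p : ℝ × ConformalCantor B ε => p.1) U atTop :=
    tendsto_fst.mono_left hU
  obtain ⟨u, hu, hxu⟩ := hM.exists_tendsto hx
  have hD := (hM.tendsto_fderiv (eventually_mem_V_of_G hx) hxu (K.G_subset_V a hu)).norm
  refine Eventually.frequently ?_
  filter_upwards [hD.eventually (gt_mem_nhds (lt_add_one _)),
    ht.eventually (eventually_ge_atTop (‖fderiv ℝ K.g u‖ + 1))] with i h1 h2
  exact h1.le.trans h2

theorem eventually_diam (K : ConformalCantor B ε) (a : A) :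
    ∀ᶠ p in (atTop : Filter ℝ) ×ˢ K.nhdsCantor, ∀ x : ℂ × ℂ, (x.1 ∈ p.2.G a ∧ x.2 ∈ p.2.G a) →
      ‖x.1 - x.2‖ ≤ p.1 := by
  refine eventually_forall_of_ultrafilter fun U hU x hx => ?_
  rw [eventually_and] at hx
  have hM : Conv (U : Filter (ℝ × ConformalCantor B ε)) (fun p => p.2) K := fun δ hδ =>
    (tendsto_snd.mono_left hU) (conv_nhdsCantor K δ hδ)
  have ht : Tendsto (fun p : ℝ × ConformalCantor B ε => p.1) U atTop :=
    tendsto_fst.mono_left hU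
  obtain ⟨u, hu, hxu⟩ := hM.exists_tendsto hx.1
  obtain ⟨v, hv, hxv⟩ := hM.exists_tendsto hx.2
  refine Eventually.frequently ?_
  filter_upwards [(hxu.sub hxv).norm.eventually (gt_mem_nhds (lt_add_one _)),
    ht.eventually (eventually_ge_atTop (‖u - v‖ + 1))] with i h1 h2
  exact h1.le.trans h2

/-- If the two points have the same limit, strict differentiability applies. Otherwise their
distance is bounded below and boundedness of the values is enough. -/
theorem eventually_lipschitz (hε : 0 < ε) (K : ConformalCantor B ε) (a : A) :
    ∀ᶠ p in (atTop : Filter ℝ) ×ˢ K.nhdsCantor, ∀ x : ℂ × ℂ, (x.1 ∈ p.2.G a ∧ x.2 ∈ p.2.G a) →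
      ‖p.2.g x.1 - p.2.g x.2‖ ≤ p.1 * ‖x.1 - x.2‖ := by
  refine eventually_forall_of_ultrafilter fun U hU x hx => ?_
  rw [eventually_and] at hx
  have hM : Conv (U : Filter (ℝ × ConformalCantor B ε)) (fun p => p.2) K := fun δ hδ =>
    (tendsto_snd.mono_left hU) (conv_nhdsCantor K δ hδ)
  have ht : Tendsto (fun p : ℝ × ConformalCantor B ε => p.1) U atTop :=
    tendsto_fst.mono_left hU
  obtain ⟨u, hu, hxu⟩ := hM.exists_tendsto hx.1
  obtain ⟨v, hv, hxv⟩ := hM.exists_tendsto hx.2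
  have hV1 := eventually_mem_V_of_G hx.1
  have hV2 := eventually_mem_V_of_G hx.2
  refine Eventually.frequently ?_
  by_cases huv : u = v
  · subst huv
    filter_upwards [hM.strict hε hV1 hV2 hxu hxv (K.G_subset_V a hu) one_pos,
      ht.eventually (eventually_ge_atTop (‖fderiv ℝ K.g u‖ + 1))] with i h1 h2
    have h3 := (fderiv ℝ K.g u).le_opNorm ((x i).1 - (x i).2)
    have h4 := norm_add_le (i.2.g (x i).1 - i.2.g (x i).2 - fderiv ℝ K.g u ((x i).1 - (x i).2))
      (fderiv ℝ K.g u ((x i).1 - (x i).2))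
    rw [sub_add_cancel] at h4
    calc _ ≤ (‖fderiv ℝ K.g u‖ + 1) * ‖(x i).1 - (x i).2‖ := by linarith
      _ ≤ _ := by gcongr
  · have hg := ((hM.tendsto_g hV1 hxu (K.G_subset_V a hu)).sub
      (hM.tendsto_g hV2 hxv (K.G_subset_V a hv))).norm
    have hd : Tendsto (fun i => ‖(x i).1 - (x i).2‖) U (𝓝 ‖u - v‖) := (hxu.sub hxv).norm
    have hpos : 0 < ‖u - v‖ := norm_pos_iff.2 (sub_ne_zero.2 huv)
    filter_upwards [hg.eventually (gt_mem_nhds (lt_add_one _)),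
      hd.eventually (lt_mem_nhds (half_lt_self hpos)),
      ht.eventually (eventually_ge_atTop ((‖K.g u - K.g v‖ + 1) / (‖u - v‖ / 2)))] with i h1 h2 h3
    rw [div_le_iff₀ (by positivity)] at h3
    have h4 : 0 ≤ i.1 := by
      by_contra! hneg
      have : i.1 * (‖u - v‖ / 2) ≤ 0 := mul_nonpos_of_nonpos_of_nonneg hneg.le (by positivity)
      linarith [norm_nonneg (K.g u - K.g v)]
    calc _ ≤ _ := h1.le
      _ ≤ i.1 * (‖u - v‖ / 2) := h3
      _ ≤ _ := by gcongr

theorem exists_local_taylor (hε : 0 < ε) {u : ℂ} (hu : u ∈ K.V) :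
    ∃ r > 0, ∃ C ≥ 0, (∀ x ∈ Metric.ball u r, ∀ y ∈ Metric.ball u r,
        ‖fderiv ℝ K.g x - fderiv ℝ K.g y‖ ≤ C * ‖x - y‖ ^ ε) ∧
      ∀ x ∈ Metric.ball u r, ∀ y ∈ Metric.ball u r, ∀ z ∈ Metric.ball u r, ∀ ρ, ‖x - z‖ ≤ ρ →
        ‖y - z‖ ≤ ρ → ‖K.g x - K.g y - fderiv ℝ K.g z (x - y)‖ ≤ C * ρ ^ ε * ‖x - y‖ := by
  obtain ⟨W, hW, C, hC⟩ := K.smooth.2 u hu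
  obtain ⟨r, hr, hrW⟩ := Metric.mem_nhds_iff.1 (inter_mem hW (K.isOpen_V.mem_nhds hu))
  refine ⟨r, hr, |C|, abs_nonneg C, ?_⟩
  have hH : ∀ x ∈ Metric.ball u r, ∀ y ∈ Metric.ball u r,
      ‖fderiv ℝ K.g x - fderiv ℝ K.g y‖ ≤ |C| * ‖x - y‖ ^ ε := fun x hx y hy =>
    (hC x (hrW hx) y (hrW hy)).trans (by gcongr; exact le_abs_self C)
  refine ⟨hH, fun x hx y hy z hz ρ hxz hyz => ?_⟩
  -- Intersecting with the ball of radius ρ about `z` makes the derivative differ from that at `z`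
  -- by at most `|C| * ρ ^ ε`, which enters the mean value inequality.
  have hconv : Convex ℝ (Metric.ball u r ∩ Metric.closedBall z ρ) :=
    (convex_ball u r).inter (convex_closedBall z ρ)
  refine hconv.norm_image_sub_le_of_norm_hasFDerivWithin_le' (f := K.g) (f' := fderiv ℝ K.g)
    (fun w hw => (hasStrictFDerivAt_g (hrW hw.1).2).hasFDerivAt.hasFDerivWithinAt)
    (fun w hw => (hH w hw.1 z hz).trans ?_) ⟨hy, mem_closedBall_iff_norm.2 hyz⟩
    ⟨hx, mem_closedBall_iff_norm.2 hxz⟩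
  gcongr
  exact mem_closedBall_iff_norm.1 hw.2

theorem eventually_holder (hε : 0 < ε) (K : ConformalCantor B ε) (a : A) :
    ∀ᶠ p in (atTop : Filter ℝ) ×ˢ K.nhdsCantor, ∀ x : ℂ × ℂ, (x.1 ∈ p.2.G a ∧ x.2 ∈ p.2.G a) →
      ‖fderiv ℝ p.2.g x.1 - fderiv ℝ p.2.g x.2‖ ≤ p.1 * ‖x.1 - x.2‖ ^ ε := by
  refine eventually_forall_of_ultrafilter fun U hU x hx => ?_
  rw [eventually_and] at hx
  have hM : Conv (U : Filter (ℝ × ConformalCantor B ε)) (fun p => p.2) K := fun δ hδ =>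
    (tendsto_snd.mono_left hU) (conv_nhdsCantor K δ hδ)
  have ht : Tendsto (fun p : ℝ × ConformalCantor B ε => p.1) U atTop :=
    tendsto_fst.mono_left hU
  obtain ⟨u, hu, hxu⟩ := hM.exists_tendsto hx.1
  obtain ⟨v, hv, hxv⟩ := hM.exists_tendsto hx.2
  have hV1 := eventually_mem_V_of_G hx.1
  have hV2 := eventually_mem_V_of_G hx.2
  have huV := K.G_subset_V a hu
  refine Eventually.frequently ?_
  by_cases huv : u = v
  · subst huv
    obtain ⟨r, hr, C, hC, hH, -⟩ := exists_local_taylor hε huV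
    filter_upwards [hM 1 one_pos, Conv.eventually_mem_V hV1 hxu huV,
      Conv.eventually_mem_V hV2 hxv huV, hxu.eventually (Metric.ball_mem_nhds u hr),
      hxv.eventually (Metric.ball_mem_nhds u hr),
      ht.eventually (eventually_ge_atTop (C + 1))] with i hn h1 h2 h3 h4 h5
    have h6 := hn.2.2.2.1 _ h2 _ h1
    have h7 := hH _ h3 _ h4
    have h8 : fderiv ℝ i.2.g (x i).1 - fderiv ℝ i.2.g (x i).2 =
        (fderiv ℝ K.g (x i).1 - fderiv ℝ K.g (x i).2) -
        ((fderiv ℝ K.g (x i).1 - fderiv ℝ i.2.g (x i).1) -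
          (fderiv ℝ K.g (x i).2 - fderiv ℝ i.2.g (x i).2)) := by abel
    calc _ ≤ (C + 1) * ‖(x i).1 - (x i).2‖ ^ ε := by
          rw [h8]
          refine (norm_sub_le _ _).trans ?_
          linarith
      _ ≤ _ := by gcongr
  · have hD := ((hM.tendsto_fderiv hV1 hxu huV).sub
      (hM.tendsto_fderiv hV2 hxv (K.G_subset_V a hv))).norm
    have hd : Tendsto (fun i => ‖(x i).1 - (x i).2‖ ^ ε) U (𝓝 (‖u - v‖ ^ ε)) :=
      (hxu.sub hxv).norm.rpow_const (Or.inr hε.le)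
    have hpos : 0 < ‖u - v‖ ^ ε :=
      Real.rpow_pos_of_pos (norm_pos_iff.2 (sub_ne_zero.2 huv)) _
    filter_upwards [hD.eventually (gt_mem_nhds (lt_add_one _)),
      hd.eventually (lt_mem_nhds (half_lt_self hpos)), ht.eventually (eventually_ge_atTop
        ((‖fderiv ℝ K.g u - fderiv ℝ K.g v‖ + 1) / (‖u - v‖ ^ ε / 2))),
      ht.eventually (eventually_ge_atTop 0)] with i h1 h2 h3 h4
    rw [div_le_iff₀ (by positivity)] at h3
    calc _ ≤ _ := h1.le
      _ ≤ i.1 * (‖u - v‖ ^ ε / 2) := h3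
      _ ≤ _ := by gcongr

/-- The constant is `2 + 1`: the remainder at `y` costs `‖x - y‖ ^ ε ≤ (2ρ) ^ ε ≤ 2 * ρ ^ ε`, where
`ε ≤ 1` enters, and replacing the derivative at `y` by that at `z` costs `ρ ^ ε`. -/
theorem near_taylor (hε : 0 < ε) (hε₁ : ε ≤ 1) {N : ConformalCantor B ε} (hn : K.Near 1 N)
    {x y z : ℂ} (hx : x ∈ K.V ∩ N.V) (hy : y ∈ K.V ∩ N.V) (hz : z ∈ K.V ∩ N.V) {ρ : ℝ}
    (hxz : ‖x - z‖ ≤ ρ) (hyz : ‖y - z‖ ≤ ρ) :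
    ‖(K.g x - N.g x) - (K.g y - N.g y) - (fderiv ℝ K.g z - fderiv ℝ N.g z) (x - y)‖ ≤
      3 * ρ ^ ε * ‖x - y‖ := by
  have hρ : 0 ≤ ρ := (norm_nonneg _).trans hxz
  have h1 := hn.2.2.2.2 y hy x hx
  have h2 := hn.2.2.2.1 z hz y hy
  rw [Real.rpow_one_add' (norm_nonneg _) (by linarith)] at h1
  have hxy : ‖x - y‖ ≤ 2 * ρ := by
    have := norm_sub_le (x - z) (y - z)
    rw [sub_sub_sub_cancel_right] at this
    linarith
  have h3 : ‖x - y‖ ^ ε ≤ 2 * ρ ^ ε := by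
    calc ‖x - y‖ ^ ε ≤ (2 * ρ) ^ ε := by gcongr
      _ = 2 ^ ε * ρ ^ ε := Real.mul_rpow zero_le_two hρ
      _ ≤ 2 * ρ ^ ε := by
        gcongr
        simpa using Real.rpow_le_rpow_of_exponent_le one_le_two hε₁
  have h4 : ‖y - z‖ ^ ε ≤ ρ ^ ε := by gcongr
  have h5 := ContinuousLinearMap.le_of_opNorm_le _ h2 (x - y)
  have h6 : (K.g x - N.g x) - (K.g y - N.g y) - (fderiv ℝ K.g z - fderiv ℝ N.g z) (x - y) =
      ((K.g x - N.g x) - (K.g y - N.g y) - (fderiv ℝ K.g y - fderiv ℝ N.g y) (x - y)) +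
      ((fderiv ℝ K.g y - fderiv ℝ N.g y) - (fderiv ℝ K.g z - fderiv ℝ N.g z)) (x - y) := by
    simp only [sub_apply]; ring
  rw [h6]
  refine (norm_add_le _ _).trans ?_
  have h7 : 1 * (‖x - y‖ * ‖x - y‖ ^ ε) ≤ ‖x - y‖ * (2 * ρ ^ ε) := by rw [one_mul]; gcongr
  have h8 : 1 * ‖y - z‖ ^ ε * ‖x - y‖ ≤ ρ ^ ε * ‖x - y‖ := by rw [one_mul]; gcongr
  linarith

/-- If the three points have a common limit, the local estimate for `K.g` is combined with the one
for the difference of the maps. Otherwise ρ stays away from `0`, and Lipschitz bounds are enough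
once the constant is large. -/
theorem eventually_taylor (hε : 0 < ε) (hε₁ : ε ≤ 1) (K : ConformalCantor B ε) (a : A) :
    ∀ᶠ p in (atTop : Filter ℝ) ×ˢ K.nhdsCantor, ∀ x : ℂ × ℂ × ℂ × ℝ,
      (x.1 ∈ p.2.G a ∧ x.2.1 ∈ p.2.G a ∧ x.2.2.1 ∈ p.2.G a ∧ ‖x.1 - x.2.2.1‖ ≤ x.2.2.2 ∧
        ‖x.2.1 - x.2.2.1‖ ≤ x.2.2.2) →
      ‖p.2.g x.1 - p.2.g x.2.1 - fderiv ℝ p.2.g x.2.2.1 (x.1 - x.2.1)‖ ≤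
        p.1 * x.2.2.2 ^ ε * ‖x.1 - x.2.1‖ := by
  obtain ⟨C₁, hC₁⟩ := exists_of_eventually_prod
    (P := fun C (N : ConformalCantor B ε) => ∀ x ∈ N.G a,
    ‖fderiv ℝ N.g x‖ ≤ C) (eventually_bound K a)
  obtain ⟨C₂, hC₂⟩ := exists_of_eventually_prod
    (P := fun C (N : ConformalCantor B ε) => ∀ x : ℂ × ℂ,
    (x.1 ∈ N.G a ∧ x.2 ∈ N.G a) → ‖N.g x.1 - N.g x.2‖ ≤ C * ‖x.1 - x.2‖)
    (eventually_lipschitz hε K a)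
  refine eventually_forall_of_ultrafilter fun U hU q hq => ?_
  simp only [eventually_and] at hq
  obtain ⟨hx, hy, hz, hxz, hyz⟩ := hq
  have hM : Conv (U : Filter (ℝ × ConformalCantor B ε)) (fun p => p.2) K := fun δ hδ =>
    (tendsto_snd.mono_left hU) (conv_nhdsCantor K δ hδ)
  have ht : Tendsto (fun p : ℝ × ConformalCantor B ε => p.1) U atTop :=
    tendsto_fst.mono_left hU
  obtain ⟨u, hu, hxu⟩ := hM.exists_tendsto hx
  obtain ⟨v, hv, hxv⟩ := hM.exists_tendsto hy
  obtain ⟨w, hw, hxw⟩ := hM.exists_tendsto hz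
  have hV1 := eventually_mem_V_of_G hx
  have hV2 := eventually_mem_V_of_G hy
  have hV3 := eventually_mem_V_of_G hz
  have huV := K.G_subset_V a hu
  refine Eventually.frequently ?_
  by_cases huvw : u = w ∧ v = w
  · obtain ⟨rfl, rfl⟩ := huvw
    obtain ⟨r, hr, C, hC, -, hT⟩ := exists_local_taylor hε huV
    filter_upwards [hM 1 one_pos, Conv.eventually_mem_V hV1 hxu huV,
      Conv.eventually_mem_V hV2 hxv huV, Conv.eventually_mem_V hV3 hxw huV,
      hxu.eventually (Metric.ball_mem_nhds _ hr), hxv.eventually (Metric.ball_mem_nhds _ hr),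
      hxw.eventually (Metric.ball_mem_nhds _ hr),
      ht.eventually (eventually_ge_atTop (C + 3)), hxz, hyz] with i hn h1 h2 h3 h4 h5 h6 h7 h8 h9
    have hρ : 0 ≤ (q i).2.2.2 := (norm_nonneg _).trans h8
    have h10 := near_taylor hε hε₁ hn h1 h2 h3 h8 h9
    have h11 := hT _ h4 _ h5 _ h6 _ h8 h9
    have h12 : i.2.g (q i).1 - i.2.g (q i).2.1 - fderiv ℝ i.2.g (q i).2.2.1 ((q i).1 - (q i).2.1) =
        (K.g (q i).1 - K.g (q i).2.1 - fderiv ℝ K.g (q i).2.2.1 ((q i).1 - (q i).2.1)) -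
        ((K.g (q i).1 - i.2.g (q i).1) - (K.g (q i).2.1 - i.2.g (q i).2.1) -
        (fderiv ℝ K.g (q i).2.2.1 - fderiv ℝ i.2.g (q i).2.2.1) ((q i).1 - (q i).2.1)) := by
      simp only [sub_apply]; ring
    calc _ ≤ (C + 3) * (q i).2.2.2 ^ ε * ‖(q i).1 - (q i).2.1‖ := by
          rw [h12]
          refine (norm_sub_le _ _).trans ?_
          linarith
      _ ≤ _ := by gcongr
  · set R := max ‖u - w‖ ‖v - w‖ with hR
    have hRpos : 0 < R := by
      rw [hR, lt_max_iff, norm_pos_iff, norm_pos_iff, sub_ne_zero, sub_ne_zero]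
      tauto
    have hd : Tendsto (fun i => max ‖(q i).1 - (q i).2.2.1‖ ‖(q i).2.1 - (q i).2.2.1‖) U (𝓝 R) :=
      (hxu.sub hxw).norm.max (hxv.sub hxw).norm
    filter_upwards [hM.eventually hC₁, hM.eventually hC₂, hx, hy, hz, hxz, hyz,
      hd.eventually (lt_mem_nhds (half_lt_self hRpos)),
      ht.eventually (eventually_ge_atTop ((C₁ + C₂) / (R / 2) ^ ε)),
      ht.eventually (eventually_ge_atTop 0)] with i h1 h2 h3 h4 h5 h6 h7 h8 h9 h10
    have h11 : R / 2 ≤ (q i).2.2.2 := h8.le.trans (max_le h6 h7)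
    have h12 := ContinuousLinearMap.le_of_opNorm_le _ (h1 _ h5) ((q i).1 - (q i).2.1)
    have h13 := h2 ((q i).1, (q i).2.1) ⟨h3, h4⟩
    rw [div_le_iff₀ (by positivity)] at h9
    calc _ ≤ (C₁ + C₂) * ‖(q i).1 - (q i).2.1‖ := by
          refine (norm_sub_le _ _).trans ?_
          linarith
      _ ≤ i.1 * (R / 2) ^ ε * ‖(q i).1 - (q i).2.1‖ := by gcongr
      _ ≤ _ := by gcongr

end Bounds

/-- The quantitative bounds hold uniformly in a neighbourhood of `K`. -/
theorem exists_tame [Finite A] (hε : 0 < ε) (hε₁ : ε ≤ 1) (K : ConformalCantor B ε) :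
    ∃ κ, 0 < κ ∧ κ < 1 ∧ ∃ C, 1 ≤ C ∧ ∀ᶠ M in K.nhdsCantor, M.Tame κ C := by
  obtain ⟨κ, h0, h1, C₀, hC₀⟩ := exists_contraction hε K
  have hge : ∀ᶠ p in (atTop : Filter ℝ) ×ˢ K.nhdsCantor, max 1 C₀ ≤ p.1 :=
    tendsto_fst.eventually (eventually_ge_atTop (max 1 C₀))
  obtain ⟨C, hC⟩ := exists_of_eventually_prod
    (P := fun C (M : ConformalCantor B ε) => max 1 C₀ ≤ C ∧ M.Tame κ C) (by
      filter_upwards [hge,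
        eventually_all.2 (eventually_holder hε K), eventually_all.2 (eventually_taylor hε hε₁ K),
        eventually_all.2 (eventually_diam K),
        tendsto_snd.eventually hC₀] with p hp hh ht hd hc
      refine ⟨hp, ⟨fun w n hw x hx y hy => (hc w n hw x hx y hy).trans ?_,
        fun a x hx y hy z hz ρ h h' => ht a (x, y, z, ρ) ⟨hx, hy, hz, h, h'⟩,
        fun a x hx y hy => hh a (x, y) ⟨hx, hy⟩,
        fun a x hx y hy => hd a (x, y) ⟨hx, hy⟩⟩⟩
      gcongr
      exact (le_max_right _ _).trans hp)
  by_cases hC1 : 1 ≤ C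
  · exact ⟨κ, h0, h1, C, hC1, hC.mono fun M hM => hM.2⟩
  · exact ⟨κ, h0, h1, 1, le_rfl, hC.mono fun M hM => absurd ((le_max_left _ _).trans hM.1) hC1⟩

end ConformalCantor

end ConfCantor

/-! ### Limits of geometrically convergent quotients, and the limit geometries -/

namespace ConfCantor

/-- A sequence whose relative variations decay geometrically converges. -/
theorem exists_limit_of_relative_variation {q C : ℝ} (hq₀ : 0 ≤ q) (hq₁ : q < 1) :
    ∃ D ≥ 0, ∀ c ≤ C, 0 ≤ c → ∀ a : ℕ → ℂ, (∀ n, ‖a (n + 1) - a n‖ ≤ c * q ^ n * ‖a n‖) →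
      (∀ n, ‖a (n + 1) - a n‖ ≤ c * q ^ n * ‖a (n + 1)‖) →
        ∃ L, Tendsto a atTop (𝓝 L) ∧ (∀ n, ‖L - a n‖ ≤ D * c * q ^ n * ‖a 0‖) ∧
          ‖a 0‖ ≤ D * ‖L‖ := by
  have h1q : 0 < 1 - q := by linarith
  -- `E` bounds the products of the factors `1 + c * q ^ i`; the tail of the geometric series adds
  -- `1 / (1 - q)`. The error bound stays linear in `c`, through which the factor ρ^ε enters later.
  set E := Real.exp (C / (1 - q)) with hE
  have hEpos : 0 < E := Real.exp_pos _
  refine ⟨E / (1 - q), by positivity, fun c hc hc₀ a ha ha' => ?_⟩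
  have hsum : ∀ n, ∑ i ∈ Finset.range n, c * q ^ i ≤ C / (1 - q) := by
    intro n
    rw [← Finset.mul_sum, div_eq_mul_inv, ← tsum_geometric_of_lt_one hq₀ hq₁]
    have := (summable_geometric_of_lt_one hq₀ hq₁).sum_le_tsum (Finset.range n)
      (fun i _ => pow_nonneg hq₀ i)
    exact mul_le_mul hc this (Finset.sum_nonneg fun i _ => pow_nonneg hq₀ i) (hc₀.trans hc)
  have hstep : ∀ (n : ℕ) (u v : ℝ), 0 ≤ u → v ≤ u + c * q ^ n * u →
      v ≤ Real.exp (c * q ^ n) * u := by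
    intro n u v hu h
    calc v ≤ (c * q ^ n + 1) * u := by linarith
      _ ≤ _ := by gcongr; exact Real.add_one_le_exp _
  have hup : ∀ n, ‖a n‖ ≤ E * ‖a 0‖ := by
    have : ∀ n, ‖a n‖ ≤ Real.exp (∑ i ∈ Finset.range n, c * q ^ i) * ‖a 0‖ := by
      intro n
      induction n with
      | zero => simp
      | succ n ih =>
        have h2 := hstep n ‖a n‖ ‖a (n + 1)‖ (norm_nonneg _)
          ((norm_le_norm_add_norm_sub' _ (a n)).trans (by linarith [ha n]))
        rw [Finset.sum_range_succ, add_comm (Finset.sum _ _), Real.exp_add, mul_assoc]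
        exact h2.trans (by gcongr)
    intro n
    refine (this n).trans ?_
    gcongr
    exact Real.exp_le_exp.2 (hsum n)
  -- The variation relative to the later term allows the same product estimate backwards, which
  -- keeps the limit away from zero.
  have hlow : ∀ n, ‖a 0‖ ≤ E * ‖a n‖ := by
    have : ∀ n, ‖a 0‖ ≤ Real.exp (∑ i ∈ Finset.range n, c * q ^ i) * ‖a n‖ := by
      intro n
      induction n with
      | zero => simp
      | succ n ih =>
        have h2 := hstep n ‖a (n + 1)‖ ‖a n‖ (norm_nonneg _)
          ((norm_le_norm_add_norm_sub _ (a n)).trans (by linarith [ha' n]))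
        rw [Finset.sum_range_succ, Real.exp_add, mul_assoc]
        exact ih.trans (by gcongr)
    intro n
    refine (this n).trans ?_
    gcongr
    exact Real.exp_le_exp.2 (hsum n)
  have hdist : ∀ n, dist (a n) (a (n + 1)) ≤ c * E * ‖a 0‖ * q ^ n := by
    intro n
    rw [dist_comm, dist_eq_norm]
    calc _ ≤ c * q ^ n * ‖a n‖ := ha n
      _ ≤ c * q ^ n * (E * ‖a 0‖) := by gcongr; exact hup n
      _ = _ := by ring
  obtain ⟨L, hL⟩ := cauchySeq_tendsto_of_complete (cauchySeq_of_le_geometric q _ hq₁ hdist)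
  refine ⟨L, hL, fun n => ?_, ?_⟩
  · have := dist_le_of_le_geometric_of_tendsto q _ hq₁ hdist hL n
    rw [dist_comm, dist_eq_norm] at this
    exact this.trans (le_of_eq (by ring))
  · have h1 : ‖a 0‖ ≤ E * ‖L‖ :=
      ge_of_tendsto (hL.norm.const_mul E) (Eventually.of_forall hlow)
    refine h1.trans ?_
    gcongr
    rw [le_div_iff₀ h1q]
    nlinarith

/-- Limits which are approached uniformly depend continuously on parameters. -/
theorem tendsto_of_geometric_tails {ι : Type*} {l : Filter ι} {a : ℕ → ι → ℂ} {α : ℕ → ℂ}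
    {b : ι → ℂ} {β : ℂ} {D q : ℝ} (hq₀ : 0 ≤ q) (hq₁ : q < 1)
    (h : ∀ n, Tendsto (a n) l (𝓝 (α n))) (hb : ∀ᶠ i in l, ∀ n, ‖b i - a n i‖ ≤ D * q ^ n)
    (hβ : ∀ n, ‖β - α n‖ ≤ D * q ^ n) : Tendsto b l (𝓝 β) := by
  rw [Metric.tendsto_nhds]
  intro r hr
  have h0 : Tendsto (fun n => D * q ^ n) atTop (𝓝 0) := by
    simpa using (tendsto_pow_atTop_nhds_zero_of_lt_one hq₀ hq₁).const_mul D
  obtain ⟨n, hn⟩ := (h0.eventually (gt_mem_nhds (show 0 < r / 3 by positivity))).exists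
  filter_upwards [hb, Metric.tendsto_nhds.1 (h n) (r / 3) (by positivity)] with i h1 h2
  have h3 := h1 n
  have h4 := hβ n
  rw [← dist_eq_norm] at h3 h4
  rw [dist_comm] at h4
  linarith [dist_triangle4 (b i) (a n i) (α n) β]

namespace ConformalCantor

variable {A : Type*} {B : A → A → Prop} {ε : ℝ} {K M : ConformalCantor B ε}

/-! ### Limit geometries -/

theorem Tame.norm_fWord_sub_le {κ C : ℝ} (hM : M.Tame κ C) (θ : NegSeq B) (n : ℕ) {x y : ℂ}
    (hx : x ∈ M.G (θ.1 0)) (hy : y ∈ M.G (θ.1 0)) :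
    ‖M.fWord θ n x - M.fWord θ n y‖ ≤ C * κ ^ n * ‖x - y‖ := by
  rw [fWord_eq]
  exact hM.contraction θ.1 n (fun i _ => θ.2 i) x hx y hy

theorem Tame.norm_branch_sub_le {κ C : ℝ} (hM : M.Tame κ C) {a b : A} (h : B a b) {x y : ℂ}
    (hx : x ∈ M.G b) (hy : y ∈ M.G b) :
    ‖M.branch a x - M.branch a y‖ ≤ C * κ * ‖x - y‖ := by
  have := hM.contraction (fun n => Nat.casesOn n b fun _ => a) 1
    (fun i hi => by obtain rfl : i = 0 := by omega
                    exact h) x hx y hy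
  rwa [pow_one] at this

section Variation

variable {κ C : ℝ}

theorem rpow_contraction_le (hε : 0 < ε) (hε₁ : ε ≤ 1) (hκ : 0 < κ) (hκ₁ : κ < 1)
    (hC : 1 ≤ C) {ρ : ℝ} (hρ : 0 ≤ ρ) (n : ℕ) :
    (C * κ ^ (n + 1) * ρ) ^ ε ≤ C * (κ ^ ε) ^ n * ρ ^ ε := by
  rw [Real.mul_rpow (by positivity) hρ, Real.mul_rpow (by positivity) (by positivity)]
  have h1 : C ^ ε ≤ C := by simpa using Real.rpow_le_rpow_of_exponent_le hC hε₁
  have h2 : (κ ^ (n + 1)) ^ ε ≤ (κ ^ ε) ^ n := by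
    rw [← Real.rpow_natCast, ← Real.rpow_mul hκ.le, mul_comm, Real.rpow_mul hκ.le,
      Real.rpow_natCast, pow_succ]
    exact mul_le_of_le_one_right (by positivity) (Real.rpow_le_one hκ.le hκ₁.le hε.le)
  gcongr

/-- With x', y', z' the images at stage n + 1, `s n` has numerator g(x') - g(y') and `s (n + 1)` has
g'(z')(x' - y'), over the same denominator. Their difference is a Taylor remainder at z', and x', y'
lie within C κ^{n+1} ρ of z'. Conformality at z' lets the derivative be moved into the quotient. -/
theorem Tame.variation (hε : 0 < ε) (hε₁ : ε ≤ 1) (hκ : 0 < κ) (hκ₁ : κ < 1)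
    (hC : 1 ≤ C) (hM : M.Tame κ C) (θ : NegSeq B) {z : ℂ} (hz : z ∈ M.piece (θ.1 0))
    {x y : ℂ} (hx : x ∈ M.G (θ.1 0)) (hy : y ∈ M.G (θ.1 0)) {ρ : ℝ} (hxz : ‖x - z‖ ≤ ρ)
    (hyz : ‖y - z‖ ≤ ρ) (n : ℕ) :
    let s : ℕ → ℂ := fun n => (M.fWord θ n x - M.fWord θ n y) / M.dAt θ n z
    ‖s (n + 1) - s n‖ ≤ C ^ 3 * ρ ^ ε * (κ ^ ε) ^ n * ‖s n‖ ∧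
      ‖s (n + 1) - s n‖ ≤ C ^ 3 * ρ ^ ε * (κ ^ ε) ^ n * ‖s (n + 1)‖ := by
  intro s
  have hρ : 0 ≤ ρ := (norm_nonneg _).trans hxz
  have hz' := fWord_mem_piece θ (n + 1) hz
  have hx' := fWord_mem θ (n + 1) hx
  have hy' := fWord_mem θ (n + 1) hy
  set z' := M.fWord θ (n + 1) z
  set x' := M.fWord θ (n + 1) x with hxdef
  set y' := M.fWord θ (n + 1) y with hydef
  have hd0 : M.dAt θ n z ≠ 0 := dAt_ne_zero θ n hz.2
  have hl0 : M.der z' ≠ 0 := der_ne_zero hz'.2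
  have hl1 : 1 ≤ ‖M.der z'‖ := one_le_norm_der hz'.2
  have hs : s n = (M.g x' - M.g y') / M.dAt θ n z := by
    simp only [s, hxdef, hydef, g_fWord θ n hx, g_fWord θ n hy]
  have hs' : s (n + 1) = M.der z' * (x' - y') / M.dAt θ n z := by
    simp only [s, dAt_succ]
    change (x' - y') / (M.dAt θ n z * (M.der z')⁻¹) = _
    field_simp
  have hT := hM.taylor (θ.1 (n + 1)) x' hx' y' hy' z' hz'.2 (C * κ ^ (n + 1) * ρ)
    ((hM.norm_fWord_sub_le θ (n + 1) hx hz.2).trans (by gcongr))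
    ((hM.norm_fWord_sub_le θ (n + 1) hy hz.2).trans (by gcongr))
  rw [fderiv_apply hz'.1, norm_sub_rev] at hT
  have hr := rpow_contraction_le hε hε₁ hκ hκ₁ hC hρ n
  have hb : ‖x' - y'‖ ≤ C * ‖M.g x' - M.g y'‖ := by
    have h1 := hM.norm_branch_sub_le (θ.2 n) (fWord_mem θ n hx) (fWord_mem θ n hy)
    rw [hxdef, hydef, g_fWord θ n hx, g_fWord θ n hy]
    refine h1.trans ?_
    gcongr
    exact mul_le_of_le_one_right (by linarith) hκ₁.le
  have hmain : ‖s (n + 1) - s n‖ ≤ C ^ 2 * ρ ^ ε * (κ ^ ε) ^ n * (‖x' - y'‖ / ‖M.dAt θ n z‖) := by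
    rw [hs, hs', ← sub_div, norm_div, ← mul_div_assoc]
    gcongr
    calc _ ≤ _ := hT
      _ ≤ C * (C * (κ ^ ε) ^ n * ρ ^ ε) * ‖x' - y'‖ := by gcongr
      _ = _ := by ring
  constructor
  · refine hmain.trans ?_
    calc _ ≤ C ^ 2 * ρ ^ ε * (κ ^ ε) ^ n * (C * ‖M.g x' - M.g y'‖ / ‖M.dAt θ n z‖) := by gcongr
      _ = _ := by rw [hs, norm_div]; ring
  · refine hmain.trans ?_
    have h1 : ‖x' - y'‖ / ‖M.dAt θ n z‖ ≤ ‖s (n + 1)‖ := by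
      rw [hs', norm_div, norm_mul]
      gcongr
      exact le_mul_of_one_le_left (norm_nonneg _) hl1
    have h2 : C ^ 2 ≤ C ^ 3 := pow_le_pow_right₀ hC (by norm_num)
    gcongr

/-- Consecutive terms differ by the factor `der z₀' / der z'`; the two points are exponentially
close, the derivative is Hölder, and both derivatives have modulus at least one. -/
theorem Tame.variation_der (hε : 0 < ε) (hε₁ : ε ≤ 1) (hκ : 0 < κ) (hκ₁ : κ < 1)
    (hC : 1 ≤ C) (hM : M.Tame κ C) (θ : NegSeq B) {z z₀ : ℂ}
    (hz : z ∈ M.G (θ.1 0)) (hz₀ : z₀ ∈ M.G (θ.1 0)) (n : ℕ) :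
    let s : ℕ → ℂ := fun n => M.dAt θ n z / M.dAt θ n z₀
    ‖s (n + 1) - s n‖ ≤ C ^ 4 * (κ ^ ε) ^ n * ‖s n‖ ∧
      ‖s (n + 1) - s n‖ ≤ C ^ 4 * (κ ^ ε) ^ n * ‖s (n + 1)‖ := by
  intro s
  have hz' := fWord_mem θ (n + 1) hz
  have hz₀' := fWord_mem θ (n + 1) hz₀
  have hd0 : M.dAt θ n z₀ ≠ 0 := dAt_ne_zero θ n hz₀
  have hl0 := der_ne_zero hz'
  have hl0' := der_ne_zero hz₀'
  have hl1 := one_le_norm_der hz'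
  have hl1' := one_le_norm_der hz₀'
  have hz'z₀' := hM.norm_fWord_sub_le θ (n + 1) hz hz₀
  have hH := hM.holder (θ.1 (n + 1)) _ hz' _ hz₀'
  set z' := M.fWord θ (n + 1) z
  set z₀' := M.fWord θ (n + 1) z₀
  have hdiff : ‖M.der z₀' - M.der z'‖ ≤ C ^ 4 * (κ ^ ε) ^ n := by
    have h1 : ‖M.der z' - M.der z₀'‖ ≤ ‖fderiv ℝ M.g z' - fderiv ℝ M.g z₀'‖ := by
      simpa [der] using (fderiv ℝ M.g z' - fderiv ℝ M.g z₀').le_opNorm 1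
    rw [norm_sub_rev]
    have h2 : C ^ ε ≤ C := by simpa using Real.rpow_le_rpow_of_exponent_le hC hε₁
    calc _ ≤ _ := h1
      _ ≤ _ := hH
      _ ≤ C * (C * κ ^ (n + 1) * C) ^ ε := by
        gcongr
        refine hz'z₀'.trans ?_
        gcongr
        exact hM.diam _ _ hz _ hz₀
      _ ≤ C * (C * (κ ^ ε) ^ n * C ^ ε) := by
        gcongr
        exact rpow_contraction_le hε hε₁ hκ hκ₁ hC (by linarith) n
      _ ≤ C * (C * (κ ^ ε) ^ n * C) := by gcongr
      _ = C ^ 3 * (κ ^ ε) ^ n := by ring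
      _ ≤ _ := by gcongr; linarith
  have hs : s (n + 1) = s n * (M.der z₀' / M.der z') := by
    simp only [s, dAt_succ]
    change M.dAt θ n z * (M.der z')⁻¹ / (M.dAt θ n z₀ * (M.der z₀')⁻¹) = _
    field_simp
  have hdiv : ∀ u : ℂ, 1 ≤ ‖u‖ → ‖(M.der z₀' - M.der z') / u‖ ≤ C ^ 4 * (κ ^ ε) ^ n := by
    intro u hu
    rw [norm_div]
    exact (div_le_self (norm_nonneg _) hu).trans hdiff
  constructor
  · have : s (n + 1) - s n = s n * ((M.der z₀' - M.der z') / M.der z') := by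
      rw [hs]; field_simp
    rw [this, norm_mul, mul_comm]
    gcongr
    exact hdiv _ hl1
  · have : s (n + 1) - s n = s (n + 1) * ((M.der z₀' - M.der z') / M.der z₀') := by
      rw [hs]; field_simp
    rw [this, norm_mul, mul_comm]
    gcongr
    exact hdiv _ hl1'

end Variation

variable (K) in
/-- The derivative of the limit geometry `k^θ` at a point of the Cantor set. -/
noncomputable def kDer (c : A → ℂ) (θ : NegSeq B) (z : ℂ) : ℂ :=
  limUnder atTop fun n => K.dAt θ n z / K.dAt θ n (c (θ.1 0))

/-- Uniform estimates for the limit geometries with base points `c`. -/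
structure Geom (D q : ℝ) (M : ConformalCantor B ε) (c : A → ℂ) : Prop where
  base : M.IsBase c
  tendsto : ∀ θ : NegSeq B, ∀ x ∈ M.G (θ.1 0),
    Tendsto (fun n => M.kApprox c θ n x) atTop (𝓝 (M.limGeom c θ x))
  tail : ∀ θ : NegSeq B, ∀ x ∈ M.G (θ.1 0), ∀ n,
    ‖M.limGeom c θ x - M.kApprox c θ n x‖ ≤ D * q ^ n
  norm_sub_le : ∀ θ : NegSeq B, ∀ x ∈ M.G (θ.1 0), ∀ y ∈ M.G (θ.1 0),
    ‖M.limGeom c θ x - M.limGeom c θ y‖ ≤ D * ‖x - y‖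
  le_norm_sub : ∀ θ : NegSeq B, ∀ x ∈ M.G (θ.1 0), ∀ y ∈ M.G (θ.1 0),
    ‖x - y‖ ≤ D * ‖M.limGeom c θ x - M.limGeom c θ y‖
  tendsto_der : ∀ θ : NegSeq B, ∀ z ∈ M.piece (θ.1 0),
    Tendsto (fun n => M.dAt θ n z / M.dAt θ n (c (θ.1 0))) atTop (𝓝 (M.kDer c θ z))
  tail_der : ∀ θ : NegSeq B, ∀ z ∈ M.piece (θ.1 0), ∀ n,
    ‖M.kDer c θ z - M.dAt θ n z / M.dAt θ n (c (θ.1 0))‖ ≤ D * q ^ n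
  der_ne_zero : ∀ θ : NegSeq B, ∀ z ∈ M.piece (θ.1 0), M.kDer c θ z ≠ 0
  taylor : ∀ θ : NegSeq B, ∀ z ∈ M.piece (θ.1 0), ∀ x ∈ M.G (θ.1 0), ∀ y ∈ M.G (θ.1 0), ∀ ρ,
    ‖x - z‖ ≤ ρ → ‖y - z‖ ≤ ρ →
    ‖M.limGeom c θ x - M.limGeom c θ y - M.kDer c θ z * (x - y)‖ ≤ D * ρ ^ ε * ‖x - y‖

/-- The differences of the values of the maps `kₙ`, normalized at a point of the Cantor set, and
the quotients of the derivatives of `f_{θₙ}` at two such points converge. -/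
theorem exists_limits {κ C : ℝ} (hε : 0 < ε) (hε₁ : ε ≤ 1) (hκ : 0 < κ) (hκ₁ : κ < 1)
    (hC : 1 ≤ C) : ∃ D ≥ 0,
    (∀ M : ConformalCantor B ε, M.Tame κ C → ∀ θ : NegSeq B, ∀ z ∈ M.piece (θ.1 0),
      ∀ x ∈ M.G (θ.1 0), ∀ y ∈ M.G (θ.1 0), ∃ L,
        Tendsto (fun n => (M.fWord θ n x - M.fWord θ n y) / M.dAt θ n z) atTop (𝓝 L) ∧
        (∀ ρ, ‖x - z‖ ≤ ρ → ‖y - z‖ ≤ ρ → ∀ n,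
          ‖L - (M.fWord θ n x - M.fWord θ n y) / M.dAt θ n z‖ ≤
            D * (C ^ 3 * ρ ^ ε) * (κ ^ ε) ^ n * ‖x - y‖) ∧ ‖x - y‖ ≤ D * ‖L‖) ∧
    (∀ M : ConformalCantor B ε, M.Tame κ C → ∀ θ : NegSeq B, ∀ z ∈ M.piece (θ.1 0),
      ∀ z₀ ∈ M.piece (θ.1 0), ∃ L, Tendsto (fun n => M.dAt θ n z / M.dAt θ n z₀) atTop (𝓝 L) ∧
        (∀ n, ‖L - M.dAt θ n z / M.dAt θ n z₀‖ ≤ D * C ^ 4 * (κ ^ ε) ^ n) ∧ 1 ≤ D * ‖L‖) := by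
  have hq₀ : 0 < κ ^ ε := Real.rpow_pos_of_pos hκ _
  have hq₁ : κ ^ ε < 1 := Real.rpow_lt_one hκ.le hκ₁ hε
  obtain ⟨D, hD, hlim⟩ := exists_limit_of_relative_variation (C := C ^ 4) hq₀.le hq₁
  have hCε : C ^ ε ≤ C := by simpa using Real.rpow_le_rpow_of_exponent_le hC hε₁
  have hC0 : 0 < C := by linarith
  refine ⟨D, hD, ?_, ?_⟩
  · intro M hM θ z hz x hx y hy
    set s : ℕ → ℂ := fun n => (M.fWord θ n x - M.fWord θ n y) / M.dAt θ n z with hs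
    have h0 : s 0 = x - y := by simp [hs, dAt, fWord]
    have key : ∀ ρ, ‖x - z‖ ≤ ρ → ‖y - z‖ ≤ ρ → ρ ≤ C → ∃ L, Tendsto s atTop (𝓝 L) ∧
        (∀ n, ‖L - s n‖ ≤ D * (C ^ 3 * ρ ^ ε) * (κ ^ ε) ^ n * ‖s 0‖) ∧ ‖s 0‖ ≤ D * ‖L‖ := by
      intro ρ hxz hyz hρC
      have hρ : 0 ≤ ρ := (norm_nonneg _).trans hxz
      have hv := fun n => hM.variation hε hε₁ hκ hκ₁ hC θ hz hx hy hxz hyz n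
      refine hlim (C ^ 3 * ρ ^ ε) ?_ (by positivity) s (fun n => (hv n).1) (fun n => (hv n).2)
      calc C ^ 3 * ρ ^ ε ≤ C ^ 3 * C ^ ε := by gcongr
        _ ≤ C ^ 3 * C := by gcongr
        _ = C ^ 4 := by ring
    rw [h0] at key
    have hxC := hM.diam _ x hx z hz.2
    have hyC := hM.diam _ y hy z hz.2
    obtain ⟨L, hL, -, hL3⟩ := key C hxC hyC le_rfl
    refine ⟨L, hL, fun ρ hxz hyz n => ?_, hL3⟩
    -- The summation constant is uniform only for ρ up to `C`. As `C` bounds the diameter of the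
    -- piece, a larger ρ may be truncated.
    obtain ⟨L', hL', hL2, -⟩ := key (min ρ C) (le_min hxz hxC) (le_min hyz hyC) (min_le_right _ _)
    obtain rfl := tendsto_nhds_unique hL hL'
    have hρ : 0 ≤ ρ := (norm_nonneg _).trans hxz
    refine (hL2 n).trans ?_
    gcongr
    exact min_le_left _ _
  · intro M hM θ z hz z₀ hz₀
    have hv := fun n => hM.variation_der hε hε₁ hκ hκ₁ hC θ hz.2 hz₀.2 n
    set s : ℕ → ℂ := fun n => M.dAt θ n z / M.dAt θ n z₀ with hs
    have h0 : ‖s 0‖ = 1 := by simp [hs, dAt]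
    have := hlim (C ^ 4) le_rfl (by positivity) s (fun n => (hv n).1) (fun n => (hv n).2)
    rw [h0] at this
    simpa only [mul_one] using this

/-- The point is uniformity: `D` and `q = κ ^ ε` depend only on the constants of `Tame`, not on the
Cantor set or the base points. `D` is a sum of constants, one or more for each of the estimates. -/
theorem exists_geom {κ C : ℝ} (hε : 0 < ε) (hε₁ : ε ≤ 1) (hκ : 0 < κ) (hκ₁ : κ < 1) (hC : 1 ≤ C) :
    ∃ D > 0, ∃ q, 0 < q ∧ q < 1 ∧ ∀ M : ConformalCantor B ε, M.Tame κ C → ∀ c, M.IsBase c →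
      M.Geom D q c := by
  have hq₀ : 0 < κ ^ ε := Real.rpow_pos_of_pos hκ _
  have hq₁ : κ ^ ε < 1 := Real.rpow_lt_one hκ.le hκ₁ hε
  have hCε : C ^ ε ≤ C := by simpa using Real.rpow_le_rpow_of_exponent_le hC hε₁
  have hC0 : 0 < C := by linarith
  obtain ⟨D, hD, hk, hd⟩ := exists_limits (B := B) hε hε₁ hκ hκ₁ hC
  set D₁ := D * C ^ 4 with hD₁
  have hD₁0 : 0 ≤ D₁ := by positivity
  refine ⟨1 + D + C * D₁ + D₁ + (1 + D₁) * D₁, by positivity, κ ^ ε, hq₀, hq₁, fun M hM c hc => ?_⟩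
  set D₂ := 1 + D + C * D₁ + D₁ + (1 + D₁) * D₁ with hD₂
  have hD₂0 : 0 ≤ D₂ := by positivity
  have hC3 : D * C ^ 3 ≤ D₁ := by rw [hD₁]; gcongr; linarith
  have hC3' : D * (C ^ 3 * C ^ ε) ≤ D₁ := by
    rw [hD₁, pow_succ C 3]; gcongr
  have htend : ∀ θ : NegSeq B, ∀ x ∈ M.G (θ.1 0),
      Tendsto (fun n => M.kApprox c θ n x) atTop (𝓝 (M.limGeom c θ x)) := by
    intro θ x hx
    obtain ⟨L, hL, -⟩ := hk M hM θ _ (hc _) x hx _ (hc _).2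
    refine tendsto_nhds_limUnder ⟨L, ?_⟩
    simpa only [kApprox_eq hc] using hL
  have htd : ∀ θ : NegSeq B, ∀ z ∈ M.piece (θ.1 0),
      Tendsto (fun n => M.dAt θ n z / M.dAt θ n (c (θ.1 0))) atTop (𝓝 (M.kDer c θ z)) := by
    intro θ z hz
    obtain ⟨L, hL, -⟩ := hd M hM θ z hz _ (hc _)
    exact tendsto_nhds_limUnder ⟨L, hL⟩
  have hkd : ∀ θ : NegSeq B, ∀ x ∈ M.G (θ.1 0), ∀ y ∈ M.G (θ.1 0),
      Tendsto (fun n => (M.fWord θ n x - M.fWord θ n y) / M.dAt θ n (c (θ.1 0))) atTop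
        (𝓝 (M.limGeom c θ x - M.limGeom c θ y)) := by
    intro θ x hx y hy
    refine ((htend θ x hx).sub (htend θ y hy)).congr fun n => ?_
    rw [kApprox_eq hc, kApprox_eq hc]
    ring
  have hfacts : ∀ θ : NegSeq B, ∀ z ∈ M.piece (θ.1 0),
      (∀ n, ‖M.kDer c θ z - M.dAt θ n z / M.dAt θ n (c (θ.1 0))‖ ≤ D₁ * (κ ^ ε) ^ n) ∧
      1 ≤ D * ‖M.kDer c θ z‖ ∧ ‖M.kDer c θ z‖ ≤ 1 + D₁ := by
    intro θ z hz
    obtain ⟨L, hL, hL2, hL3⟩ := hd M hM θ z hz _ (hc _)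
    obtain rfl := tendsto_nhds_unique hL (htd θ z hz)
    refine ⟨hL2, hL3, ?_⟩
    have h1 := hL2 0
    have h0 : M.dAt θ 0 z / M.dAt θ 0 (c (θ.1 0)) = 1 := by simp [dAt]
    rw [h0, pow_zero, mul_one] at h1
    have h2 := norm_le_norm_add_norm_sub' (M.kDer c θ z) 1
    rw [norm_one] at h2
    linarith
  have hlip : ∀ θ : NegSeq B, ∀ x ∈ M.G (θ.1 0), ∀ y ∈ M.G (θ.1 0),
      ‖M.limGeom c θ x - M.limGeom c θ y‖ ≤ (1 + D₁) * ‖x - y‖ ∧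
      ‖x - y‖ ≤ D * ‖M.limGeom c θ x - M.limGeom c θ y‖ := by
    intro θ x hx y hy
    obtain ⟨L, hL, hL2, hL3⟩ := hk M hM θ _ (hc _) x hx y hy
    obtain rfl := tendsto_nhds_unique hL (hkd θ x hx y hy)
    refine ⟨?_, hL3⟩
    have h1 := hL2 C (hM.diam _ _ hx _ (hc _).2) (hM.diam _ _ hy _ (hc _).2) 0
    have h0 : (M.fWord θ 0 x - M.fWord θ 0 y) / M.dAt θ 0 (c (θ.1 0)) = x - y := by
      simp [dAt, fWord]
    rw [h0, pow_zero, mul_one] at h1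
    have h2 := norm_le_norm_add_norm_sub' (M.limGeom c θ x - M.limGeom c θ y) (x - y)
    have h3 : D * (C ^ 3 * C ^ ε) * ‖x - y‖ ≤ D₁ * ‖x - y‖ := by gcongr
    linarith
  refine ⟨hc, htend, fun θ x hx n => ?_, fun θ x hx y hy => ?_, fun θ x hx y hy => ?_, htd,
    fun θ z hz n => ?_, fun θ z hz h => ?_, fun θ z hz x hx y hy ρ hxz hyz => ?_⟩
  · obtain ⟨L, hL, hL2, -⟩ := hk M hM θ _ (hc _) x hx _ (hc _).2
    obtain rfl := tendsto_nhds_unique hL (by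
      simpa only [kApprox_eq hc] using htend θ x hx)
    have h1 := hL2 C (hM.diam _ _ hx _ (hc _).2) (hM.diam _ _ (hc _).2 _ (hc _).2) n
    rw [kApprox_eq hc]
    calc _ ≤ _ := h1
      _ ≤ D₁ * (κ ^ ε) ^ n * C := by gcongr; exact hM.diam _ _ hx _ (hc _).2
      _ = C * D₁ * (κ ^ ε) ^ n := by ring
      _ ≤ _ := by gcongr; rw [hD₂]; nlinarith
  · refine (hlip θ x hx y hy).1.trans ?_
    gcongr
    rw [hD₂]; nlinarith
  · refine (hlip θ x hx y hy).2.trans ?_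
    gcongr
    rw [hD₂]; nlinarith
  · refine ((hfacts θ z hz).1 n).trans ?_
    gcongr
    rw [hD₂]; nlinarith
  · have := (hfacts θ z hz).2.1
    rw [h, norm_zero, mul_zero] at this
    linarith
  · obtain ⟨L, hL, hL2, -⟩ := hk M hM θ z hz x hx y hy
    have hρ : 0 ≤ ρ := (norm_nonneg _).trans hxz
    have h1 := hL2 ρ hxz hyz 0
    have h0 : (M.fWord θ 0 x - M.fWord θ 0 y) / M.dAt θ 0 z = x - y := by
      simp [dAt, fWord]
    rw [h0, pow_zero, mul_one] at h1
    -- Changing the normalization from the base point to `z` multiplies the limit by `kDer`. The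
    -- Taylor estimate can thus be made at any Cantor point.
    have h2 : M.limGeom c θ x - M.limGeom c θ y = M.kDer c θ z * L := by
      refine tendsto_nhds_unique (hkd θ x hx y hy) (((htd θ z hz).mul hL).congr fun n => ?_)
      have := dAt_ne_zero θ n hz.2
      field_simp
    rw [h2, ← mul_sub, norm_mul]
    calc _ ≤ (1 + D₁) * (D * (C ^ 3 * ρ ^ ε) * ‖x - y‖) := by
          gcongr
          exact (hfacts θ z hz).2.2
      _ = (1 + D₁) * (D * C ^ 3) * ρ ^ ε * ‖x - y‖ := by ring
      _ ≤ (1 + D₁) * D₁ * ρ ^ ε * ‖x - y‖ := by gcongr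
      _ ≤ _ := by gcongr; rw [hD₂]; nlinarith

/-! ### The renormalization maps -/

variable {c : A → ℂ} {D q : ℝ}

theorem Geom.limGeom_base (hM : M.Geom D q c) (θ : NegSeq B) :
    M.limGeom c θ (c (θ.1 0)) = 0 := by
  refine tendsto_nhds_unique (hM.tendsto θ _ (hM.base _).2) ?_
  simp only [kApprox_base hM.base, tendsto_const_nhds]

/-- The limit of the linear parts is nonzero because `kDer` is, so the limit exists in the affine
group and `limUnder` takes this value. -/
theorem Geom.tendsto_phi (hM : M.Geom D q c) (θ : NegSeq B) {b : A} (h : B (θ.1 0) b) :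
    Tendsto (fun n => M.phi c θ n * (M.phi c (θ.snoc b h) (n + 1))⁻¹) atTop
        (𝓝 (M.fam c θ b)) ∧
      ((M.fam c θ b).lin : ℂ) =
        M.kDer c θ (M.branch (θ.1 0) (c b)) / M.der (M.branch (θ.1 0) (c b)) ∧
      (M.fam c θ b).tr = M.limGeom c θ (M.branch (θ.1 0) (c b)) := by
  have hp := branch_mem_piece h (hM.base b)
  set p := M.branch (θ.1 0) (c b) with hpdef
  have h0 : M.kDer c θ p / M.der p ≠ 0 :=
    div_ne_zero (hM.der_ne_zero θ p hp) (ConformalCantor.der_ne_zero hp.2)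
  have key : Tendsto (fun n => M.phi c θ n * (M.phi c (θ.snoc b h) (n + 1))⁻¹) atTop
      (𝓝 ⟨Units.mk0 _ h0, M.limGeom c θ p⟩) := by
    rw [AffC.tendsto_iff]
    constructor
    · simp only [phi_mul_lin hM.base]
      exact (hM.tendsto_der θ p hp).div_const _
    · simp only [phi_mul_tr hM.base]
      exact hM.tendsto θ p hp.2
  have hfam : M.fam c θ b = ⟨Units.mk0 _ h0, M.limGeom c θ p⟩ := by
    rw [M.fam_eq c h]
    exact key.limUnder_eq
  rw [hfam]
  exact ⟨key, rfl, rfl⟩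

theorem Geom.fam_app (hM : M.Geom D q c) (θ : NegSeq B) {b : A} (h : B (θ.1 0) b) {z : ℂ}
    (hz : z ∈ M.G b) :
    (M.fam c θ b).app (M.limGeom c (θ.ext' b) z) = M.limGeom c θ (M.branch (θ.1 0) z) := by
  obtain ⟨hF, -⟩ := hM.tendsto_phi θ h
  rw [AffC.tendsto_iff] at hF
  rw [NegSeq.ext'_eq h]
  have h1 := (hM.tendsto (θ.snoc b h) z hz).comp (tendsto_add_atTop_nat 1)
  refine tendsto_nhds_unique ((hF.1.mul h1).add hF.2)
    ((hM.tendsto θ _ (branch_mem h hz)).congr fun n => ?_)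
  rw [← kApprox_snoc θ h]
  rfl

/-! ### Continuous dependence -/

section Continuity

variable {ι : Type*} {l : Filter ι} {N : ι → ConformalCantor B ε} {d : ι → A → ℂ}
  {θ : ι → NegSeq B} {θ₀ : NegSeq B}

theorem Conv.tendsto_fWord (hN : Conv l N K) (hθ : Tendsto θ l (𝓝 θ₀)) {p : ι → ℂ} {p₀ : ℂ}
    (hp : ∀ᶠ i in l, p i ∈ (N i).G ((θ i).1 0)) (h : Tendsto p l (𝓝 p₀)) (n : ℕ) :
    Tendsto (fun i => (N i).fWord (θ i) n (p i)) l (𝓝 (K.fWord θ₀ n p₀)) := by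
  rw [NegSeq.tendsto_iff] at hθ
  induction n with
  | zero => exact h
  | succ n ih =>
    have hmem : ∀ᶠ i in l, (N i).fWord (θ i) n (p i) ∈ (N i).G (θ₀.1 n) := by
      filter_upwards [hp, hθ n] with i hi hn
      rw [← hn]
      exact fWord_mem (θ i) n hi
    refine (hN.tendsto_branch (θ₀.2 n) hmem ih).congr' ?_
    filter_upwards [hθ (n + 1)] with i hi
    rw [← hi]
    rfl

theorem Conv.eventually_fWord_mem_V {p : ι → ℂ}
    (hp : ∀ᶠ i in l, p i ∈ (N i).G ((θ i).1 0)) (n : ℕ) :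
    ∀ᶠ i in l, (N i).fWord (θ i) n (p i) ∈ (N i).V :=
  hp.mono fun i hi => (N i).G_subset_V _ (fWord_mem (θ i) n hi)

theorem Conv.tendsto_dAt [l.NeBot] (hN : Conv l N K) (hθ : Tendsto θ l (𝓝 θ₀)) {p : ι → ℂ} {p₀ : ℂ}
    (hp : ∀ᶠ i in l, p i ∈ (N i).G ((θ i).1 0)) (h : Tendsto p l (𝓝 p₀)) (n : ℕ) :
    Tendsto (fun i => (N i).dAt (θ i) n (p i)) l (𝓝 (K.dAt θ₀ n p₀)) := by
  have hp₀ : p₀ ∈ K.G (θ₀.1 0) := by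
    refine hN.mem_G ?_ h
    filter_upwards [hp, NegSeq.tendsto_iff.1 hθ 0] with i hi h0
    rwa [← h0]
  refine tendsto_finsetProd _ fun j _ => ?_
  have hm := fWord_mem (K := K) θ₀ (j + 1) hp₀
  exact (hN.tendsto_der (Conv.eventually_fWord_mem_V hp (j + 1))
    (hN.tendsto_fWord hθ hp h (j + 1)) (K.G_subset_V _ hm)).inv₀ (der_ne_zero hm)

theorem Conv.tendsto_base (hG : ∀ᶠ i in l, (N i).Geom D q (d i))
    (hd : ∀ a, Tendsto (fun i => d i a) l (𝓝 (c a)))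
    (hθ : Tendsto θ l (𝓝 θ₀)) :
    (∀ᶠ i in l, d i ((θ i).1 0) ∈ (N i).G ((θ i).1 0)) ∧
      Tendsto (fun i => d i ((θ i).1 0)) l (𝓝 (c (θ₀.1 0))) := by
  refine ⟨hG.mono fun i hi => (hi.base _).2, (hd (θ₀.1 0)).congr' ?_⟩
  filter_upwards [NegSeq.tendsto_iff.1 hθ 0] with i hi
  rw [hi]

/-- Each kₙ^θ depends continuously on all data, being built from finitely many branches and
derivatives. The tails are uniformly small since all the Cantor sets share `D` and `q`. -/
theorem Conv.tendsto_limGeom [l.NeBot] (hN : Conv l N K) (hK : K.Geom D q c)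
    (hG : ∀ᶠ i in l, (N i).Geom D q (d i))
    (hd : ∀ a, Tendsto (fun i => d i a) l (𝓝 (c a)))
    (hq₀ : 0 ≤ q) (hq₁ : q < 1) (hθ : Tendsto θ l (𝓝 θ₀)) {p : ι → ℂ} {p₀ : ℂ}
    (hp : ∀ᶠ i in l, p i ∈ (N i).G ((θ i).1 0)) (h : Tendsto p l (𝓝 p₀)) :
    Tendsto (fun i => (N i).limGeom (d i) (θ i) (p i)) l (𝓝 (K.limGeom c θ₀ p₀)) := by
  have hp₀ : p₀ ∈ K.G (θ₀.1 0) := by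
    refine hN.mem_G ?_ h
    filter_upwards [hp, NegSeq.tendsto_iff.1 hθ 0] with i hi h0
    rwa [← h0]
  obtain ⟨hb, hbt⟩ := Conv.tendsto_base hG hd hθ
  refine tendsto_of_geometric_tails hq₀ hq₁ (a := fun n i => (N i).kApprox (d i) (θ i) n (p i))
    (α := fun n => K.kApprox c θ₀ n p₀) (D := D) (fun n => ?_) ?_ (hK.tail θ₀ p₀ hp₀)
  · rw [kApprox_eq hK.base]
    refine (((hN.tendsto_fWord hθ hp h n).sub (hN.tendsto_fWord hθ hb hbt n)).div
      (hN.tendsto_dAt hθ hb hbt n) (dAt_ne_zero θ₀ n (hK.base _).2)).congr' ?_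
    filter_upwards [hG] with i hi
    exact (kApprox_eq hi.base _ _ _).symm
  · filter_upwards [hG, hp] with i hi hpi
    exact hi.tail (θ i) (p i) hpi

theorem Conv.tendsto_kDer [l.NeBot] (hN : Conv l N K) (hK : K.Geom D q c)
    (hG : ∀ᶠ i in l, (N i).Geom D q (d i))
    (hd : ∀ a, Tendsto (fun i => d i a) l (𝓝 (c a)))
    (hq₀ : 0 ≤ q) (hq₁ : q < 1) (hθ : Tendsto θ l (𝓝 θ₀)) {p : ι → ℂ} {p₀ : ℂ}
    (hp : ∀ᶠ i in l, p i ∈ (N i).piece ((θ i).1 0)) (hp₀ : p₀ ∈ K.piece (θ₀.1 0))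
    (h : Tendsto p l (𝓝 p₀)) :
    Tendsto (fun i => (N i).kDer (d i) (θ i) (p i)) l (𝓝 (K.kDer c θ₀ p₀)) := by
  obtain ⟨hb, hbt⟩ := Conv.tendsto_base hG hd hθ
  refine tendsto_of_geometric_tails hq₀ hq₁
    (a := fun n i => (N i).dAt (θ i) n (p i) / (N i).dAt (θ i) n (d i ((θ i).1 0)))
    (α := fun n => K.dAt θ₀ n p₀ / K.dAt θ₀ n (c (θ₀.1 0))) (D := D) (fun n => ?_) ?_
    (hK.tail_der θ₀ p₀ hp₀)
  · exact (hN.tendsto_dAt hθ (hp.mono fun i hi => hi.2) h n).div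
      (hN.tendsto_dAt hθ hb hbt n) (dAt_ne_zero θ₀ n (hK.base _).2)
  · filter_upwards [hG, hp] with i hi hpi
    exact hi.tail_der (θ i) (p i) hpi

theorem Conv.tendsto_fam [l.NeBot] (hN : Conv l N K) (hK : K.Geom D q c)
    (hG : ∀ᶠ i in l, (N i).Geom D q (d i))
    (hd : ∀ a, Tendsto (fun i => d i a) l (𝓝 (c a)))
    (hq₀ : 0 ≤ q) (hq₁ : q < 1) (hθ : Tendsto θ l (𝓝 θ₀)) {b : A}
    (hb : B (θ₀.1 0) b) :
    Tendsto (fun i => (N i).fam (d i) (θ i) b) l (𝓝 (K.fam c θ₀ b)) := by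
  have h0 := NegSeq.tendsto_iff.1 hθ 0
  have hmem : ∀ᶠ i in l, (N i).branch ((θ i).1 0) (d i b) ∈ (N i).piece ((θ i).1 0) := by
    filter_upwards [hG, h0] with i hi h0
    exact branch_mem_piece (h0 ▸ hb) (hi.base b)
  have ht : Tendsto (fun i => (N i).branch ((θ i).1 0) (d i b)) l
      (𝓝 (K.branch (θ₀.1 0) (c b))) := by
    refine (hN.tendsto_branch hb (hG.mono fun i hi => (hi.base b).2) (hd b)).congr' ?_
    filter_upwards [h0] with i hi
    rw [hi]
  have hp₀ := branch_mem_piece hb (hK.base b)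
  have hlin := ((hN.tendsto_kDer hK hG hd hq₀ hq₁ hθ hmem hp₀ ht).div (hN.tendsto_der
    (hmem.mono fun i hi => (N i).G_subset_V _ hi.2) ht (K.G_subset_V _ hp₀.2))
    (ConformalCantor.der_ne_zero hp₀.2))
  have htr := hN.tendsto_limGeom hK hG hd hq₀ hq₁ hθ (hmem.mono fun i hi => hi.2) ht
  obtain ⟨-, hl, hr⟩ := hK.tendsto_phi θ₀ hb
  rw [AffC.tendsto_iff, hl, hr]
  constructor
  · refine hlin.congr' ?_
    filter_upwards [hG, h0] with i hi h0
    exact ((hi.tendsto_phi (θ i) (h0 ▸ hb)).2.1).symm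
  · refine htr.congr' ?_
    filter_upwards [hG, h0] with i hi h0
    exact ((hi.tendsto_phi (θ i) (h0 ▸ hb)).2.2).symm

end Continuity

end ConformalCantor

end ConfCantor

namespace ConfCantor

namespace ConformalCantor

variable {A : Type*} {B : A → A → Prop} {ε : ℝ} {K : ConformalCantor B ε}

/-! ### Points with a given itinerary -/

variable (K) in
/-- The points whose first iterates follow the sequence `a`. -/
def cylinder : ℕ → (ℕ → A) → Set ℂ
  | 0, a => K.G (a 0)
  | n + 1, a => K.G (a 0) ∩ K.g ⁻¹' cylinder n fun i => a (i + 1)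

theorem isClosed_cylinder (n : ℕ) (a : ℕ → A) : IsClosed (K.cylinder n a) := by
  induction n generalizing a with
  | zero => exact (K.isCompact_G _).isClosed
  | succ n ih =>
    refine ContinuousOn.preimage_isClosed_of_isClosed (fun x hx => ?_) (K.isCompact_G _).isClosed
      (ih _)
    exact (continuousAt_g (K.G_subset_V _ hx)).continuousWithinAt

theorem cylinder_succ_subset (n : ℕ) (a : ℕ → A) : K.cylinder (n + 1) a ⊆ K.cylinder n a := by
  induction n generalizing a with
  | zero => exact inter_subset_left
  | succ n ih => exact inter_subset_inter_right _ (preimage_mono (ih _))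

theorem cylinder_nonempty (n : ℕ) {a : ℕ → A} (ha : ∀ i, B (a i) (a (i + 1))) :
    (K.cylinder n a).Nonempty := by
  induction n generalizing a with
  | zero => exact (K.isConnected_G _).nonempty
  | succ n ih =>
    obtain ⟨y, hy⟩ := ih (a := fun i => a (i + 1)) fun i => ha (i + 1)
    have hyG : y ∈ K.G (a 1) := by
      cases n with
      | zero => exact hy
      | succ n => exact hy.1
    refine ⟨K.branch (a 0) y, branch_mem (ha 0) hyG, ?_⟩
    rw [mem_preimage, g_branch (ha 0) hyG]
    exact hy

theorem iterate_mem_of_mem_cylinder {n : ℕ} {a : ℕ → A} {x : ℂ} (hx : x ∈ K.cylinder n a) :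
    K.g^[n] x ∈ K.G (a n) := by
  induction n generalizing a x with
  | zero => exact hx
  | succ n ih => exact ih hx.2

/-- The cylinders are nonempty, closed and decreasing in a compact piece. -/
theorem exists_itinerary (K : ConformalCantor B ε) {a : ℕ → A} (ha : ∀ i, B (a i) (a (i + 1))) :
    ∃ x, ∀ n, K.g^[n] x ∈ K.G (a n) := by
  obtain ⟨x, hx⟩ := IsCompact.nonempty_iInter_of_sequence_nonempty_isCompact_isClosed
    (fun n => K.cylinder n a) (fun n => cylinder_succ_subset n a)
    (fun n => cylinder_nonempty n ha) (K.isCompact_G _) (fun n => isClosed_cylinder n a)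
  exact ⟨x, fun n => iterate_mem_of_mem_cylinder (mem_iInter.1 hx n)⟩

theorem mem_piece_of_itinerary {a : ℕ → A} {x : ℂ} (hx : ∀ n, K.g^[n] x ∈ K.G (a n)) :
    x ∈ K.piece (a 0) := ⟨fun n => mem_iUnion.2 ⟨_, hx n⟩, hx 0⟩

theorem fSeq_iterate {a : ℕ → A} {x : ℂ} (hx : ∀ n, K.g^[n] x ∈ K.G (a n)) (n : ℕ) {m : ℕ}
    (hm : m ≤ n) : K.fSeq (fun i => a (n - i)) m (K.g^[n] x) = K.g^[n - m] x := by
  induction m with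
  | zero => rfl
  | succ m ih =>
    change K.branch (a (n - (m + 1))) (K.fSeq (fun i => a (n - i)) m (K.g^[n] x)) = _
    rw [ih (Nat.le_of_succ_le hm)]
    have h : n - m = (n - (m + 1)) + 1 := by omega
    rw [h, Function.iterate_succ_apply']
    exact branch_g (hx _)

/-- Both points are recovered from their n-th iterates, which lie in one piece, by the same
composition of `n` inverse branches. The letters are read backwards, hence the index `n - i`. -/
theorem Tame.eq_of_itinerary {κ C : ℝ} (hK : K.Tame κ C) (hκ : 0 < κ) (hκ₁ : κ < 1)
    {a : ℕ → A} {x y : ℂ} (hx : ∀ n, K.g^[n] x ∈ K.G (a n)) (hy : ∀ n, K.g^[n] y ∈ K.G (a n)) :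
    x = y := by
  have hC : 0 ≤ C := (norm_nonneg _).trans (hK.diam _ _ (hx 0) _ (hx 0))
  have h : ∀ n, ‖x - y‖ ≤ C * C * κ ^ n := by
    intro n
    have hw : ∀ i < n, B (a (n - (i + 1))) (a (n - i)) := by
      intro i hi
      have h1 : n - i = (n - (i + 1)) + 1 := by omega
      have h2 := hx (n - i)
      rw [h1, Function.iterate_succ_apply'] at h2
      rw [h1]
      exact admissible (hx _) h2
    have h1 := hK.contraction (fun i => a (n - i)) n hw (K.g^[n] x) (hx n) (K.g^[n] y) (hy n)
    rw [fSeq_iterate hx n le_rfl, fSeq_iterate hy n le_rfl, Nat.sub_self] at h1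
    calc ‖x - y‖ ≤ _ := h1
      _ ≤ C * κ ^ n * C := by gcongr; exact hK.diam _ _ (hx n) _ (hy n)
      _ = _ := by ring
  have h0 : Tendsto (fun n => C * C * κ ^ n) atTop (𝓝 0) := by
    simpa using (tendsto_pow_atTop_nhds_zero_of_lt_one hκ.le hκ₁).const_mul (C * C)
  exact sub_eq_zero.1 (norm_le_zero_iff.1 (ge_of_tendsto' h0 h))

section Limits

variable {ι : Type*} {l : Filter ι} {N : ι → ConformalCantor B ε}

theorem Conv.tendsto_iterate [l.NeBot] (hN : Conv l N K) {a : ℕ → A} {p : ι → ℂ} {p₀ : ℂ}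
    (hp : ∀ n, ∀ᶠ i in l, (N i).g^[n] (p i) ∈ (N i).G (a n)) (h : Tendsto p l (𝓝 p₀)) (n : ℕ) :
    Tendsto (fun i => (N i).g^[n] (p i)) l (𝓝 (K.g^[n] p₀)) := by
  induction n with
  | zero => exact h
  | succ n ih =>
    simp only [Function.iterate_succ_apply']
    exact hN.tendsto_g (eventually_mem_V_of_G (hp n)) ih (K.G_subset_V _ (hN.mem_G (hp n) ih))

theorem Conv.mem_iUnion_G [Finite A] [l.NeBot] (hN : Conv l N K) {p : ι → ℂ} {p₀ : ℂ}
    (hp : ∀ᶠ i in l, p i ∈ ⋃ a, (N i).G a) (h : Tendsto p l (𝓝 p₀)) : p₀ ∈ ⋃ a, K.G a := by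
  by_contra hcon
  have hall : ∀ᶠ i in l, ∀ a, p i ∉ (N i).G a := by
    refine eventually_all.2 fun a => ?_
    by_contra hfreq
    -- The piece containing `p i` may vary with `i`; restricting the filter to the indices with one
    -- frequent letter fixes it.
    have hne : (l ⊓ 𝓟 {i | p i ∈ (N i).G a}).NeBot := by
      rw [← frequently_mem_iff_neBot]
      exact (not_eventually.1 hfreq).mono fun i hi => not_not.1 hi
    exact hcon (mem_iUnion.2 ⟨a, (hN.mono inf_le_left).mem_G
      (l := l ⊓ 𝓟 {i | p i ∈ (N i).G a}) (mem_inf_of_right (mem_principal_self _))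
      (h.mono_left inf_le_left)⟩)
  obtain ⟨i, hi, hi'⟩ := (hp.and hall).exists
  obtain ⟨a, ha⟩ := mem_iUnion.1 hi
  exact hi' a ha

theorem Conv.mem_piece [Finite A] [l.NeBot] (hN : Conv l N K) {a : A} {p : ι → ℂ} {p₀ : ℂ}
    (hp : ∀ᶠ i in l, p i ∈ (N i).piece a) (h : Tendsto p l (𝓝 p₀)) : p₀ ∈ K.piece a := by
  refine ⟨?_, hN.mem_G (hp.mono fun i hi => hi.2) h⟩
  have hU : ∀ n, ∀ᶠ i in l, (N i).g^[n] (p i) ∈ ⋃ a, (N i).G a := fun n =>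
    hp.mono fun i hi => hi.1 n
  have ht : ∀ n, Tendsto (fun i => (N i).g^[n] (p i)) l (𝓝 (K.g^[n] p₀)) := by
    intro n
    induction n with
    | zero => exact h
    | succ n ih =>
      simp only [Function.iterate_succ_apply']
      refine hN.tendsto_g ((hU n).mono fun i hi => ?_) ih ?_
      · obtain ⟨b, hb⟩ := mem_iUnion.1 hi
        exact (N i).G_subset_V b hb
      · obtain ⟨b, hb⟩ := mem_iUnion.1 (hN.mem_iUnion_G (hU n) ih)
        exact K.G_subset_V b hb
  exact fun n => hN.mem_iUnion_G (hU n) (ht n)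

end Limits

/-- The Cantor sets close to `K` have base points close to those of `K`. -/
theorem eventually_exists_base [Finite A] (hε : 0 < ε) (hε₁ : ε ≤ 1) {c : A → ℂ}
    (hc : K.IsBase c) {η : ℝ} (hη : 0 < η) :
    ∀ᶠ M in K.nhdsCantor, ∃ d, M.IsBase d ∧ ∀ a, ‖d a - c a‖ < η := by
  obtain ⟨κ, hκ, hκ₁, C, -, hT⟩ := exists_tame hε hε₁ K
  have hKT : K.Tame κ C := (conv_const (pure ()) K).eventually hT
  -- The new base point in a nearby Cantor set is a point with the itinerary of `c a`. Its limits
  -- have this itinerary for `K`, and contraction leaves only `c a`.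
  have hit : ∀ a, ∃ s : ℕ → A, s 0 = a ∧ ∀ n, K.g^[n] (c a) ∈ K.G (s n) := by
    intro a
    have : ∀ n, ∃ b, K.g^[n] (c a) ∈ K.G b := fun n => mem_iUnion.1 ((hc a).1 n)
    choose s hs using this
    exact ⟨s, eq_of_mem_G (hs 0) (hc a).2, hs⟩
  choose s hs0 hs using hit
  have hsB : ∀ a i, B (s a i) (s a (i + 1)) := fun a i => by
    have h := hs a (i + 1)
    rw [Function.iterate_succ_apply'] at h
    exact admissible (hs a i) h
  have hex : ∀ (M : ConformalCantor B ε) (a : A), ∃ x, ∀ n, M.g^[n] x ∈ M.G (s a n) :=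
    fun M a => M.exists_itinerary (hsB a)
  choose d hd using hex
  have ht : ∀ a, Tendsto (fun M => d M a) K.nhdsCantor (𝓝 (c a)) := by
    intro a
    rw [tendsto_iff_ultrafilter]
    intro U hU
    have hM := (conv_nhdsCantor K).mono hU
    have hp : ∀ n, ∀ᶠ M in (U : Filter (ConformalCantor B ε)),
        (id M).g^[n] (d M a) ∈ (id M).G (s a n) := fun n => Eventually.of_forall fun M => hd M a n
    obtain ⟨u, -, hu⟩ := hM.exists_tendsto (hp 0)
    have h1 : ∀ n, K.g^[n] u ∈ K.G (s a n) := fun n =>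
      hM.mem_G (hp n) (hM.tendsto_iterate hp hu n)
    rw [← hKT.eq_of_itinerary hκ hκ₁ h1 (hs a)]
    exact hu
  filter_upwards [eventually_all.2 fun a => Metric.tendsto_nhds.1 (ht a) η hη] with M hM
  refine ⟨d M, fun a => ?_, fun a => ?_⟩
  · have := mem_piece_of_itinerary (hd M a)
    rwa [hs0] at this
  · rw [← dist_eq_norm]
    exact hM a

/-! ### Cantor sets with base points -/

/-- The neighbourhoods of a Cantor set with base points. -/
noncomputable def nhdsBase (K : ConformalCantor B ε) (c : A → ℂ) :
    Filter (ConformalCantor B ε × (A → ℂ)) :=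
  (K.nhdsCantor ×ˢ 𝓝 c) ⊓ 𝓟 {p | p.1.IsBase p.2}

theorem pure_le_nhdsBase {c : A → ℂ} (hc : K.IsBase c) : pure (K, c) ≤ K.nhdsBase c := by
  refine le_inf ?_ ?_
  · rw [← prod_pure_pure]
    refine Filter.prod_mono ?_ (pure_le_nhds c)
    intro s hs
    obtain ⟨δ, hδ, h⟩ := eventually_nhdsCantor.1 hs
    exact h K (near_self K hδ)
  · rw [le_principal_iff]
    exact hc

theorem nhdsBase_neBot {c : A → ℂ} (hc : K.IsBase c) : (K.nhdsBase c).NeBot :=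
  NeBot.mono inferInstance (pure_le_nhdsBase hc)

theorem conv_nhdsBase (K : ConformalCantor B ε) (c : A → ℂ) :
    Conv (K.nhdsBase c) (fun p => p.1) K := fun δ hδ =>
  (tendsto_fst.mono_left inf_le_left) (conv_nhdsCantor K δ hδ)

theorem tendsto_nhdsBase (K : ConformalCantor B ε) (c : A → ℂ) (a : A) :
    Tendsto (fun p : ConformalCantor B ε × (A → ℂ) => p.2 a) (K.nhdsBase c) (𝓝 (c a)) :=
  tendsto_pi_nhds.1 (tendsto_snd.mono_left inf_le_left) a

/-- Passes from the filter to δ and η: the base points are taken closer to `c` than both η and the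
radius that `P` requires. -/
theorem eventually_nhdsBase [Finite A] (hε : 0 < ε) (hε₁ : ε ≤ 1) {c : A → ℂ} (hc : K.IsBase c)
    {P : ConformalCantor B ε × (A → ℂ) → Prop} (hP : ∀ᶠ p in K.nhdsBase c, P p) {η : ℝ}
    (hη : 0 < η) :
    ∃ δ > 0, ∀ M, K.Near δ M → ∃ d, M.IsBase d ∧ (∀ a, ‖d a - c a‖ < η) ∧ P (M, d) := by
  cases nonempty_fintype A
  rw [nhdsBase, eventually_inf_principal, eventually_prod_iff] at hP
  obtain ⟨pa, ha, pb, hb, h⟩ := hP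
  obtain ⟨r, hr, hrb⟩ := Metric.eventually_nhds_iff.1 hb
  obtain ⟨δ, hδ, hM⟩ := eventually_nhdsCantor.1
    (ha.and (eventually_exists_base hε hε₁ hc (lt_min hη hr)))
  refine ⟨δ, hδ, fun M hnear => ?_⟩
  obtain ⟨hpa, d, hd, hdc⟩ := hM M hnear
  refine ⟨d, hd, fun a => (hdc a).trans_le (min_le_left _ _), h hpa (hrb ?_) hd⟩
  rw [dist_pi_lt_iff hr]
  intro a
  rw [dist_eq_norm]
  exact (hdc a).trans_le (min_le_right _ _)

/-- Uniform estimates in a neighbourhood of a Cantor set with base points. -/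
theorem exists_uniform [Finite A] (hε : 0 < ε) (hε₁ : ε ≤ 1) {c : A → ℂ} (hc : K.IsBase c) :
    ∃ κ, 0 < κ ∧ κ < 1 ∧ ∃ C, 1 ≤ C ∧ ∃ D > 0, ∃ q, 0 < q ∧ q < 1 ∧ K.Tame κ C ∧ K.Geom D q c ∧
      ∀ᶠ p in K.nhdsBase c, p.1.Tame κ C ∧ p.1.Geom D q p.2 := by
  obtain ⟨κ, hκ, hκ₁, C, hC, hT⟩ := exists_tame hε hε₁ K
  obtain ⟨D, hD, q, hq, hq₁, hG⟩ := exists_geom (B := B) hε hε₁ hκ hκ₁ hC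
  have hev : ∀ᶠ p in K.nhdsBase c, p.1.Tame κ C ∧ p.1.Geom D q p.2 := by
    filter_upwards [(conv_nhdsBase K c).eventually hT,
      mem_inf_of_right (mem_principal_self _)] with p hp hb
    exact ⟨hp, hG p.1 hp p.2 hb⟩
  have hself := eventually_pure.1 (hev.filter_mono (pure_le_nhdsBase hc))
  exact ⟨κ, hκ, hκ₁, C, hC, D, hD, q, hq, hq₁, hself.1, hself.2, hev⟩

/-- The continuity on which everything rests: the Cantor set, the base points and the sequence vary
simultaneously. -/
theorem famTendsto_fam [Finite A] (hε : 0 < ε) (hε₁ : ε ≤ 1) {c : A → ℂ} (hc : K.IsBase c) :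
    FamTendsto (K.nhdsBase c) (fun p => p.1.fam p.2) (K.fam c) := by
  obtain ⟨_, _, _, _, _, D, _, q, hq, hq₁, _, hK, hev⟩ := exists_uniform hε hε₁ hc
  intro θ b hb
  have := nhdsBase_neBot hc
  have hfst : Tendsto (fun p : (ConformalCantor B ε × (A → ℂ)) × NegSeq B => p.1)
    (K.nhdsBase c ×ˢ 𝓝 θ) (K.nhdsBase c) := tendsto_fst
  exact Conv.tendsto_fam (N := fun p : (ConformalCantor B ε × (A → ℂ)) × NegSeq B => p.1.1)
    (d := fun p => p.1.2) (θ := fun p => p.2)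
    (fun δ hδ => hfst.eventually (conv_nhdsBase K c δ hδ)) hK
    (hfst.eventually (hev.mono fun p hp => hp.2))
    (fun a => (tendsto_nhdsBase K c a).comp hfst) hq.le hq₁ tendsto_snd hb

theorem continuousAt_fam [Finite A] (hε : 0 < ε) (hε₁ : ε ≤ 1) {c : A → ℂ} (hc : K.IsBase c)
    (θ : NegSeq B) (b : A) (hb : B (θ.1 0) b) : ContinuousAt (fun η => K.fam c η b) θ := by
  have h := (famTendsto_fam hε hε₁ hc θ b hb).mono_left
    (Filter.prod_mono (pure_le_nhdsBase hc) le_rfl)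
  rw [pure_prod, tendsto_map'_iff] at h
  exact h

end ConformalCantor

theorem FamTendsto.comp {ι ι' A : Type*} {B : A → A → Prop} {l : Filter ι} {l' : Filter ι'}
    {F : ι → NegSeq B → A → AffC} {F₀ : NegSeq B → A → AffC} (h : FamTendsto l F F₀)
    {u : ι' → ι} (hu : Tendsto u l' l) : FamTendsto l' (fun i => F (u i)) F₀ := fun θ b hb =>
  (h θ b hb).comp (hu.prodMap tendsto_id)

/-! ### Immediately recurrent sets and persistence -/

section Persistence

variable {A₁ A₂ : Type*} [Finite A₁] [Finite A₂] {B₁ : A₁ → A₁ → Prop} {B₂ : A₂ → A₂ → Prop}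
  {ε : ℝ} {K₁ : ConformalCantor B₁ ε} {K₂ : ConformalCantor B₂ ε} {c₁ : A₁ → ℂ} {c₂ : A₂ → ℂ}

theorem exists_near_of_eventually (hε : 0 < ε) (hε₁ : ε ≤ 1) (hc₁ : K₁.IsBase c₁)
    (hc₂ : K₂.IsBase c₂) {P : ConformalCantor B₁ ε → (A₁ → ℂ) → ConformalCantor B₂ ε →
      (A₂ → ℂ) → Prop}
    (hP : ∀ᶠ p in K₁.nhdsBase c₁ ×ˢ K₂.nhdsBase c₂, P p.1.1 p.1.2 p.2.1 p.2.2) {η : ℝ}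
    (hη : 0 < η) : ∃ δ > 0, ∀ M₁ M₂, K₁.Near δ M₁ → K₂.Near δ M₂ →
      ∃ d₁ d₂, M₁.IsBase d₁ ∧ M₂.IsBase d₂ ∧ (∀ a, ‖d₁ a - c₁ a‖ < η) ∧
        (∀ a, ‖d₂ a - c₂ a‖ < η) ∧ P M₁ d₁ M₂ d₂ := by
  obtain ⟨p₁, h₁, p₂, h₂, h⟩ := eventually_prod_iff.1 hP
  obtain ⟨δ₁, hδ₁, hM₁⟩ := ConformalCantor.eventually_nhdsBase hε hε₁ hc₁ h₁ hη
  obtain ⟨δ₂, hδ₂, hM₂⟩ := ConformalCantor.eventually_nhdsBase hε hε₁ hc₂ h₂ hη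
  refine ⟨min δ₁ δ₂, lt_min hδ₁ hδ₂, fun M₁ M₂ hn₁ hn₂ => ?_⟩
  obtain ⟨d₁, hd₁, hdc₁, hp₁⟩ := hM₁ M₁ (hn₁.mono (min_le_left _ _))
  obtain ⟨d₂, hd₂, hdc₂, hp₂⟩ := hM₂ M₂ (hn₂.mono (min_le_right _ _))
  exact ⟨d₁, d₂, hd₁, hd₂, hdc₁, hdc₂, h hp₁ hp₂⟩

theorem eventually_reach_fam (hε : 0 < ε) (hε₁ : ε ≤ 1) (hc₁ : K₁.IsBase c₁)
    (hc₂ : K₂.IsBase c₂) {O L : Set (AffC × NegSeq B₁ × NegSeq B₂)} (hO : IsOpen O)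
    (hL : IsCompact L) {N : Set ℕ}
    (h : ∀ x ∈ L, ∃ n ∈ N, x ∈ Reach (Step (K₁.fam c₁, K₂.fam c₂)) O n) :
    ∀ᶠ p in K₁.nhdsBase c₁ ×ˢ K₂.nhdsBase c₂, ∀ x ∈ L, ∃ n ∈ N,
      x ∈ Reach (Step (p.1.1.fam p.1.2, p.2.1.fam p.2.2)) O n :=
  eventually_forall_reach
    (F := fun p : (ConformalCantor B₁ ε × (A₁ → ℂ)) × ConformalCantor B₂ ε × (A₂ → ℂ) =>
      (p.1.1.fam p.1.2, p.2.1.fam p.2.2)) (F₀ := (K₁.fam c₁, K₂.fam c₂))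
    ((ConformalCantor.famTendsto_fam hε hε₁ hc₁).comp tendsto_fst)
    ((ConformalCantor.famTendsto_fam hε hε₁ hc₂).comp tendsto_snd) hO hL h

/-- A recurrent compact set is contained in the interior of an immediately recurrent one. -/
theorem IsRecurrent.exists_isImmediatelyRecurrent (hε : 0 < ε) (hε₁ : ε ≤ 1)
    (hc₁ : K₁.IsBase c₁) (hc₂ : K₂.IsBase c₂) {L : Set (RelConf B₁ B₂)}
    (hL : IsRecurrent K₁ c₁ K₂ c₂ L) :
    ∃ L₁, IsImmediatelyRecurrent K₁ c₁ K₂ c₂ L₁ ∧ L ⊆ interior L₁ := by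
  rw [isRecurrent_iff] at hL
  obtain ⟨D, hD, hLD, hDD⟩ := exists_compact_one_step
    (isOpen_step (F₀ := (K₁.fam c₁, K₂.fam c₂))
      (ConformalCantor.continuousAt_fam hε hε₁ hc₁) (ConformalCantor.continuousAt_fam hε hε₁ hc₂))
    hL.1 (fun x hx => by
      obtain ⟨n, hn, hxn⟩ := hL.2 x hx
      obtain ⟨m, rfl⟩ := Nat.exists_eq_add_of_le' (mem_Ici.1 hn)
      exact ⟨m, hxn⟩)
  have himg : RelConf.homeo B₁ B₂ '' (RelConf.homeo B₁ B₂ ⁻¹' D) = D :=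
    image_preimage_eq _ (RelConf.homeo B₁ B₂).surjective
  refine ⟨RelConf.homeo B₁ B₂ ⁻¹' D, ?_, ?_⟩
  · rw [isImmediatelyRecurrent_iff, himg]
    exact ⟨hD, hDD⟩
  · rw [← (RelConf.homeo B₁ B₂).preimage_interior, ← image_subset_iff]
    exact hLD

/-- The same set `L` serves for all nearby Cantor sets, since 𝒞 depends only on the subshifts; only
the families that define `Step` move. -/
theorem IsRecurrent.persistence (hε : 0 < ε) (hε₁ : ε ≤ 1)
    (hc₁ : K₁.IsBase c₁) (hc₂ : K₂.IsBase c₂) {L : Set (RelConf B₁ B₂)}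
    (hL : IsRecurrent K₁ c₁ K₂ c₂ L) {η : ℝ} (hη : 0 < η) :
    ∃ δ > 0, ∀ M₁ M₂, K₁.Near δ M₁ → K₂.Near δ M₂ →
      ∃ d₁ d₂, M₁.IsBase d₁ ∧ M₂.IsBase d₂ ∧ (∀ a, ‖d₁ a - c₁ a‖ < η) ∧
        (∀ a, ‖d₂ a - c₂ a‖ < η) ∧ IsRecurrent M₁ d₁ M₂ d₂ L := by
  simp only [isRecurrent_iff] at hL ⊢
  refine exists_near_of_eventually (P := fun M₁ d₁ M₂ d₂ => _ ∧ _) hε hε₁ hc₁ hc₂ ?_ hη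
  filter_upwards [eventually_reach_fam hε hε₁ hc₁ hc₂ isOpen_interior hL.1 hL.2] with p hp
  exact ⟨hL.1, hp⟩

theorem IsImmediatelyRecurrent.persistence (hε : 0 < ε) (hε₁ : ε ≤ 1)
    (hc₁ : K₁.IsBase c₁) (hc₂ : K₂.IsBase c₂) {L : Set (RelConf B₁ B₂)}
    (hL : IsImmediatelyRecurrent K₁ c₁ K₂ c₂ L) {η : ℝ} (hη : 0 < η) :
    ∃ δ > 0, ∀ M₁ M₂, K₁.Near δ M₁ → K₂.Near δ M₂ →
      ∃ d₁ d₂, M₁.IsBase d₁ ∧ M₂.IsBase d₂ ∧ (∀ a, ‖d₁ a - c₁ a‖ < η) ∧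
        (∀ a, ‖d₂ a - c₂ a‖ < η) ∧ IsImmediatelyRecurrent M₁ d₁ M₂ d₂ L := by
  simp only [isImmediatelyRecurrent_iff] at hL ⊢
  refine exists_near_of_eventually (P := fun M₁ d₁ M₂ d₂ => _ ∧ _) hε hε₁ hc₁ hc₂ ?_ hη
  filter_upwards [eventually_reach_fam hε hε₁ hc₁ hc₂ isOpen_interior hL.1 (N := {1})
    fun x hx => ⟨1, rfl, hL.2 x hx⟩] with p hp
  refine ⟨hL.1, fun x hx => ?_⟩
  obtain ⟨n, rfl, hn⟩ := hp x hx
  exact hn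

end Persistence

end ConfCantor

namespace ConfCantor

/-- Continuous convergence of families is uniform convergence. -/
theorem FamTendsto.eventually_famClose {ι A : Type*} [Finite A] {B : A → A → Prop} {l : Filter ι}
    {F : ι → NegSeq B → A → AffC} {F₀ : NegSeq B → A → AffC} (h : FamTendsto l F F₀)
    (h₀ : ∀ θ b, B (θ.1 0) b → ContinuousAt (fun η => F₀ η b) θ) {m : ℝ} (hm : 0 < m) :
    ∀ᶠ i in l, FamClose m F₀ (F i) := by
  have key : ∀ b, ∀ᶠ i in l, ∀ θ : NegSeq B, B (θ.1 0) b →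
      ‖((F i θ b).lin : ℂ) - (F₀ θ b).lin‖ ≤ m ∧ ‖(F i θ b).tr - (F₀ θ b).tr‖ ≤ m := by
    intro b
    refine eventually_forall_of_ultrafilter fun U hU θ hθ => ?_
    -- Compactness of Σ⁻ supplies a limit sequence, at which the perturbed and the unperturbed
    -- families have the same limit.
    obtain ⟨θ₀, -, hθ₀⟩ := isCompact_univ.ultrafilter_le_nhds (U.map θ) (by simp)
    have ht : Tendsto θ U (𝓝 θ₀) := hθ₀
    obtain ⟨i, hi, hi0⟩ := (hθ.and (NegSeq.tendsto_iff.1 ht 0)).exists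
    have hb : B (θ₀.1 0) b := hi0 ▸ hi
    have h1 := AffC.tendsto_iff.1 ((h θ₀ b hb).comp (Tendsto.prodMk (tendsto_id'.2 hU) ht))
    have h2 := AffC.tendsto_iff.1 ((h₀ θ₀ b hb).tendsto.comp ht)
    refine Eventually.frequently ?_
    have h3 := (h1.1.sub h2.1).norm
    have h4 := (h1.2.sub h2.2).norm
    rw [sub_self, norm_zero] at h3 h4
    filter_upwards [h3.eventually (gt_mem_nhds hm), h4.eventually (gt_mem_nhds hm)] with i h5 h6
    exact ⟨h5.le, h6.le⟩
  filter_upwards [eventually_all.2 key] with i hi θ b hb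
  exact hi b θ hb

namespace ConformalCantor

variable {A : Type*} {B : A → A → Prop} {ε : ℝ} {K M : ConformalCantor B ε}

theorem isCompact_piece [Finite A] (K : ConformalCantor B ε) (a : A) : IsCompact (K.piece a) := by
  rw [isCompact_iff_ultrafilter_le_nhds]
  intro U hU
  have hev : ∀ᶠ x in (U : Filter ℂ), x ∈ K.piece a := le_principal_iff.1 hU
  obtain ⟨u, -, hu⟩ := (conv_const (U : Filter ℂ) K).exists_tendsto (p := id)
    (hev.mono fun x hx => hx.2)
  exact ⟨u, (conv_const (U : Filter ℂ) K).mem_piece (p := id) hev hu, hu⟩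

theorem IsConfiguration.continuousOn {a : A} {h : ℂ → ℂ} (hh : K.IsConfiguration a h) :
    ContinuousOn h (K.G a) := by
  obtain ⟨U, H, -, hGU, hH, hEq⟩ := hh
  exact (hH.1.1.continuousOn.mono hGU).congr hEq

theorem exists_ne_mem_G (K : ConformalCantor B ε) (a : A) :
    ∃ x ∈ K.G a, ∃ y ∈ K.G a, x ≠ y := by
  have hne : (interior (K.G a)).Nonempty := by
    rw [← closure_nonempty_iff, K.regular_G]
    exact (K.isConnected_G a).nonempty
  obtain ⟨x, hx⟩ := hne
  obtain ⟨r, hr, hball⟩ := Metric.isOpen_iff.1 isOpen_interior x hx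
  refine ⟨x, interior_subset hx, x + (r / 2 : ℝ), interior_subset (hball ?_), ?_⟩
  · rw [mem_ball_iff_norm, add_sub_cancel_left, Complex.norm_real, Real.norm_eq_abs,
      abs_of_pos (half_pos hr)]
    exact half_lt_self hr
  · intro h
    have h1 : ((r / 2 : ℝ) : ℂ) = 0 := by simpa using h
    rw [Complex.ofReal_eq_zero] at h1
    linarith

/-! ### Renormalization of configurations close to limit geometries -/

/-- On the Cantor set of `M`, the map `j` is Lipschitz close to the affine configuration
`S ∘ k^θ`. -/
structure LipClose (r : ℝ) (M : ConformalCantor B ε) (d : A → ℂ) (θ : NegSeq B) (S : AffC)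
    (j : ℂ → ℂ) : Prop where
  lipschitz : ∀ u ∈ M.piece (θ.1 0), ∀ v ∈ M.piece (θ.1 0),
    ‖(j u - j v) - S.lin * (M.limGeom d θ u - M.limGeom d θ v)‖ ≤ r * ‖u - v‖
  base : ‖j (d (θ.1 0)) - S.tr‖ ≤ r

/-- Ensures that k^θ of `K` and the closeness of configurations, given only on interiors, are
available at the Cantor points of nearby sets. -/
theorem eventually_piece_subset [Finite A] (K : ConformalCantor B ε) (a : A) :
    ∀ᶠ M in K.nhdsCantor, ∀ u, u ∈ M.piece a → u ∈ interior (K.G a) := by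
  refine eventually_forall_of_ultrafilter fun U hU u hu => ?_
  have hM : Conv (U : Filter (ConformalCantor B ε)) id K := (conv_nhdsCantor K).mono hU
  obtain ⟨u₀, -, ht⟩ := hM.exists_tendsto (hu.mono fun i hi => hi.2)
  exact (ht.eventually (isOpen_interior.mem_nhds
    (piece_subset_interior (hM.mem_piece hu ht)))).frequently

/-- The limit geometries of Cantor sets close to `K` are Lipschitz close to those of `K`. -/
theorem eventually_limGeom_lipschitz [Finite A] (hε : 0 < ε) (hε₁ : ε ≤ 1) {c : A → ℂ}
    (hc : K.IsBase c) (θ : NegSeq B) {m : ℝ} (hm : 0 < m) :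
    ∀ᶠ p in K.nhdsBase c, ∀ x : ℂ × ℂ, (x.1 ∈ p.1.piece (θ.1 0) ∧ x.2 ∈ p.1.piece (θ.1 0)) →
      ‖(K.limGeom c θ x.1 - K.limGeom c θ x.2) -
        (p.1.limGeom p.2 θ x.1 - p.1.limGeom p.2 θ x.2)‖ ≤ m * ‖x.1 - x.2‖ := by
  obtain ⟨_, _, _, _, _, D, hD, q, hq, hq₁, _, hK, hev⟩ := exists_uniform hε hε₁ hc
  refine eventually_forall_of_ultrafilter fun U hU x hx => ?_
  rw [eventually_and] at hx
  obtain ⟨hx, hy⟩ := hx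
  have hM : Conv (U : Filter (ConformalCantor B ε × (A → ℂ))) (fun p => p.1) K :=
    (conv_nhdsBase K c).mono hU
  have hG : ∀ᶠ p in (U : Filter (ConformalCantor B ε × (A → ℂ))), p.1.Geom D q p.2 :=
    hU (hev.mono fun p hp => hp.2)
  have hd : ∀ a, Tendsto (fun p : ConformalCantor B ε × (A → ℂ) => p.2 a) U (𝓝 (c a)) :=
    fun a => (tendsto_nhdsBase K c a).mono_left hU
  have hsub := hM.eventually (eventually_piece_subset K (θ.1 0))
  have hxK : ∀ᶠ p in (U : Filter (ConformalCantor B ε × (A → ℂ))), (x p).1 ∈ K.G (θ.1 0) := by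
    filter_upwards [hx, hsub] with p h1 h2
    exact interior_subset (h2 _ h1)
  have hyK : ∀ᶠ p in (U : Filter (ConformalCantor B ε × (A → ℂ))), (x p).2 ∈ K.G (θ.1 0) := by
    filter_upwards [hy, hsub] with p h1 h2
    exact interior_subset (h2 _ h1)
  obtain ⟨u, -, hxu⟩ := hM.exists_tendsto (hx.mono fun i hi => hi.2)
  obtain ⟨v, -, hyv⟩ := hM.exists_tendsto (hy.mono fun i hi => hi.2)
  have hu : u ∈ K.piece (θ.1 0) := hM.mem_piece hx hxu
  have hv : v ∈ K.piece (θ.1 0) := hM.mem_piece hy hyv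
  have hθ : Tendsto (fun _ : ConformalCantor B ε × (A → ℂ) => θ) U (𝓝 θ) := tendsto_const_nhds
  have hconst := conv_const (U : Filter (ConformalCantor B ε × (A → ℂ))) K
  have hGK : ∀ᶠ p in (U : Filter (ConformalCantor B ε × (A → ℂ))), K.Geom D q c :=
    Eventually.of_forall fun _ => hK
  have hdK : ∀ a, Tendsto (fun _ : ConformalCantor B ε × (A → ℂ) => c a) U (𝓝 (c a)) :=
    fun a => tendsto_const_nhds
  refine Eventually.frequently ?_
  -- For a common limit both limit geometries are linearized, that of `K` at `u` and that of the
  -- nearby set at the point itself; the derivatives there converge. For distinct limits convergence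
  -- of the values is enough.
  by_cases huv : u = v
  · subst huv
    have hder := hM.tendsto_kDer hK hG hd hq.le hq₁ hθ hx hu hxu
    have hρ : Tendsto (fun p => max ‖(x p).1 - u‖ ‖(x p).2 - u‖) U (𝓝 0) := by
      simpa using (hxu.sub_const u).norm.max (hyv.sub_const u).norm
    have hρ' : Tendsto (fun p => ‖(x p).1 - (x p).2‖) U (𝓝 0) := by
      simpa using (hxu.sub hyv).norm
    have hsmall : Tendsto (fun p => D * (max ‖(x p).1 - u‖ ‖(x p).2 - u‖) ^ ε +
        D * ‖(x p).1 - (x p).2‖ ^ ε + ‖p.1.kDer p.2 θ (x p).1 - K.kDer c θ u‖) U (𝓝 0) := by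
      have h1 := ((hρ.rpow_const (Or.inr hε.le)).const_mul D).add
        ((hρ'.rpow_const (Or.inr hε.le)).const_mul D)
      have h2 := h1.add (hder.sub_const (K.kDer c θ u)).norm
      simpa [Real.zero_rpow hε.ne'] using h2
    filter_upwards [hG, hx, hy, hxK, hyK, hsmall.eventually (gt_mem_nhds hm)]
      with p hGp hxp hyp hxKp hyKp hs
    have h1 := hK.taylor θ u hu _ hxKp _ hyKp _ (le_max_left _ _) (le_max_right _ _)
    have h2 := hGp.taylor θ _ hxp _ hxp.2 _ hyp.2 ‖(x p).1 - (x p).2‖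
      (by rw [sub_self, norm_zero]; exact norm_nonneg _) (by rw [norm_sub_rev])
    have h3 : (K.limGeom c θ (x p).1 - K.limGeom c θ (x p).2) -
        (p.1.limGeom p.2 θ (x p).1 - p.1.limGeom p.2 θ (x p).2) =
        (K.limGeom c θ (x p).1 - K.limGeom c θ (x p).2 - K.kDer c θ u * ((x p).1 - (x p).2)) -
        (p.1.limGeom p.2 θ (x p).1 - p.1.limGeom p.2 θ (x p).2 -
          p.1.kDer p.2 θ (x p).1 * ((x p).1 - (x p).2)) -
        (p.1.kDer p.2 θ (x p).1 - K.kDer c θ u) * ((x p).1 - (x p).2) := by ring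
    rw [h3]
    refine (norm_sub_le _ _).trans ((add_le_add ((norm_sub_le _ _).trans (add_le_add h1 h2))
      (norm_mul_le _ _)).trans ?_)
    rw [← add_mul, ← add_mul]
    gcongr
  · have h1 := hM.tendsto_limGeom hK hG hd hq.le hq₁ hθ (hx.mono fun i hi => hi.2) hxu
    have h2 := hM.tendsto_limGeom hK hG hd hq.le hq₁ hθ (hy.mono fun i hi => hi.2) hyv
    have h3 := hconst.tendsto_limGeom hK hGK hdK hq.le hq₁ hθ hxK hxu
    have h4 := hconst.tendsto_limGeom hK hGK hdK hq.le hq₁ hθ hyK hyv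
    have h5 := ((h3.sub h4).sub (h1.sub h2)).norm
    rw [sub_self, norm_zero] at h5
    have h6 : Tendsto (fun p => m * ‖(x p).1 - (x p).2‖) U (𝓝 (m * ‖u - v‖)) :=
      (hxu.sub hyv).norm.const_mul m
    have hpos : 0 < m * ‖u - v‖ := mul_pos hm (norm_pos_iff.2 (sub_ne_zero.2 huv))
    filter_upwards [h5.eventually_lt h6 hpos] with p hp
    exact hp.le

/-- Configurations close to the affine configuration `S ∘ k^θ` of `K` are Lipschitz close to
the affine configuration `S ∘ k^θ` of Cantor sets close to `K`. -/
theorem exists_lipClose [Finite A] (hε : 0 < ε) (hε₁ : ε ≤ 1) {c : A → ℂ} (hc : K.IsBase c)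
    (S : AffC) (θ : NegSeq B) {r : ℝ} (hr : 0 < r) :
    ∃ δ > 0, ∀ᶠ p in K.nhdsBase c, ∀ j, C1HolderClose ε δ (fun z => S.app (K.limGeom c θ z)) j
      (interior (K.G (θ.1 0)) ∩ interior (p.1.G (θ.1 0))) → LipClose r p.1 p.2 θ S j := by
  obtain ⟨κ, hκ, hκ₁, C, hC, D, hD, q, hq, hq₁, _, hK, hev⟩ := exists_uniform hε hε₁ hc
  have hS : 0 < ‖(S.lin : ℂ)‖ := norm_pos_iff.2 S.lin.ne_zero
  -- Since `‖u - v‖ ^ ε ≤ C`, this makes the Lipschitz constant of the difference of the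
  -- configurations at most `r / 2`; the other half is left for the difference of the limit
  -- geometries.
  refine ⟨r / (2 * (1 + C)), by positivity, ?_⟩
  have hbase : ∀ᶠ p in K.nhdsBase c,
      ‖p.2 (θ.1 0) - c (θ.1 0)‖ < r / (2 * (‖(S.lin : ℂ)‖ * D)) := by
    filter_upwards [Metric.tendsto_nhds.1 (tendsto_nhdsBase K c (θ.1 0)) _
      (show 0 < r / (2 * (‖(S.lin : ℂ)‖ * D)) by positivity)] with p hp
    rwa [← dist_eq_norm]
  filter_upwards [hev, (conv_nhdsBase K c).eventually (eventually_piece_subset K (θ.1 0)),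
    eventually_limGeom_lipschitz hε hε₁ hc θ (show 0 < r / (2 * ‖(S.lin : ℂ)‖) by positivity),
    hbase] with p hp hsub hlip hpb j hj
  have hmem : ∀ u ∈ p.1.piece (θ.1 0), u ∈ interior (K.G (θ.1 0)) ∩ interior (p.1.G (θ.1 0)) :=
    fun u hu => ⟨hsub u hu, piece_subset_interior hu⟩
  have hCε : C ^ ε ≤ C := by simpa using Real.rpow_le_rpow_of_exponent_le hC hε₁
  constructor
  · intro u hu v hv
    have h1 := hj.norm_sub_le hε (hmem u hu) (hmem v hv)
    have h2 := hlip (u, v) ⟨hu, hv⟩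
    have h3 : ‖u - v‖ ^ ε ≤ C := by
      refine le_trans ?_ hCε
      gcongr
      exact hp.1.diam _ _ hu.2 _ hv.2
    have h4 : (j u - j v) - S.lin * (p.1.limGeom p.2 θ u - p.1.limGeom p.2 θ v) =
        S.lin * ((K.limGeom c θ u - K.limGeom c θ v) -
          (p.1.limGeom p.2 θ u - p.1.limGeom p.2 θ v)) -
        ((S.app (K.limGeom c θ u) - j u) - (S.app (K.limGeom c θ v) - j v)) := by
      simp only [AffC.app]; ring
    rw [h4]
    refine (norm_sub_le _ _).trans ?_
    rw [norm_mul]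
    have h5 : ‖(S.lin : ℂ)‖ * ‖(K.limGeom c θ u - K.limGeom c θ v) -
        (p.1.limGeom p.2 θ u - p.1.limGeom p.2 θ v)‖ ≤ r / 2 * ‖u - v‖ := by
      calc _ ≤ ‖(S.lin : ℂ)‖ * (r / (2 * ‖(S.lin : ℂ)‖) * ‖u - v‖) := by gcongr
        _ = _ := by field_simp
    have h6 : r / (2 * (1 + C)) * (1 + ‖u - v‖ ^ ε) * ‖u - v‖ ≤ r / 2 * ‖u - v‖ := by
      calc _ ≤ r / (2 * (1 + C)) * (1 + C) * ‖u - v‖ := by gcongr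
        _ = _ := by field_simp
    linarith
  · have hb := hp.2.base (θ.1 0)
    have h1 := hj.1 _ (hmem _ hb)
    have h2 := hK.norm_sub_le θ _ (interior_subset (hsub _ hb)) _ (hc _).2
    rw [hK.limGeom_base θ, sub_zero] at h2
    have h3 : j (p.2 (θ.1 0)) - S.tr = S.lin * K.limGeom c θ (p.2 (θ.1 0)) -
        (S.app (K.limGeom c θ (p.2 (θ.1 0))) - j (p.2 (θ.1 0))) := by
      simp only [AffC.app]; ring
    rw [h3]
    refine (norm_sub_le _ _).trans ?_
    rw [norm_mul]
    have h4 : ‖(S.lin : ℂ)‖ * ‖K.limGeom c θ (p.2 (θ.1 0))‖ ≤ r / 2 := by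
      calc _ ≤ ‖(S.lin : ℂ)‖ * (D * (r / (2 * (‖(S.lin : ℂ)‖ * D)))) := by
            gcongr
            exact h2.trans (by gcongr)
        _ = _ := by field_simp
    have h5 : r / (2 * (1 + C)) ≤ r / 2 := by
      gcongr
      linarith
    linarith

/-- The affine configuration `S' ∘ k^η` approximates the restriction of the configuration `j` to
the piece of the Cantor set for the last `k` letters of `η`. -/
structure Approximates (M : ConformalCantor B ε) (d : A → ℂ) (θ : NegSeq B) (S : AffC)
    (j : ℂ → ℂ) (k : ℕ) (S' : AffC) (η : NegSeq B) : Prop where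
  word : η.1 k = θ.1 0
  tr : S'.tr = j (M.fWord η k (d (η.1 0)))
  lin : ∃ ρ : ℂ, (S'.lin : ℂ) = S.lin * ρ ∧ ∀ x ∈ M.G (η.1 0),
    ρ * M.limGeom d η x = M.limGeom d θ (M.fWord η k x) - M.limGeom d θ (M.fWord η k (d (η.1 0)))

variable {d : A → ℂ} {θ : NegSeq B} {S : AffC} {j : ℂ → ℂ} {D q : ℝ}

theorem Geom.approximates_zero (hG : M.Geom D q d) :
    M.Approximates d θ S j 0 ⟨S.lin, j (d (θ.1 0))⟩ θ where
  word := rfl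
  tr := rfl
  lin := ⟨1, by rw [mul_one], fun x _ => by
    change 1 * M.limGeom d θ x = M.limGeom d θ x - M.limGeom d θ (d (θ.1 0))
    rw [hG.limGeom_base, sub_zero, one_mul]⟩

/-- A renormalization step up to a small translation. -/
theorem Approximates.step {k : ℕ} {S' : AffC} {η : NegSeq B}
    (h : M.Approximates d θ S j k S' η) (hG : M.Geom D q d) {r C : ℝ} (hD : 0 ≤ D) (hr : 0 ≤ r)
    (hC : ∀ a, ∀ x ∈ M.G a, ∀ y ∈ M.G a, ‖x - y‖ ≤ C) (hj : LipClose r M d θ S j) {b : A}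
    (hb : B (η.1 0) b) :
    ∃ t : ℂ, ‖t‖ ≤ r * D * D * C / ‖(S.lin : ℂ)‖ ∧
      M.Approximates d θ S j (k + 1) (S' * ⟨(M.fam d η b).lin, (M.fam d η b).tr + t⟩)
        (η.ext' b) := by
  obtain ⟨ρ, hρ, hx⟩ := h.lin
  have hS : (S.lin : ℂ) ≠ 0 := S.lin.ne_zero
  have hS' : (S'.lin : ℂ) ≠ 0 := S'.lin.ne_zero
  have hρ0 : ρ ≠ 0 := by
    rintro rfl
    exact hS' (by rw [hρ, mul_zero])
  have hpb := branch_mem_piece hb (hG.base b)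
  obtain ⟨-, -, htr⟩ := hG.tendsto_phi η hb
  set p := M.branch (η.1 0) (d b)
  set F := M.fam d η b
  have hword : ∀ x, M.fWord (η.ext' b) (k + 1) x = M.fWord η k (M.branch (η.1 0) x) := by
    intro x
    rw [NegSeq.ext'_eq hb, fWord_snoc]
  have hb0 : (η.ext' b).1 0 = b := by rw [NegSeq.ext'_eq hb]; rfl
  have hfp : M.fWord η k p ∈ M.piece (θ.1 0) := h.word ▸ fWord_mem_piece η k hpb
  have hfd : M.fWord η k (d (η.1 0)) ∈ M.piece (θ.1 0) :=
    h.word ▸ fWord_mem_piece η k (hG.base _)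
  have hxp := hx p hpb.2
  -- The translation `t` is the one that makes the new translation part exactly a value of `j`, so
  -- errors do not accumulate. The error of `j` is at most `r` times the distance of two points of
  -- the cylinder, which is of order `‖ρ‖`. Dividing by `‖S'.lin‖ = ‖S.lin‖ * ‖ρ‖` leaves a bound
  -- independent of the depth.
  refine ⟨((j (M.fWord η k p) - S'.tr) - S'.lin * M.limGeom d η p) / S'.lin, ?_, ?_, ?_, ?_⟩
  · rw [h.tr, hρ, mul_assoc, hxp, norm_div, norm_mul,
      div_le_div_iff₀ (by positivity) (by positivity)]
    have h1 := hj.lipschitz _ hfp _ hfd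
    have h2 := hG.le_norm_sub θ _ hfp.2 _ hfd.2
    rw [← hxp, norm_mul] at h2
    have h3 := hG.norm_sub_le η p hpb.2 _ (hG.base (η.1 0)).2
    rw [hG.limGeom_base η, sub_zero] at h3
    have h4 := hC _ p hpb.2 _ (hG.base (η.1 0)).2
    calc _ ≤ r * (D * (‖ρ‖ * (D * C))) * ‖(S.lin : ℂ)‖ := by
          gcongr
          refine h1.trans ?_
          gcongr
          refine h2.trans ?_
          gcongr
          exact h3.trans (by gcongr)
      _ = _ := by ring
  · rw [NegSeq.ext'_eq hb]
    exact h.word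
  · rw [hb0, hword, AffC.mul_tr]
    change (S'.lin : ℂ) * (F.tr + _) + S'.tr = _
    rw [htr]
    field_simp
    ring
  · refine ⟨ρ * F.lin, ?_, fun x hxG => ?_⟩
    · rw [AffC.mul_lin, Units.val_mul, hρ, mul_assoc]
    · rw [hb0] at hxG ⊢
      have h1 := hG.fam_app η hb hxG
      rw [AffC.app, htr] at h1
      rw [hword, hword, mul_assoc, eq_sub_of_add_eq h1, mul_sub, hx _ (branch_mem hb hxG), hxp]
      ring

/-- ρ compares the sizes of a cylinder of depth `k` and of a whole piece, as seen by limit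
geometries with bi-Lipschitz constant `D`. Two distinct points of the piece suffice to measure it.
-/
theorem Approximates.norm_lin_le {k : ℕ} {S' : AffC} {η : NegSeq B}
    (h : M.Approximates d θ S j k S' η) (hG : M.Geom D q d) (hD : 0 ≤ D) {κ C : ℝ}
    (hT : M.Tame κ C) : ‖(S'.lin : ℂ)‖ ≤ ‖(S.lin : ℂ)‖ * (D * D * C) * κ ^ k := by
  obtain ⟨ρ, hρ, hx⟩ := h.lin
  obtain ⟨x, hxG, y, hyG, hxy⟩ := M.exists_ne_mem_G (η.1 0)
  have hpos : 0 < ‖x - y‖ := norm_pos_iff.2 (sub_ne_zero.2 hxy)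
  have h1 : ρ * (M.limGeom d η x - M.limGeom d η y) =
      M.limGeom d θ (M.fWord η k x) - M.limGeom d θ (M.fWord η k y) := by
    rw [mul_sub, hx x hxG, hx y hyG]; ring
  have h2 := hG.norm_sub_le θ _ (h.word ▸ fWord_mem η k hxG) _ (h.word ▸ fWord_mem η k hyG)
  rw [← h1, norm_mul] at h2
  have h3 := hG.le_norm_sub η x hxG y hyG
  have h4 := hT.norm_fWord_sub_le η k hxG hyG
  have h5 : ‖ρ‖ * ‖x - y‖ ≤ D * D * C * κ ^ k * ‖x - y‖ := by
    calc ‖ρ‖ * ‖x - y‖ ≤ ‖ρ‖ * (D * ‖M.limGeom d η x - M.limGeom d η y‖) := by gcongr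
      _ = D * (‖ρ‖ * ‖M.limGeom d η x - M.limGeom d η y‖) := by ring
      _ ≤ D * (D * (C * κ ^ k * ‖x - y‖)) := mul_le_mul_of_nonneg_left (h2.trans (by gcongr)) hD
      _ = _ := by ring
  rw [hρ, norm_mul, mul_assoc]
  gcongr
  exact le_of_mul_le_mul_right h5 hpos

end ConformalCantor

end ConfCantor

/-! ### Stable intersections -/

namespace ConfCantor

variable {A₁ A₂ : Type*} {B₁ : A₁ → A₁ → Prop} {B₂ : A₂ → A₂ → Prop} {ε : ℝ}

open ConformalCantor

/-- A family which differs from `F` by translations. -/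
def translateFam {A : Type*} {B : A → A → Prop} (F : NegSeq B → A → AffC) (t : A → ℂ) :
    NegSeq B → A → AffC := fun θ b => ⟨(F θ b).lin, (F θ b).tr + t b⟩

theorem FamClose.translate {A : Type*} {B : A → A → Prop} {F₀ F : NegSeq B → A → AffC} {m : ℝ}
    (h : FamClose (m / 2) F₀ F) (hm : 0 ≤ m) {t : A → ℂ} (ht : ∀ b, ‖t b‖ ≤ m / 2) :
    FamClose m F₀ (translateFam F t) := by
  intro θ b hb
  refine ⟨(h θ b hb).1.trans (by linarith), ?_⟩
  have h1 : (translateFam F t θ b).tr - (F₀ θ b).tr = ((F θ b).tr - (F₀ θ b).tr) + t b := by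
    simp only [translateFam]; ring
  rw [h1]
  exact (norm_add_le _ _).trans (by linarith [(h θ b hb).2, ht b])

/-- The corrections for all letters are collected in one `t`, so that the next step belongs to a
single perturbed family, whatever letter recurrence selects. -/
theorem ConformalCantor.Approximates.exists_translations {A : Type*} {B : A → A → Prop}
    {M : ConformalCantor B ε} {d : A → ℂ} {θ : NegSeq B} {S : AffC} {j : ℂ → ℂ} {D q : ℝ} {k : ℕ}
    {S' : AffC} {η : NegSeq B} (h : M.Approximates d θ S j k S' η) (hG : M.Geom D q d) {r C m : ℝ}
    (hD : 0 ≤ D) (hr : 0 ≤ r) (hC : ∀ a, ∀ x ∈ M.G a, ∀ y ∈ M.G a, ‖x - y‖ ≤ C)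
    (hj : LipClose r M d θ S j) (hm : 0 ≤ m) (hrm : r * D * D * C / ‖(S.lin : ℂ)‖ ≤ m) :
    ∃ t : A → ℂ, (∀ b, ‖t b‖ ≤ m) ∧ ∀ b, B (η.1 0) b →
      M.Approximates d θ S j (k + 1) (S' * translateFam (M.fam d) t η b) (η.ext' b) := by
  have : ∀ b, ∃ t : ℂ, ‖t‖ ≤ m ∧ (B (η.1 0) b → M.Approximates d θ S j (k + 1)
      (S' * ⟨(M.fam d η b).lin, (M.fam d η b).tr + t⟩) (η.ext' b)) := by
    intro b
    by_cases hb : B (η.1 0) b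
    · obtain ⟨t, ht, h'⟩ := h.step hG hD hr hC hj hb
      exact ⟨t, ht.trans hrm, fun _ => h'⟩
    · exact ⟨0, by rwa [norm_zero], fun h' => absurd h' hb⟩
  choose t ht h' using this
  exact ⟨t, ht, h'⟩

/-- Two configurations which can be renormalized indefinitely within a compact set of relative
configurations intersect. -/
theorem nonempty_inter_of_approximates [Finite A₁] [Finite A₂] {M₁ : ConformalCantor B₁ ε}
    {M₂ : ConformalCantor B₂ ε} {d₁ : A₁ → ℂ} {d₂ : A₂ → ℂ} {θ₁ : NegSeq B₁} {θ₂ : NegSeq B₂}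
    {S₁ S₂ : AffC} {j₁ j₂ : ℂ → ℂ} {D₁ q₁ κ₁ C₁ D₂ q₂ κ₂ C₂ : ℝ} (hG₁ : M₁.Geom D₁ q₁ d₁)
    (hG₂ : M₂.Geom D₂ q₂ d₂) (hT₁ : M₁.Tame κ₁ C₁) (hT₂ : M₂.Tame κ₂ C₂) (hD₁ : 0 ≤ D₁)
    (hD₂ : 0 ≤ D₂) (hC₁ : 0 ≤ C₁) (hC₂ : 0 ≤ C₂) (hκ₁ : 0 < κ₁) (hκ₁' : κ₁ < 1)
    (hκ₂ : 0 < κ₂) (hκ₂' : κ₂ < 1) (hj₁ : M₁.IsConfiguration (θ₁.1 0) j₁)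
    (hj₂ : M₂.IsConfiguration (θ₂.1 0) j₂) {L : Set (AffC × NegSeq B₁ × NegSeq B₂)}
    (hL : IsCompact L)
    (h : ∀ n : ℕ, ∃ k₁ k₂ T₁ T₂ η₁ η₂, k₁ + k₂ = n ∧ M₁.Approximates d₁ θ₁ S₁ j₁ k₁ T₁ η₁ ∧
      M₂.Approximates d₂ θ₂ S₂ j₂ k₂ T₂ η₂ ∧ (T₁⁻¹ * T₂, η₁, η₂) ∈ L) :
    ((j₁ '' M₁.piece (θ₁.1 0)) ∩ (j₂ '' M₂.piece (θ₂.1 0))).Nonempty := by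
  obtain ⟨R, hR⟩ := hL.exists_bound_of_continuousOn (f := fun x => x.1.tr)
    (AffC.continuous_tr.comp continuous_fst).continuousOn
  obtain ⟨R', hR'⟩ := hL.exists_bound_of_continuousOn (f := fun x => ((x.1.lin⁻¹ : ℂˣ) : ℂ))
    (Units.continuous_val.comp
      (AffC.continuous_lin.comp continuous_fst).inv).continuousOn
  set κ := max κ₁ κ₂
  have hκ0 : 0 < κ := hκ₁.trans_le (le_max_left _ _)
  have hκ1 : κ < 1 := max_lt hκ₁' hκ₂'
  set E₁ := ‖(S₁.lin : ℂ)‖ * (D₁ * D₁ * C₁)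
  set E₂ := ‖(S₂.lin : ℂ)‖ * (D₂ * D₂ * C₂)
  have hE₁ : 0 ≤ E₁ := by positivity
  have hE₂ : 0 ≤ E₂ := by positivity
  -- Only `k₁ + k₂ = n` is known, so one of the two words may stay short. As `T₁⁻¹ * T₂` lies in a
  -- compact set, the linear parts are comparable. Bounding `‖T₁.lin‖ ^ 2` by the product of the
  -- estimates for the two words brings in both exponents; hence the square.
  have hex : ∀ n : ℕ, ∃ u v, u ∈ M₁.piece (θ₁.1 0) ∧ v ∈ M₂.piece (θ₂.1 0) ∧
      ‖j₁ u - j₂ v‖ ^ 2 ≤ R ^ 2 * (R' * E₁ * E₂) * κ ^ n := by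
    intro n
    obtain ⟨k₁, k₂, T₁, T₂, η₁, η₂, hk, h₁, h₂, hmem⟩ := h n
    refine ⟨M₁.fWord η₁ k₁ (d₁ (η₁.1 0)), M₂.fWord η₂ k₂ (d₂ (η₂.1 0)),
      h₁.word ▸ fWord_mem_piece η₁ k₁ (hG₁.base _),
      h₂.word ▸ fWord_mem_piece η₂ k₂ (hG₂.base _), ?_⟩
    rw [← h₁.tr, ← h₂.tr]
    have hT0 : (T₁.lin : ℂ) ≠ 0 := T₁.lin.ne_zero
    have hT0' : (T₂.lin : ℂ) ≠ 0 := T₂.lin.ne_zero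
    have htr : T₁.tr - T₂.tr = -(T₁.lin * (T₁⁻¹ * T₂).tr) := by
      rw [AffC.mul_tr, AffC.inv_tr, AffC.inv_lin, Units.val_inv_eq_inv_val]
      field_simp
      ring
    have hlin : (T₁.lin : ℂ) = T₂.lin * ((T₁⁻¹ * T₂).lin⁻¹ : ℂˣ) := by
      rw [AffC.mul_lin, AffC.inv_lin, mul_inv, inv_inv, Units.val_mul, Units.val_inv_eq_inv_val]
      field_simp
    have hb1 := hR _ hmem
    have hb2 := hR' _ hmem
    have hR0 : 0 ≤ R := (norm_nonneg _).trans hb1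
    have hR0' : 0 ≤ R' := (norm_nonneg _).trans hb2
    have hn1 : ‖(T₁.lin : ℂ)‖ ≤ E₁ * κ ^ k₁ :=
      (h₁.norm_lin_le hG₁ hD₁ hT₁).trans (by gcongr; exact le_max_left _ _)
    have hn2 : ‖(T₁.lin : ℂ)‖ ≤ E₂ * κ ^ k₂ * R' := by
      rw [hlin, norm_mul]
      gcongr
      exact (h₂.norm_lin_le hG₂ hD₂ hT₂).trans (by gcongr; exact le_max_right _ _)
    rw [htr, norm_neg, norm_mul, mul_pow, sq ‖(T₁.lin : ℂ)‖]
    calc _ ≤ (E₁ * κ ^ k₁) * (E₂ * κ ^ k₂ * R') * R ^ 2 := by gcongr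
      _ = R ^ 2 * (R' * E₁ * E₂) * κ ^ n := by rw [← hk, pow_add]; ring
  choose u v hu hv huv using hex
  have hlim : Tendsto (fun n => j₁ (u n) - j₂ (v n)) atTop (𝓝 0) := by
    have h1 : Tendsto (fun n => R ^ 2 * (R' * E₁ * E₂) * κ ^ n) atTop (𝓝 0) := by
      simpa using (tendsto_pow_atTop_nhds_zero_of_lt_one hκ0.le hκ1).const_mul _
    have h2 : Tendsto (fun n => ‖j₁ (u n) - j₂ (v n)‖ ^ 2) atTop (𝓝 0) :=
      squeeze_zero (fun n => by positivity) huv h1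
    have h3 := h2.sqrt
    simp only [Real.sqrt_sq (norm_nonneg _), Real.sqrt_zero] at h3
    exact tendsto_zero_iff_norm_tendsto_zero.2 h3
  obtain ⟨x, hx, φ, hφ, hφx⟩ := (M₁.isCompact_piece (θ₁.1 0)).tendsto_subseq hu
  obtain ⟨y, hy, ψ, hψ, hψy⟩ := (M₂.isCompact_piece (θ₂.1 0)).tendsto_subseq
    (x := fun n => v (φ n)) fun n => hv _
  have h1 : Tendsto (fun n => j₁ (u (φ (ψ n)))) atTop (𝓝 (j₁ x)) :=
    (hj₁.continuousOn x hx.2).tendsto.comp (tendsto_nhdsWithin_iff.2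
      ⟨hφx.comp hψ.tendsto_atTop, Eventually.of_forall fun n => (hu _).2⟩)
  have h2 : Tendsto (fun n => j₂ (v (φ (ψ n)))) atTop (𝓝 (j₂ y)) :=
    (hj₂.continuousOn y hy.2).tendsto.comp (tendsto_nhdsWithin_iff.2
      ⟨hψy, Eventually.of_forall fun n => (hv _).2⟩)
  have h3 := tendsto_nhds_unique (h1.sub h2)
    (hlim.comp (hφ.tendsto_atTop.comp hψ.tendsto_atTop))
  exact ⟨j₁ x, ⟨x, hx, rfl⟩, y, hy, (sub_eq_zero.1 h3).symm⟩

section Renormalization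

variable {M₁ : ConformalCantor B₁ ε} {M₂ : ConformalCantor B₂ ε} {d₁ : A₁ → ℂ} {d₂ : A₂ → ℂ}
  {θ₁ : NegSeq B₁} {θ₂ : NegSeq B₂} {S₁ S₂ : AffC} {j₁ j₂ : ℂ → ℂ}
  {D₁ q₁ κ₁ C₁ D₂ q₂ κ₂ C₂ : ℝ}

/-- Pairs of configurations which are close to an element of a compact set with the immediate
recurrence property can be renormalized indefinitely within the compact set. -/
theorem exists_approximates (hG₁ : M₁.Geom D₁ q₁ d₁) (hG₂ : M₂.Geom D₂ q₂ d₂)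
    (hT₁ : M₁.Tame κ₁ C₁) (hT₂ : M₂.Tame κ₂ C₂) (hD₁ : 0 ≤ D₁) (hD₂ : 0 ≤ D₂) {r m : ℝ}
    (hr : 0 ≤ r) (hm : 0 ≤ m) (hr₁ : r * D₁ * D₁ * C₁ / ‖(S₁.lin : ℂ)‖ ≤ m)
    (hr₂ : r * D₂ * D₂ * C₂ / ‖(S₂.lin : ℂ)‖ ≤ m) (hj₁ : LipClose r M₁ d₁ θ₁ S₁ j₁)
    (hj₂ : LipClose r M₂ d₂ θ₂ S₂ j₂) {L : Set (AffC × NegSeq B₁ × NegSeq B₂)}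
    (hL : ∀ t₁ t₂, (∀ b, ‖t₁ b‖ ≤ m) → (∀ b, ‖t₂ b‖ ≤ m) → ∀ x ∈ L, ∃ y ∈ L,
      Step (translateFam (M₁.fam d₁) t₁, translateFam (M₂.fam d₂) t₂) x y)
    (h₀ : ((⟨S₁.lin, j₁ (d₁ (θ₁.1 0))⟩ : AffC)⁻¹ * ⟨S₂.lin, j₂ (d₂ (θ₂.1 0))⟩, θ₁, θ₂) ∈ L)
    (n : ℕ) :
    ∃ k₁ k₂ T₁ T₂ η₁ η₂, k₁ + k₂ = n ∧ M₁.Approximates d₁ θ₁ S₁ j₁ k₁ T₁ η₁ ∧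
      M₂.Approximates d₂ θ₂ S₂ j₂ k₂ T₂ η₂ ∧ (T₁⁻¹ * T₂, η₁, η₂) ∈ L := by
  induction n with
  | zero => exact ⟨0, 0, _, _, θ₁, θ₂, rfl, hG₁.approximates_zero, hG₂.approximates_zero, h₀⟩
  | succ n ih =>
    obtain ⟨k₁, k₂, T₁, T₂, η₁, η₂, hk, h₁, h₂, hmem⟩ := ih
    obtain ⟨t₁, ht₁, ha₁⟩ := h₁.exists_translations hG₁ hD₁ hr hT₁.diam hj₁ hm hr₁
    obtain ⟨t₂, ht₂, ha₂⟩ := h₂.exists_translations hG₂ hD₂ hr hT₂.diam hj₂ hm hr₂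
    -- The translations depend on the current stage, so the perturbed families change from step to
    -- step. This is why one-step recurrence for all small translations is required.
    obtain ⟨y, hy, ⟨b, hb, rfl⟩ | ⟨b, hb, rfl⟩⟩ := hL t₁ t₂ ht₁ ht₂ _ hmem
    · refine ⟨k₁ + 1, k₂, _, T₂, _, η₂, by omega, ha₁ b hb, h₂, ?_⟩
      rw [mul_inv_rev, mul_assoc]
      exact hy
    · refine ⟨k₁, k₂ + 1, T₁, _, η₁, _, by omega, h₁, ha₂ b hb, ?_⟩
      rw [← mul_assoc]
      exact hy

end Renormalization

/-- Configurations obtained by small changes of the translation parts stay in an open set. -/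
theorem exists_translations_mem {S₁ S₂ : AffC} {θ₁ : NegSeq B₁} {θ₂ : NegSeq B₂}
    {O : Set (AffC × NegSeq B₁ × NegSeq B₂)} (hO : IsOpen O) (h : (S₁⁻¹ * S₂, θ₁, θ₂) ∈ O) :
    ∃ s > 0, ∀ u v : ℂ, ‖u - S₁.tr‖ < s → ‖v - S₂.tr‖ < s →
      ((⟨S₁.lin, u⟩ : AffC)⁻¹ * ⟨S₂.lin, v⟩, θ₁, θ₂) ∈ O := by
  have h1 : Continuous fun τ : ℂ × ℂ => (⟨S₁.lin, τ.1⟩ : AffC) :=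
    AffC.continuous_iff.2 ⟨continuous_const, continuous_fst⟩
  have h2 : Continuous fun τ : ℂ × ℂ => (⟨S₂.lin, τ.2⟩ : AffC) :=
    AffC.continuous_iff.2 ⟨continuous_const, continuous_snd⟩
  have hopen : IsOpen {τ : ℂ × ℂ |
      ((⟨S₁.lin, τ.1⟩ : AffC)⁻¹ * ⟨S₂.lin, τ.2⟩, θ₁, θ₂) ∈ O} :=
    hO.preimage ((h1.inv.mul h2).prodMk continuous_const)
  obtain ⟨s, hs, hsX⟩ := Metric.isOpen_iff.1 hopen (S₁.tr, S₂.tr) h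
  refine ⟨s, hs, fun u v hu hv => ?_⟩
  have hmem : (u, v) ∈ Metric.ball (S₁.tr, S₂.tr) s := by
    rw [Metric.mem_ball, Prod.dist_eq, max_lt_iff, dist_eq_norm, dist_eq_norm]
    exact ⟨hu, hv⟩
  exact hsX hmem

variable [Finite A₁] [Finite A₂] {K₁ : ConformalCantor B₁ ε} {K₂ : ConformalCantor B₂ ε}
  {c₁ : A₁ → ℂ} {c₂ : A₂ → ℂ}

/-- The elements of a recurrent compact set have stable intersections. -/
theorem IsRecurrent.hasStableIntersections (hε : 0 < ε) (hε₁ : ε ≤ 1) (hc₁ : K₁.IsBase c₁)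
    (hc₂ : K₂.IsBase c₂) {L : Set (RelConf B₁ B₂)} (hL : IsRecurrent K₁ c₁ K₂ c₂ L)
    {S₁ S₂ : AffC} {θ₁ : NegSeq B₁} {θ₂ : NegSeq B₂}
    (hmem : RelConf.mk (S₁, θ₁) (S₂, θ₂) ∈ L) :
    HasStableIntersections K₁ K₂ (θ₁.1 0) (θ₂.1 0) (fun z => S₁.app (K₁.limGeom c₁ θ₁ z))
      (fun z => S₂.app (K₂.limGeom c₂ θ₂ z)) := by
  -- The enlarged set returns in one step, and its interior contains the given element. This leaves
  -- room for the initial displacement of the translation parts.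
  obtain ⟨L', hL', hLL'⟩ := hL.exists_isImmediatelyRecurrent hε hε₁ hc₁ hc₂
  rw [isImmediatelyRecurrent_iff] at hL'
  have hx₀ := mem_image_of_mem (RelConf.homeo B₁ B₂) (hLL' hmem)
  rw [(RelConf.homeo B₁ B₂).image_interior, RelConf.homeo_mk] at hx₀
  set X := RelConf.homeo B₁ B₂ '' L'
  have hF₁ := continuousAt_fam hε hε₁ hc₁
  have hF₂ := continuousAt_fam hε hε₁ hc₂
  -- The tolerance `m` is split in halves: one for the change of the Cantor sets and base points,
  -- one for the translations that correct for the configurations.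
  obtain ⟨m, hm, hreach⟩ := exists_famClose_reach (F₀ := (K₁.fam c₁, K₂.fam c₂)) hF₁ hF₂
    isOpen_interior hL'.1 hL'.2
  obtain ⟨s, hs, hsX⟩ := exists_translations_mem isOpen_interior hx₀
  obtain ⟨κ₁, hκ₁, hκ₁', C₁, hC₁, D₁, hD₁, q₁, -, -, -, -, hev₁⟩ := exists_uniform hε hε₁ hc₁
  obtain ⟨κ₂, hκ₂, hκ₂', C₂, hC₂, D₂, hD₂, q₂, -, -, -, -, hev₂⟩ := exists_uniform hε hε₁ hc₂
  have hsmall : ∀ᶠ r in 𝓝[>] (0 : ℝ), 0 < r ∧ r < s ∧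
      r * D₁ * D₁ * C₁ / ‖(S₁.lin : ℂ)‖ < m / 2 ∧ r * D₂ * D₂ * C₂ / ‖(S₂.lin : ℂ)‖ < m / 2 := by
    have hid : Tendsto (fun r : ℝ => r) (𝓝[>] 0) (𝓝 0) := nhdsWithin_le_nhds
    have h1 := (((hid.mul_const D₁).mul_const D₁).mul_const C₁).div_const ‖(S₁.lin : ℂ)‖
    have h2 := (((hid.mul_const D₂).mul_const D₂).mul_const C₂).div_const ‖(S₂.lin : ℂ)‖
    simp only [zero_mul, zero_div] at h1 h2
    filter_upwards [self_mem_nhdsWithin, hid.eventually (gt_mem_nhds hs),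
      h1.eventually (gt_mem_nhds (half_pos hm)), h2.eventually (gt_mem_nhds (half_pos hm))]
      with r h1 h2 h3 h4
    exact ⟨h1, h2, h3, h4⟩
  obtain ⟨r, hr, hrs, hrm₁, hrm₂⟩ := hsmall.exists
  obtain ⟨δ₁, hδ₁, hlip₁⟩ := exists_lipClose hε hε₁ hc₁ S₁ θ₁ hr
  obtain ⟨δ₂, hδ₂, hlip₂⟩ := exists_lipClose hε hε₁ hc₂ S₂ θ₂ hr
  have hall₁ := hev₁.and (hlip₁.and
    ((famTendsto_fam hε hε₁ hc₁).eventually_famClose hF₁ (half_pos hm)))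
  have hall₂ := hev₂.and (hlip₂.and
    ((famTendsto_fam hε hε₁ hc₂).eventually_famClose hF₂ (half_pos hm)))
  obtain ⟨δ₁', hδ₁', hnear₁⟩ := eventually_nhdsBase hε hε₁ hc₁ hall₁ one_pos
  obtain ⟨δ₂', hδ₂', hnear₂⟩ := eventually_nhdsBase hε hε₁ hc₂ hall₂ one_pos
  refine ⟨min (min δ₁ δ₂) (min δ₁' δ₂'), by positivity, ?_⟩
  intro M₁ M₂ hM₁ hM₂ j₁ j₂ hj₁ hj₂ hclose₁ hclose₂
  obtain ⟨d₁, -, -, ⟨hT₁, hG₁⟩, hl₁, hfam₁⟩ :=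
    hnear₁ M₁ (hM₁.mono ((min_le_right _ _).trans (min_le_left _ _)))
  obtain ⟨d₂, -, -, ⟨hT₂, hG₂⟩, hl₂, hfam₂⟩ :=
    hnear₂ M₂ (hM₂.mono ((min_le_right _ _).trans (min_le_right _ _)))
  have hlc₁ := hl₁ j₁ (C1HolderClose.mono' ((min_le_left _ _).trans (min_le_left _ _)) hclose₁)
  have hlc₂ := hl₂ j₂ (C1HolderClose.mono' ((min_le_left _ _).trans (min_le_right _ _)) hclose₂)
  refine nonempty_inter_of_approximates hG₁ hG₂ hT₁ hT₂ hD₁.le hD₂.le (by linarith) (by linarith)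
    hκ₁ hκ₁' hκ₂ hκ₂' hj₁ hj₂ hL'.1 (exists_approximates hG₁ hG₂ hT₁ hT₂ hD₁.le hD₂.le hr.le
      (half_pos hm).le hrm₁.le hrm₂.le hlc₁ hlc₂ ?_ ?_)
  · intro t₁ t₂ ht₁ ht₂ x hx
    obtain ⟨y, hy, hxy⟩ := hreach (translateFam (M₁.fam d₁) t₁, translateFam (M₂.fam d₂) t₂)
      (hfam₁.translate hm.le ht₁) (hfam₂.translate hm.le ht₂) x hx
    exact ⟨y, interior_subset hy, hxy⟩
  · exact interior_subset (hsX _ _ (hlc₁.base.trans_lt hrs) (hlc₂.base.trans_lt hrs))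

end ConfCantor

theorem theoremB {A₁ A₂ : Type*} [Finite A₁] [Finite A₂]
    (B₁ : A₁ → A₁ → Prop) (B₂ : A₂ → A₂ → Prop)
    (hB₁ : ConfCantor.IsTopMixing B₁) (hB₂ : ConfCantor.IsTopMixing B₂)
    (ε : ℝ) (hε₀ : 0 < ε) (hε₁ : ε ≤ 1)
    (K₁ : ConfCantor.ConformalCantor B₁ ε) (K₂ : ConfCantor.ConformalCantor B₂ ε)
    (c₁ : A₁ → ℂ) (c₂ : A₂ → ℂ) (hc₁ : K₁.IsBase c₁) (hc₂ : K₂.IsBase c₂) :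
    -- (1) every recurrent compact set lies in an immediately recurrent one
    (∀ L : Set (ConfCantor.RelConf B₁ B₂), ConfCantor.IsRecurrent K₁ c₁ K₂ c₂ L →
      ∃ L₁ : Set (ConfCantor.RelConf B₁ B₂),
        ConfCantor.IsImmediatelyRecurrent K₁ c₁ K₂ c₂ L₁ ∧ L ⊆ L₁) ∧
    -- (2) persistence of recurrence, with base points close to the given ones
    (∀ L : Set (ConfCantor.RelConf B₁ B₂), ConfCantor.IsRecurrent K₁ c₁ K₂ c₂ L →
      ∀ η > 0, ∃ δ > 0, ∀ (M₁ : ConfCantor.ConformalCantor B₁ ε)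
        (M₂ : ConfCantor.ConformalCantor B₂ ε), K₁.Near δ M₁ → K₂.Near δ M₂ →
        ∃ (d₁ : A₁ → ℂ) (d₂ : A₂ → ℂ), M₁.IsBase d₁ ∧ M₂.IsBase d₂ ∧
          (∀ a, ‖d₁ a - c₁ a‖ < η) ∧ (∀ a, ‖d₂ a - c₂ a‖ < η) ∧
          ConfCantor.IsRecurrent M₁ d₁ M₂ d₂ L) ∧
    -- (2) persistence of immediate recurrence
    (∀ L : Set (ConfCantor.RelConf B₁ B₂), ConfCantor.IsImmediatelyRecurrent K₁ c₁ K₂ c₂ L →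
      ∀ η > 0, ∃ δ > 0, ∀ (M₁ : ConfCantor.ConformalCantor B₁ ε)
        (M₂ : ConfCantor.ConformalCantor B₂ ε), K₁.Near δ M₁ → K₂.Near δ M₂ →
        ∃ (d₁ : A₁ → ℂ) (d₂ : A₂ → ℂ), M₁.IsBase d₁ ∧ M₂.IsBase d₂ ∧
          (∀ a, ‖d₁ a - c₁ a‖ < η) ∧ (∀ a, ‖d₂ a - c₂ a‖ < η) ∧
          ConfCantor.IsImmediatelyRecurrent M₁ d₁ M₂ d₂ L) ∧
    -- (3) the elements of a recurrent compact set have stable intersections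
    (∀ L : Set (ConfCantor.RelConf B₁ B₂), ConfCantor.IsRecurrent K₁ c₁ K₂ c₂ L →
      ∀ (S₁ S₂ : ConfCantor.AffC) (θ₁ : ConfCantor.NegSeq B₁) (θ₂ : ConfCantor.NegSeq B₂),
        ConfCantor.RelConf.mk (S₁, θ₁) (S₂, θ₂) ∈ L →
        ConfCantor.HasStableIntersections K₁ K₂ (θ₁.1 0) (θ₂.1 0)
          (fun z => S₁.app (K₁.limGeom c₁ θ₁ z)) (fun z => S₂.app (K₂.limGeom c₂ θ₂ z))) := by
  refine ⟨fun L hL => ?_, fun L hL η hη => ?_, fun L hL η hη => ?_, fun L hL S₁ S₂ θ₁ θ₂ h => ?_⟩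
  · obtain ⟨L₁, h₁, h₂⟩ := hL.exists_isImmediatelyRecurrent hε₀ hε₁ hc₁ hc₂
    exact ⟨L₁, h₁, h₂.trans interior_subset⟩
  · exact hL.persistence hε₀ hε₁ hc₁ hc₂ hη
  · exact hL.persistence hε₀ hε₁ hc₁ hc₂ hη
  · exact hL.hasStableIntersections hε₀ hε₁ hc₁ hc₂ h
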